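/- Conventions. $\mathrm{Mod}_\theta g(x)=e^{2\pi i\theta x}g(x)$, $\widehat h(\xi)=\int h(x)e^{-2\pi i x\xi}\,dx$, $\langle f,h\rangle=\int f\overline h$, and $\|F\|_{1,\infty}=\sup_{t>0}t\,|\{x:F(x)>t\}|$. For a bounded interval $I$ with length $|I|$ and center $c(I)$ put $\chi_I(x)=\big(1+\frac{(x-c(I))^2}{|I|^2}\big)^{-1/2}$. A *grid* is a collection of closed intervals (not necessarily dyadic) of lengths $2^k$, $k\in\mathbf Z$, any two of which are either nested or disjoint up to endpoints. Let ${\mathcal S}=\{[2^il,2^i(l+1)]:i,l\in\mathbf Z\}$ and $\Delta=1000$. **Theorem.** Let ${\mathcal G},{\mathcal G}_1,{\mathcal G}_2,{\mathcal G}_3$ be grids such that ${\mathcal G}\subset{\mathcal S}$ and such that $\max\{|I||I'|^{-1},|I'||I|^{-1}\}\ge 2^{\Delta}$ whenever $I,I'\in{\mathcal G}$ have different lengths. Let $e$ be an integer with $10^2<|e|\le 10^5$. Let ${\bf D}$ be the set of all products $$\prod_{j=1}^{3}\Big[\tfrac{l_j}{5}2^i,\big(\tfrac{l_j}{5}+1\big)2^i\Big],\qquad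 i,l_1,l_2,l_3\in\mathbf Z,\quad l_2=l_1+e,\quad l_3=l_1+l_2,$$ whose $j$-th factor belongs to ${\mathcal G}_j$ for $j=1,2,3$. Let ${\bf S}$ be the set of all multitiles $s=I_s\times\omega_{s,1}\times\omega_{s,2}\times\omega_{s,3}$ with $I_s\in{\mathcal G}$ and $\omega_{s,1}\times\omega_{s,2}\times\omega_{s,3}\in{\bf D}$ of sidelength $1/|I_s|$. Suppose that each $s\in{\bf S}$ is associated with smooth functions $\psi_{s,1},\psi_{s,2},\psi_{s,3}:\mathbf R\to\mathbf C$ such that for $j=1,2,3$ $$\Big|\frac{d^n}{dx^n}\mathrm{Mod}_{-c(\omega_{s,j})}\psi_{s,j}(x)\Big|\le A_{n,M}\,|I_s|^{-1/2-n}\chi_{I_s}(x)^M\qquad (n,M\in\mathbf N_0,\ x\in\mathbf R),\qquad \operatorname{supp}\widehat{\psi}_{s,j}\subset\omega_{s,j}.$$ Then, for all $f,g\in L^2(\mathbf R)$, each of the sums over $s$ below converges absolutely at every $x\in\mathbf R$, and $$\Big\|\Big(\sum_{k\in\mathbf Z}\Big|\sum_{s\in{\bf S},\ |I_s|=2^k}|I_s|^{-1/2}\langle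 f,\psi_{s,1}\rangle\langle g,\psi_{s,2}\rangle\psi_{s,3}\Big|^2\Big)^{1/2}\Big\|_{1,\infty}\le C\,\|f\|_2\|g\|_2,$$ where $C$ depends only on the constants $(A_{n,M})_{n,M\ge0}$. -/

import Mathlib

open MeasureTheory Set
open scoped NNReal ENNReal FourierTransform ContDiff ComplexConjugate

noncomputable section

namespace BilinearModel

/-- The length `|I|` of an interval `I ⊆ ℝ`. -/
def len (I : Set ℝ) : ℝ := volume.real I

/-- The center `c(I)` of a bounded interval `I ⊆ ℝ`. -/
def center (I : Set ℝ) : ℝ := (sInf I + sSup I) / 2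

/-- The bump `χ_I(x) = (1 + (x - c(I))² / |I|²)^(-1/2)`. -/
def chi (I : Set ℝ) (x : ℝ) : ℝ := (1 + (x - center I) ^ 2 / len I ^ 2) ^ (-(1 / 2) : ℝ)

/-- The modulation `Mod_θ g (x) = e^{2π i θ x} g(x)`. -/
def modulate (θ : ℝ) (g : ℝ → ℂ) (x : ℝ) : ℂ :=
  Complex.exp (2 * Real.pi * Complex.I * θ * x) * g x

/-- A grid: a collection of closed intervals (not necessarily dyadic) whose lengths are integer
powers of two and any two of which are nested or disjoint. Intervals are closed, so "disjoint" is
up to endpoints, as it must be for the standard dyadic intervals to form a grid. -/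
structure IsGrid (𝒢 : Set (Set ℝ)) : Prop where
  nested : ∀ I ∈ 𝒢, ∀ I' ∈ 𝒢, len I' ≤ len I → I' ⊆ I ∨ Disjoint (interior I) (interior I')
  dyadic_length : ∀ I ∈ 𝒢, ∃ (a : ℝ) (k : ℤ), I = Icc a (a + 2 ^ k)

/-- The standard dyadic grid `{[2^i l, 2^i (l+1)] : i, l ∈ ℤ}`. -/
def standardGrid : Set (Set ℝ) :=
  {I | ∃ i l : ℤ, I = Icc ((2 : ℝ) ^ i * l) ((2 : ℝ) ^ i * (l + 1))}

/-- Scale separation: two intervals of the collection with different lengths have lengths whose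
ratio (larger over smaller) is at least `2^Δ`. -/
def IsSparse (Δ : ℕ) (𝒢 : Set (Set ℝ)) : Prop :=
  ∀ I ∈ 𝒢, ∀ I' ∈ 𝒢, len I ≠ len I' → (2 : ℝ) ^ Δ ≤ max (len I / len I') (len I' / len I)

/-- A box `I × freq 0 × freq 1 × freq 2`, given by its time interval and its frequency intervals. -/
@[ext] structure Multitile where
  /-- the time interval -/
  I : Set ℝ
  /-- the three frequency intervals -/
  freq : Fin 3 → Set ℝ

/-- The collection `D` of frequency cubes: products of the intervals
`[(l_j/5) 2^i, (l_j/5 + 1) 2^i]`, the `j`-th of which belongs to the `j`-th grid, with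
`l_2 = l_1 + e` and `l_3 = l_1 + l_2`. The indices `1, 2, 3` are `0, 1, 2 : Fin 3`. -/
def freqCubes (𝒢f : Fin 3 → Set (Set ℝ)) (e : ℤ) : Set (Fin 3 → Set ℝ) :=
  {Q | ∃ (i : ℤ) (l : Fin 3 → ℤ),
    (∀ j, Q j = Icc ((l j / 5 : ℝ) * 2 ^ i) ((l j / 5 + 1 : ℝ) * 2 ^ i)) ∧ (∀ j, Q j ∈ 𝒢f j) ∧
      l 1 = l 0 + e ∧ l 2 = l 0 + l 1}

/-- The collection `S` of multitiles `I × Q`, with `I` in the time grid and `Q` in `D` of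
sidelength `1 / |I|`. -/
def multitiles (𝒢 : Set (Set ℝ)) (𝒢f : Fin 3 → Set (Set ℝ)) (e : ℤ) : Set Multitile :=
  {s | s.I ∈ 𝒢 ∧ s.freq ∈ freqCubes 𝒢f e ∧ ∀ j, len (s.freq j) = 1 / len s.I}

/-- The functions `ψ s j` are smooth wave packets adapted to the multitiles `s ∈ S`, with constants
`A n M` in the decay estimates, and with Fourier transforms supported in `s.freq j`. -/
structure IsWavePackets (A : ℕ → ℕ → ℝ) (S : Set Multitile) (ψ : Multitile → Fin 3 → ℝ → ℂ) :
    Prop where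
  smooth : ∀ s ∈ S, ∀ j, ContDiff ℝ ∞ (ψ s j)
  decay : ∀ s ∈ S, ∀ j, ∀ (n M : ℕ) (x : ℝ),
    ‖iteratedDeriv n (modulate (-center (s.freq j)) (ψ s j)) x‖ ≤
      A n M * len s.I ^ (-(1 / 2) - n : ℝ) * chi s.I x ^ M
  fourier_support : ∀ s ∈ S, ∀ j, tsupport (𝓕 (ψ s j)) ⊆ s.freq j

/-- The pairing `⟨f, h⟩ = ∫ f conj(h)`. -/
def pairing (f h : ℝ → ℂ) : ℂ := ∫ x, f x * conj (h x)

/-- The summand `|I_s|^{-1/2} ⟨f, ψ_{s,1}⟩ ⟨g, ψ_{s,2}⟩ ψ_{s,3}(x)` of the model sum. -/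
def modelTerm (ψ : Multitile → Fin 3 → ℝ → ℂ) (f g : ℝ → ℂ) (x : ℝ) (s : Multitile) : ℂ :=
  ((len s.I ^ (-(1 / 2) : ℝ) : ℝ) : ℂ) * pairing f (ψ s 0) * pairing g (ψ s 1) * ψ s 2 x

/-- The multitiles of `S` at scale `k`, i.e. with `|I_s| = 2^k`. -/
def atScale (S : Set Multitile) (k : ℤ) : Set Multitile := {s ∈ S | len s.I = 2 ^ k}

/-- The square function `(∑_k |∑_{s ∈ S, |I_s| = 2^k} modelTerm s|²)^{1/2}`, with values in
`[0, ∞]`. -/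
def squareFunction (S : Set Multitile) (ψ : Multitile → Fin 3 → ℝ → ℂ) (f g : ℝ → ℂ) (x : ℝ) :
    ℝ≥0∞ :=
  (∑' k : ℤ, ‖∑' s : atScale S k, modelTerm ψ f g x s‖ₑ ^ 2) ^ (1 / 2 : ℝ)

/-- The weak norm `‖F‖_{1,∞} = sup_{t > 0} t |{x : F(x) > t}|`. -/
def weakL1Norm (F : ℝ → ℝ≥0∞) : ℝ≥0∞ := ⨆ t : ℝ≥0, (t : ℝ≥0∞) * volume {x | (t : ℝ≥0∞) < F x}

end BilinearModel

end

open BilinearModel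

/-!
By bilinearity it suffices to bound the measure of the set where the square function exceeds `1`
by a multiple of `N`, when `‖f‖₂²` and `‖g‖₂²` are at most `N` (`weakL1Norm_squareFunction_le`).

Let `Ω` be the union of the balls on which the average of `|f|²` or of `|g|²` exceeds `1/2`. Its
measure is at most a multiple of `N` by Vitali's covering lemma (`volume_exceptional_le`), so by
Chebyshev's inequality it is enough to integrate the square of the square function over `Ωᶜ`. At
this point the third functions disappear: within one scale, packets of different frequencies are
orthogonal, and they remain so after multiplication by the polynomial weight
`1 + ((x - c(I)) / |I|)²`, which does not enlarge Fourier supports (`isPacket_weight_mul`).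
Therefore each scale contributes at most a multiple of the sum over its tiles of
`q_s⁻⁴ |I_s|⁻¹ |⟨f, ψ_{s,1}⟩|² |⟨g, ψ_{s,2}⟩|²`, where `q_s ≥ 1` is the weight of `I_s` at the
point of `Ωᶜ` nearest to the center of `I_s` (`setIntegral_norm_sum_sq_le`). The square function
adds the scales without interaction, so what remains is the sum of these quantities over all `s`.

The damping factors `q_s⁻¹` are distributed over the two coefficients. This bounds the sizes of
the damped coefficients, that is, their square sums over lacunary trees divided by the length of
the top: the square sum over a lacunary tree is localised to the top, again by multiplication of
the packets by a polynomial weight (`sum_inLac_le`), and local averages of `|f|²` are under control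
at points of `Ωᶜ` (`integral_mul_weight_le`, `sizeLE_of_damped`).

The sum is then estimated by the time-frequency method (`sum_coeff_sq_mul_le`). A greedy selection,
which removes whole trees in the order of their top frequencies, halves the sizes
(`exists_selection`); it produces strongly disjoint lacunary trees, and Bessel's inequality for
such forests bounds the total length of the tops of the removed trees (`forest_bessel`). On a
single tree, the square sum of one function is multiplied by the maximum of the coefficients of the
other (`sum_tree_le`). This is possible since `|e| > 100`: the two frequency intervals of a
multitile cannot both be close to the top frequency, so a tree is covered by four lacunary parts.
Summation over the generations gives a geometric series.

Only the decay of the packets and their Fourier supports enter, and no bounds on derivatives.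
Absolute convergence of the sum over one scale is Bessel's inequality for `f` and for `g`
(`summable_norm_coeff`).
-/

namespace BilinearModel

/-! ### Polynomial weights -/

/-- The weight `1 + ((x - c) / L)²` of an interval with center `c` and length `L`; it is
`χ_I(x)⁻²`. A polynomial in `x`, so that multiplying by it does not enlarge Fourier supports. -/
noncomputable def weight (c L x : ℝ) : ℝ := 1 + ((x - c) / L) ^ 2

lemma one_le_weight (c L x : ℝ) : 1 ≤ weight c L x := by
  unfold weight; nlinarith [sq_nonneg ((x - c) / L)]

lemma weight_pos (c L x : ℝ) : 0 < weight c L x := one_pos.trans_le (one_le_weight c L x)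

lemma weight_inv_le_one (c L x : ℝ) : (weight c L x)⁻¹ ≤ 1 :=
  inv_le_one_of_one_le₀ (one_le_weight c L x)

lemma weight_inv_nonneg (c L x : ℝ) : 0 ≤ (weight c L x)⁻¹ := (inv_pos.2 (weight_pos c L x)).le

lemma weight_comm (c L x : ℝ) : weight c L x = weight x L c := by
  unfold weight; ring

@[fun_prop]
lemma continuous_weight (c L : ℝ) : Continuous (weight c L) := by
  unfold weight; fun_prop

@[fun_prop]
lemma continuous_weight_inv (c L : ℝ) : Continuous fun x => (weight c L x)⁻¹ :=
  (continuous_weight c L).inv₀ fun x => (weight_pos c L x).ne'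

/-- Peetre's inequality. -/
lemma weight_le_mul (c L x y : ℝ) : weight c L x ≤ 2 * weight c L y * weight y L x := by
  unfold weight
  have h : (x - c) / L = (x - y) / L + (y - c) / L := by ring
  rw [h]
  set a := (x - y) / L
  set b := (y - c) / L
  nlinarith [sq_nonneg (a - b), mul_nonneg (sq_nonneg a) (sq_nonneg b)]

lemma weight_mono {c x : ℝ} {L L' : ℝ} (hL' : 0 < L') (h : L' ≤ L) :
    weight c L x ≤ weight c L' x := by
  unfold weight
  have : ((x - c) / L) ^ 2 ≤ ((x - c) / L') ^ 2 := by
    rw [div_pow, div_pow]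
    gcongr
  linarith

lemma weight_mono_of_abs_le {c c' x x' L : ℝ} (h : |x - c| ≤ |x' - c'|) :
    weight c L x ≤ weight c' L x' := by
  unfold weight
  have : ((x - c) / L) ^ 2 ≤ ((x' - c') / L) ^ 2 := by
    rw [div_pow, div_pow]
    have := sq_le_sq.2 h
    gcongr
  linarith

/-- The weight is comparable to `1` on the interval itself. -/
lemma weight_le_of_abs_le {c L x : ℝ} (hL : 0 < L) (h : |x - c| ≤ L / 2) :
    weight c L x ≤ 5 / 4 := by
  unfold weight
  have h1 : |(x - c) / L| ≤ 1 / 2 := by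
    rw [abs_div, abs_of_pos hL, div_le_iff₀ hL]; linarith
  have := sq_le_sq' (by linarith [abs_le.1 h1 |>.1]) (abs_le.1 h1).2
  norm_num at this
  linarith

/-- The weights of two intervals dominate the weight of the larger one on the smaller one. -/
lemma weight_le_mul_weight {c c' L L' x' : ℝ} (hL' : 0 < L') (h : L' ≤ L)
    (hx' : |x' - c'| ≤ L' / 2) (y : ℝ) :
    weight c L x' ≤ 5 * (weight c L y * weight c' L' y) := by
  have h1 := weight_le_mul c L x' y
  have h2 : weight y L x' ≤ 2 * weight c' L' y * (5 / 4) := by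
    calc weight y L x' ≤ weight y L' x' := weight_mono hL' h
      _ ≤ 2 * weight y L' c' * weight c' L' x' := weight_le_mul _ _ _ _
      _ ≤ 2 * weight y L' c' * (5 / 4) := by
        gcongr
        · have := weight_pos y L' c'; positivity
        · exact weight_le_of_abs_le hL' hx'
      _ = _ := by rw [weight_comm]
  have := weight_pos c L y
  nlinarith

/-- Moving the center of the weight inside the interval costs a constant. -/
lemma weight_le_of_mem {c L y : ℝ} (hL : 0 < L) (hy : |y - c| ≤ L / 2) (x : ℝ) :
    weight y L x ≤ 5 / 2 * weight c L x := by
  have h1 := weight_le_mul y L x c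
  have h2 := weight_le_of_abs_le hL hy
  rw [weight_comm] at h2
  have := weight_pos c L x
  nlinarith

lemma weight_inv_le_of_mem {c L y : ℝ} (hL : 0 < L) (hy : |y - c| ≤ L / 2) (x : ℝ) :
    (weight c L x)⁻¹ ≤ 5 / 2 * (weight x L y)⁻¹ := by
  have h := weight_le_of_mem hL hy x
  rw [weight_comm y] at h
  rw [inv_eq_one_div, inv_eq_one_div, mul_one_div, div_le_div_iff₀ (weight_pos _ _ _)
    (weight_pos _ _ _)]
  linarith

lemma integrable_weight_inv (c : ℝ) {L : ℝ} (hL : 0 < L) :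
    Integrable fun x => (weight c L x)⁻¹ := by
  have h := (integrable_inv_one_add_sq.comp_div hL.ne').comp_sub_right c
  simpa [weight] using h

lemma integral_weight_inv (c : ℝ) {L : ℝ} (hL : 0 < L) :
    ∫ x, (weight c L x)⁻¹ = Real.pi * L := by
  have h := integral_sub_right_eq_self (fun x : ℝ => (1 + (x / L) ^ 2)⁻¹) c (μ := volume)
  have h2 := Measure.integral_comp_div (fun x : ℝ => (1 + x ^ 2)⁻¹) L
  simp only [weight]
  rw [h, h2, integral_univ_inv_one_add_sq, abs_of_pos hL]
  simp [mul_comm]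

lemma integrable_weight_inv_pow (c : ℝ) {L : ℝ} (hL : 0 < L) (m : ℕ) :
    Integrable fun x => (weight c L x)⁻¹ ^ (m + 1) := by
  refine (integrable_weight_inv c hL).mono'
    ((continuous_weight_inv c L).pow _).aestronglyMeasurable (.of_forall fun x => ?_)
  rw [Real.norm_of_nonneg (pow_nonneg (weight_inv_nonneg _ _ _) _)]
  exact pow_le_of_le_one (weight_inv_nonneg _ _ _) (weight_inv_le_one _ _ _) (by lia)

lemma integral_weight_inv_sq_le (c : ℝ) {L : ℝ} (hL : 0 < L) :
    ∫ x, (weight c L x)⁻¹ ^ 2 ≤ Real.pi * L := by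
  rw [← integral_weight_inv c hL]
  refine integral_mono (integrable_weight_inv_pow c hL 1) (integrable_weight_inv c hL) fun x => ?_
  exact pow_le_of_le_one (weight_inv_nonneg _ _ _) (weight_inv_le_one _ _ _) (by lia)

/-! ### Wave packets and their inner products -/

lemma tsupport_fourier_add {φ φ' : ℝ → ℂ} {Ω : Set ℝ} (hΩ : IsClosed Ω) (hφ : Integrable φ)
    (hφ' : Integrable φ') (h : tsupport (𝓕 φ) ⊆ Ω) (h' : tsupport (𝓕 φ') ⊆ Ω) :
    tsupport (𝓕 fun x => φ x + φ' x) ⊆ Ω := by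
  refine closure_minimal ?_ hΩ
  have e : 𝓕 (fun x => φ x + φ' x) = 𝓕 φ + 𝓕 φ' :=
    VectorFourier.fourierIntegral_add Real.continuous_fourierChar (by exact continuous_inner)
      hφ hφ'
  rw [e]
  exact (Function.support_add _ _).trans (union_subset ((subset_tsupport _).trans h)
    ((subset_tsupport _).trans h'))

lemma fourier_const_mul (a : ℂ) (φ : ℝ → ℂ) : 𝓕 (fun x => a * φ x) = a • 𝓕 φ := by
  ext w
  simp only [Real.fourier_eq, Pi.smul_apply, smul_eq_mul, ← integral_const_mul]
  congr 1; ext v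
  simp only [Circle.smul_def, smul_eq_mul]; ring

lemma tsupport_fourier_const_mul (a : ℂ) (φ : ℝ → ℂ) :
    tsupport (𝓕 fun x => a * φ x) ⊆ tsupport (𝓕 φ) := by
  refine closure_mono ?_
  rw [fourier_const_mul]
  exact Function.support_const_smul_subset _ _

/-- A wave packet with constant `B`, localised in time to the interval with center `c` and
length `L` and in frequency to the set `Ω`. Only decay is recorded, no derivative bound: the
Fourier support is all the regularity that the argument needs. -/
structure IsPacket (c L : ℝ) (Ω : Set ℝ) (B : ℝ) (φ : ℝ → ℂ) : Prop where
  continuous : Continuous φ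
  bound : ∀ x, ‖φ x‖ ≤ B * (√L)⁻¹ * (weight c L x)⁻¹ ^ 3
  support : tsupport (𝓕 φ) ⊆ Ω

namespace IsPacket

variable {c c' L L' B : ℝ} {Ω Ω' : Set ℝ} {φ φ' : ℝ → ℂ}

lemma const_nonneg (h : IsPacket c L Ω B φ) (hL : 0 < L) : 0 ≤ B := by
  have h1 := (norm_nonneg _).trans (h.bound c)
  have h2 : 0 < (√L)⁻¹ * (weight c L c)⁻¹ ^ 3 := by
    have := weight_pos c L c
    positivity
  rw [mul_assoc] at h1
  exact nonneg_of_mul_nonneg_left h1 h2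

lemma integrable (h : IsPacket c L Ω B φ) (hL : 0 < L) : Integrable φ :=
  ((integrable_weight_inv_pow c hL 2).const_mul _).mono' h.continuous.aestronglyMeasurable
    (.of_forall h.bound)

lemma memLp (h : IsPacket c L Ω B φ) (hL : 0 < L) : MemLp φ 2 := by
  rw [memLp_two_iff_integrable_sq_norm h.continuous.aestronglyMeasurable]
  refine ((integrable_weight_inv_pow c hL 5).const_mul ((B * (√L)⁻¹) ^ 2)).mono'
    (h.continuous.norm.pow 2).aestronglyMeasurable (.of_forall fun x => ?_)
  rw [Real.norm_of_nonneg (by positivity)]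
  calc ‖φ x‖ ^ 2 ≤ (B * (√L)⁻¹ * (weight c L x)⁻¹ ^ 3) ^ 2 := by gcongr; exact h.bound x
    _ = _ := by ring

lemma mono_const (h : IsPacket c L Ω B φ) {B' : ℝ} (hB : B ≤ B') : IsPacket c L Ω B' φ where
  continuous := h.continuous
  bound x := (h.bound x).trans (by have := weight_inv_nonneg c L x; gcongr)
  support := h.support

lemma const_mul (h : IsPacket c L Ω B φ) {a : ℂ} (ha : ‖a‖ ≤ 1) :
    IsPacket c L Ω B fun x => a * φ x where
  continuous := by have := h.continuous; fun_prop
  bound x := by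
    rw [norm_mul]
    exact (mul_le_of_le_one_left (norm_nonneg _) ha).trans (h.bound x)
  support := (tsupport_fourier_const_mul a φ).trans h.support

end IsPacket

/-- Parseval: functions with Fourier supports in non-overlapping intervals are orthogonal. -/
lemma integral_inner_eq_zero {φ φ' : ℝ → ℂ} (hc' : Continuous φ')
    (hφ : Integrable φ) (hφ' : Integrable φ') {a b a' b' : ℝ}
    (hs : tsupport (𝓕 φ) ⊆ Icc a b) (hs' : tsupport (𝓕 φ') ⊆ Icc a' b')
    (hdis : Disjoint (Ioo a b) (Ioo a' b')) :
    ∫ x, inner ℂ (φ x) (φ' x) = 0 := by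
  have hcont : Continuous (𝓕 φ') :=
    VectorFourier.fourierIntegral_continuous Real.continuous_fourierChar
      (by exact continuous_inner) hφ'
  have hint : Integrable (𝓕 φ') := by
    refine hcont.integrable_of_hasCompactSupport ?_
    exact isCompact_Icc.of_isClosed_subset (isClosed_tsupport _) hs'
  have h := VectorFourier.integral_sesq_fourierIntegral_eq_neg_flip (innerSL ℂ (E := ℂ))
    (μ := volume) (ν := volume) (L := innerₗ ℝ) (e := Real.fourierChar)
    Real.continuous_fourierChar (by exact continuous_inner) hφ hint
  have hinv : ∀ x, VectorFourier.fourierIntegral Real.fourierChar volume (-(innerₗ ℝ).flip)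
      (𝓕 φ') x = φ' x := by
    intro x
    have h1 := congrFun (hc'.fourierInv_fourier_eq hφ' hint) x
    rw [← h1, Real.fourierInv_eq]
    simp [VectorFourier.fourierIntegral]
  simp only [hinv] at h
  have h0 : ∫ ξ, (innerSL ℂ (E := ℂ)) (𝓕 φ ξ) (𝓕 φ' ξ) = 0 := by
    refine integral_eq_zero_of_ae ?_
    have hfin : (({a, b, a', b'} : Set ℝ))ᶜ ∈ ae (volume : Measure ℝ) :=
      compl_mem_ae_iff.2 (Set.Finite.measure_zero (by simp) _)
    filter_upwards [hfin] with ξ hξ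
    simp only [mem_compl_iff, mem_insert_iff, mem_singleton_iff, not_or] at hξ
    by_cases h1 : 𝓕 φ ξ = 0
    · simp [h1]
    by_cases h2 : 𝓕 φ' ξ = 0
    · simp [h2]
    have m1 := hs (subset_tsupport _ (Function.mem_support.2 h1))
    have m2 := hs' (subset_tsupport _ (Function.mem_support.2 h2))
    exact absurd ⟨lt_of_le_of_ne m2.1 (Ne.symm hξ.2.2.1), lt_of_le_of_ne m2.2 hξ.2.2.2⟩
      (Set.disjoint_left.1 hdis
        ⟨lt_of_le_of_ne m1.1 (Ne.symm hξ.1), lt_of_le_of_ne m1.2 hξ.2.1⟩)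
  exact h.symm.trans h0

/-- The interaction of two packets with `L' ≤ L` decays like the weight of the longer interval
on the shorter one. The factor `√L'` is put on the left because in a forest the coefficient at
the shorter interval is of size `√L'`. -/
lemma sqrt_mul_norm_integral_inner_le {c c' L L' B : ℝ} {Ω Ω' : Set ℝ} {φ φ' : ℝ → ℂ}
    (h : IsPacket c L Ω B φ) (h' : IsPacket c' L' Ω' B φ') (hL' : 0 < L') (hLL : L' ≤ L) :
    √L' * ‖∫ x, inner ℂ (φ x) (φ' x)‖ ≤
      100 * B ^ 2 * (√L)⁻¹ * ∫ x in Ioo (c' - L' / 2) (c' + L' / 2), (weight c L x)⁻¹ ^ 2 := by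
  have hL : 0 < L := hL'.trans_le hLL
  have hB := h.const_nonneg hL
  set N := ‖∫ x, inner ℂ (φ x) (φ' x)‖
  have key : ∀ x' ∈ Ioo (c' - L' / 2) (c' + L' / 2),
      √L' * N ≤ 100 * B ^ 2 * (√L)⁻¹ * L' * (weight c L x')⁻¹ ^ 2 := by
    intro x' hx'
    have hx : |x' - c'| ≤ L' / 2 := by rw [abs_le]; constructor <;> linarith [hx'.1, hx'.2]
    have hpt : ∀ y, ‖inner ℂ (φ y) (φ' y)‖ ≤
        25 * B ^ 2 * (√L)⁻¹ * (√L')⁻¹ * (weight c L x')⁻¹ ^ 2 * (weight c' L' y)⁻¹ := by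
      intro y
      have hw := weight_le_mul_weight (c := c) hL' hLL hx y
      have p1 := weight_pos c L y
      have p2 := weight_pos c' L' y
      have p3 := weight_pos c L x'
      have hw' : (weight c L y)⁻¹ * (weight c' L' y)⁻¹ ≤ 5 * (weight c L x')⁻¹ := by
        rw [← mul_inv, inv_eq_one_div, inv_eq_one_div, mul_one_div,
          div_le_div_iff₀ (by positivity) p3]
        linarith
      have q1 := weight_inv_nonneg c L y
      have q2 := weight_inv_nonneg c' L' y
      have q3 := weight_inv_nonneg c L x'
      have q1' := weight_inv_le_one c L y
      calc ‖inner ℂ (φ y) (φ' y)‖ ≤ ‖φ y‖ * ‖φ' y‖ := norm_inner_le_norm _ _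
        _ ≤ (B * (√L)⁻¹ * (weight c L y)⁻¹ ^ 3) * (B * (√L')⁻¹ * (weight c' L' y)⁻¹ ^ 3) :=
          mul_le_mul (h.bound y) (h'.bound y) (norm_nonneg _) (by positivity)
        _ = B ^ 2 * (√L)⁻¹ * (√L')⁻¹ * ((weight c L y)⁻¹ * (weight c' L' y)⁻¹) ^ 2 *
            (weight c' L' y)⁻¹ * (weight c L y)⁻¹ := by ring
        _ ≤ B ^ 2 * (√L)⁻¹ * (√L')⁻¹ * (5 * (weight c L x')⁻¹) ^ 2 *
            (weight c' L' y)⁻¹ * 1 := by gcongr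
        _ = _ := by ring
    have hN : N ≤ 25 * B ^ 2 * (√L)⁻¹ * (√L')⁻¹ * (weight c L x')⁻¹ ^ 2 * (Real.pi * L') := by
      rw [← integral_weight_inv c' hL', ← integral_const_mul]
      exact norm_integral_le_of_norm_le ((integrable_weight_inv c' hL').const_mul _)
        (.of_forall hpt)
    have hs : √L' * (√L')⁻¹ = 1 := mul_inv_cancel₀ (Real.sqrt_pos.2 hL').ne'
    have q3 := weight_inv_nonneg c L x'
    calc √L' * N ≤ √L' *
          (25 * B ^ 2 * (√L)⁻¹ * (√L')⁻¹ * (weight c L x')⁻¹ ^ 2 * (Real.pi * L')) := by gcongr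
      _ = (√L' * (√L')⁻¹) * (25 * Real.pi) * B ^ 2 * (√L)⁻¹ * L' * (weight c L x')⁻¹ ^ 2 := by ring
      _ ≤ 100 * B ^ 2 * (√L)⁻¹ * L' * (weight c L x')⁻¹ ^ 2 := by
        rw [hs, one_mul]
        have := Real.pi_le_four
        gcongr
        linarith
  have hvol : volume.real (Ioo (c' - L' / 2) (c' + L' / 2)) = L' := by
    rw [Real.volume_real_Ioo_of_le (by linarith)]; ring
  have hI := setIntegral_mono_on (μ := volume) (s := Ioo (c' - L' / 2) (c' + L' / 2))
    (f := fun _ => √L' * N) (integrable_const _)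
    (((integrable_weight_inv_pow c hL 1).const_mul
      (100 * B ^ 2 * (√L)⁻¹ * L')).integrableOn) measurableSet_Ioo key
  rw [setIntegral_const, hvol, integral_const_mul, smul_eq_mul] at hI
  have : L' * (√L' * N) ≤ L' * (100 * B ^ 2 * (√L)⁻¹ *
      ∫ x in Ioo (c' - L' / 2) (c' + L' / 2), (weight c L x)⁻¹ ^ 2) := by
    refine hI.trans (le_of_eq ?_); ring
  exact le_of_mul_le_mul_left this hL'

/-- Multiplication by `x` preserves the Fourier support: it differentiates the transform. -/
lemma tsupport_fourier_mul_id {φ : ℝ → ℂ} (hφ : Integrable φ)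
    (hφ' : Integrable fun x : ℝ => (x : ℂ) * φ x) :
    tsupport (𝓕 fun x : ℝ => (x : ℂ) * φ x) ⊆ tsupport (𝓕 φ) := by
  have h := Real.deriv_fourier hφ (by simpa using hφ')
  refine Subset.trans (closure_mono ?_) (tsupport_deriv_subset (f := 𝓕 φ))
  rw [h]
  intro ξ hξ
  have e : 𝓕 (fun x : ℝ => (-2 * Real.pi * Complex.I * x) • φ x) ξ =
      (-2 * Real.pi * Complex.I) * 𝓕 (fun x : ℝ => (x : ℂ) * φ x) ξ := by
    simp only [Real.fourier_eq, ← integral_const_mul]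
    congr 1; ext v
    simp only [Circle.smul_def, smul_eq_mul]; ring
  rw [Function.mem_support] at hξ ⊢
  rw [e]
  refine mul_ne_zero ?_ hξ
  simp [Real.pi_ne_zero]

/-- Multiplication by a polynomial weight preserves the Fourier support. -/
lemma tsupport_fourier_weight_mul {φ : ℝ → ℂ} {Ω : Set ℝ} (hΩ : IsClosed Ω) (c L : ℝ)
    (hc : Continuous φ) (hint : Integrable fun x => (weight c L x : ℂ) * φ x)
    (h : tsupport (𝓕 φ) ⊆ Ω) :
    tsupport (𝓕 fun x => (weight c L x : ℂ) * φ x) ⊆ Ω := by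
  have key : ∀ g : ℝ → ℂ, Continuous g → (∀ x, ‖g x‖ ≤ weight c L x) →
      Integrable fun x => g x * φ x := fun g hg hgw => by
    refine hint.norm.mono' (hg.mul hc).aestronglyMeasurable (.of_forall fun x => ?_)
    rw [norm_mul, norm_mul]
    gcongr
    rw [Complex.norm_real, Real.norm_of_nonneg (weight_pos _ _ _).le]
    exact hgw x
  have hφ : Integrable φ := by
    simpa using key (fun _ => 1) continuous_const fun x => by simpa using one_le_weight c L x
  have aff : ∀ g : ℝ → ℂ, Integrable g → (Integrable fun x => (((x - c) / L : ℝ) : ℂ) * g x) →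
      tsupport (𝓕 g) ⊆ Ω → tsupport (𝓕 fun x => (((x - c) / L : ℝ) : ℂ) * g x) ⊆ Ω := by
    intro g hg hxg hs
    by_cases hL : L = 0
    · subst hL
      simpa using (tsupport_fourier_const_mul 0 g).trans hs
    have hxg' : Integrable fun x : ℝ => (x : ℂ) * g x := by
      refine ((hxg.const_mul (L : ℂ)).add (hg.const_mul (c : ℂ))).congr (.of_forall fun x => ?_)
      have : (L : ℂ) ≠ 0 := by exact_mod_cast hL
      simp only [Pi.add_apply]; push_cast; field_simp; ring
    have e : (fun x : ℝ => (((x - c) / L : ℝ) : ℂ) * g x) =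
        fun x : ℝ => (L⁻¹ : ℂ) * ((x : ℂ) * g x) + (-c / L : ℂ) * g x := by
      ext x; push_cast; ring
    rw [e]
    exact tsupport_fourier_add hΩ (hxg'.const_mul _) (hg.const_mul _)
      ((tsupport_fourier_const_mul _ _).trans ((tsupport_fourier_mul_id hg hxg').trans hs))
      ((tsupport_fourier_const_mul _ _).trans hs)
  have h1 : Integrable fun x => (((x - c) / L : ℝ) : ℂ) * φ x := by
    refine key (fun x => (((x - c) / L : ℝ) : ℂ)) (by fun_prop) fun x => ?_
    rw [Complex.norm_real, Real.norm_eq_abs, weight]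
    nlinarith [sq_nonneg (|(x - c) / L| - 1), sq_abs ((x - c) / L)]
  have h2 : Integrable fun x => (((x - c) / L : ℝ) : ℂ) * ((((x - c) / L : ℝ) : ℂ) * φ x) := by
    refine (key (fun x => (((x - c) / L : ℝ) : ℂ) * (((x - c) / L : ℝ) : ℂ)) (by fun_prop)
      fun x => ?_).congr (.of_forall fun x => by ring)
    rw [norm_mul, Complex.norm_real, Real.norm_eq_abs, weight, ← sq, sq_abs]
    linarith
  have e : (fun x => (weight c L x : ℂ) * φ x) =
      fun x => φ x + (((x - c) / L : ℝ) : ℂ) * ((((x - c) / L : ℝ) : ℂ) * φ x) := by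
    ext x; simp only [weight]; push_cast; ring
  rw [e]
  exact tsupport_fourier_add hΩ hφ h2 h (aff _ h1 h2 (aff _ hφ h1 h))

/-- A rapidly decaying function remains a wave packet after multiplication by a weight that is
dominated by the weight of its own interval. -/
lemma isPacket_weight_mul {c L B c₀ L₀ K : ℝ} {Ω : Set ℝ} {φ : ℝ → ℂ} {m : ℕ}
    (hΩ : IsClosed Ω) (hL : 0 < L) (hB : 0 ≤ B) (hK : 0 ≤ K) (hm : 3 ≤ m) (hc : Continuous φ)
    (hbound : ∀ x, ‖φ x‖ ≤ B * (√L)⁻¹ * (weight c L x)⁻¹ ^ (m + 1))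
    (hs : tsupport (𝓕 φ) ⊆ Ω) (hw : ∀ x, weight c₀ L₀ x ≤ K * weight c L x) :
    IsPacket c L Ω (K * B) (fun x => (weight c₀ L₀ x : ℂ) * φ x) ∧
      ∀ x, ‖(weight c₀ L₀ x : ℂ) * φ x‖ ≤ K * B * (√L)⁻¹ * (weight c L x)⁻¹ ^ m := by
  have hb : ∀ x, ‖(weight c₀ L₀ x : ℂ) * φ x‖ ≤ K * B * (√L)⁻¹ * (weight c L x)⁻¹ ^ m := by
    intro x
    have p := weight_pos c L x
    have p0 := weight_pos c₀ L₀ x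
    rw [norm_mul, Complex.norm_real, Real.norm_of_nonneg p0.le]
    calc weight c₀ L₀ x * ‖φ x‖
        ≤ (K * weight c L x) * (B * (√L)⁻¹ * (weight c L x)⁻¹ ^ (m + 1)) := by
          gcongr
          · exact hw x
          · exact hbound x
      _ = K * B * (√L)⁻¹ * (weight c L x)⁻¹ ^ m * (weight c L x * (weight c L x)⁻¹) := by ring
      _ = _ := by rw [mul_inv_cancel₀ p.ne', mul_one]
  have hcont : Continuous fun x => (weight c₀ L₀ x : ℂ) * φ x := by fun_prop
  refine ⟨⟨hcont, fun x => (hb x).trans ?_, ?_⟩, hb⟩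
  · have := pow_le_pow_of_le_one (weight_inv_nonneg c L x) (weight_inv_le_one c L x) hm
    gcongr
  · refine tsupport_fourier_weight_mul hΩ c₀ L₀ hc ?_ hs
    have hint := integrable_weight_inv_pow c hL (m - 1)
    rw [Nat.sub_add_cancel (by lia)] at hint
    exact (hint.const_mul (K * B * (√L)⁻¹)).mono' hcont.aestronglyMeasurable (.of_forall hb)

/-! ### Almost orthogonality in Hilbert space -/

section Hilbert

variable {ι H : Type*} [NormedAddCommGroup H] [InnerProductSpace ℂ H]

lemma norm_sum_smul_sq_le (P : Finset ι) (v : ι → H) (a : ι → ℂ) :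
    ‖∑ s ∈ P, a s • v s‖ ^ 2 ≤
      ∑ s ∈ P, ∑ t ∈ P, ‖a s‖ * ‖a t‖ * ‖inner ℂ (v s) (v t)‖ := by
  have h : ((‖∑ s ∈ P, a s • v s‖ ^ 2 : ℝ) : ℂ) =
      ∑ s ∈ P, ∑ t ∈ P, conj (a s) * a t * inner ℂ (v s) (v t) := by
    have e := inner_self_eq_norm_sq_to_K (𝕜 := ℂ) (∑ s ∈ P, a s • v s)
    rw [Complex.ofReal_pow]
    refine e.symm.trans ?_
    rw [sum_inner]
    refine Finset.sum_congr rfl fun s _ => ?_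
    rw [inner_sum]
    refine Finset.sum_congr rfl fun t _ => ?_
    rw [inner_smul_left, inner_smul_right]; ring
  have h2 := congrArg norm h
  rw [Complex.norm_real, Real.norm_of_nonneg (by positivity)] at h2
  rw [h2]
  refine (norm_sum_le _ _).trans (Finset.sum_le_sum fun s _ => (norm_sum_le _ _).trans
    (Finset.sum_le_sum fun t _ => ?_))
  simp

/-- A Bessel inequality: the quadratic form of the Gram matrix need only be controlled at the
coefficients of `F` itself. -/
lemma sum_norm_inner_sq_le (P : Finset ι) (v : ι → H) (F : H) {K : ℝ} (hK : 0 ≤ K)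
    (h : ∑ s ∈ P, ∑ t ∈ P, ‖inner ℂ (v s) F‖ * ‖inner ℂ (v t) F‖ * ‖inner ℂ (v s) (v t)‖ ≤
      K * ∑ s ∈ P, ‖inner ℂ (v s) F‖ ^ 2) :
    ∑ s ∈ P, ‖inner ℂ (v s) F‖ ^ 2 ≤ K * ‖F‖ ^ 2 := by
  set S := ∑ s ∈ P, ‖inner ℂ (v s) F‖ ^ 2 with hS
  have hS0 : 0 ≤ S := Finset.sum_nonneg fun _ _ => by positivity
  set G := ∑ s ∈ P, (inner ℂ (v s) F) • v s
  have h1 : inner ℂ G F = (S : ℂ) := by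
    rw [sum_inner, hS]
    push_cast
    refine Finset.sum_congr rfl fun s _ => ?_
    rw [inner_smul_left, mul_comm, Complex.mul_conj, Complex.normSq_eq_norm_sq]; push_cast; rfl
  have h2 : S ≤ ‖G‖ * ‖F‖ := by
    have := norm_inner_le_norm (𝕜 := ℂ) G F
    rwa [h1, Complex.norm_real, Real.norm_of_nonneg hS0] at this
  have h3 : ‖G‖ ^ 2 ≤ K * S := (norm_sum_smul_sq_le P v _).trans h
  rcases hS0.eq_or_lt with h0 | h0
  · rw [← h0]; positivity
  have h4 : S * S ≤ (K * ‖F‖ ^ 2) * S := by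
    calc S * S ≤ (‖G‖ * ‖F‖) * (‖G‖ * ‖F‖) := mul_self_le_mul_self hS0 h2
      _ = ‖G‖ ^ 2 * ‖F‖ ^ 2 := by ring
      _ ≤ (K * S) * ‖F‖ ^ 2 := by gcongr
      _ = _ := by ring
  exact le_of_mul_le_mul_right h4 h0

end Hilbert

/-- Schur's test for a symmetric matrix. -/
lemma sum_sum_mul_le_of_row_sum_le {ι : Type*} (P : Finset ι) (a : ι → ℝ) (N : ι → ι → ℝ) {K : ℝ}
    (hN : ∀ s t, 0 ≤ N s t) (hsymm : ∀ s t, N s t = N t s)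
    (hrow : ∀ s ∈ P, ∑ t ∈ P, N s t ≤ K) :
    ∑ s ∈ P, ∑ t ∈ P, a s * a t * N s t ≤ K * ∑ s ∈ P, a s ^ 2 := by
  have h1 : ∑ s ∈ P, ∑ t ∈ P, a s ^ 2 * N s t ≤ K * ∑ s ∈ P, a s ^ 2 := by
    rw [Finset.mul_sum]
    refine Finset.sum_le_sum fun s hs => ?_
    rw [← Finset.mul_sum, mul_comm]
    exact mul_le_mul_of_nonneg_right (hrow s hs) (sq_nonneg _)
  have h2 : ∑ s ∈ P, ∑ t ∈ P, a t ^ 2 * N s t = ∑ s ∈ P, ∑ t ∈ P, a s ^ 2 * N s t := by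
    rw [Finset.sum_comm]
    simp only [hsymm]
  have h3 : 2 * ∑ s ∈ P, ∑ t ∈ P, a s * a t * N s t ≤
      ∑ s ∈ P, ∑ t ∈ P, a s ^ 2 * N s t + ∑ s ∈ P, ∑ t ∈ P, a t ^ 2 * N s t := by
    rw [Finset.mul_sum, ← Finset.sum_add_distrib]
    refine Finset.sum_le_sum fun s _ => ?_
    rw [Finset.mul_sum, ← Finset.sum_add_distrib]
    refine Finset.sum_le_sum fun t _ => ?_
    nlinarith [mul_nonneg (sq_nonneg (a s - a t)) (hN s t)]
  linarith

lemma sum_setIntegral_le {ι : Type*} (Q : Finset ι) (A : ι → Set ℝ) (E : Set ℝ) {h : ℝ → ℝ}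
    (hA : ∀ s ∈ Q, MeasurableSet (A s)) (hsub : ∀ s ∈ Q, A s ⊆ E)
    (hdis : ∀ s ∈ Q, ∀ t ∈ Q, s ≠ t → Disjoint (A s) (A t))
    (hint : Integrable h) (h0 : ∀ x, 0 ≤ h x) :
    ∑ s ∈ Q, ∫ x in A s, h x ≤ ∫ x in E, h x := by
  rw [← integral_biUnion_finset Q hA (fun s hs t ht hst => hdis s hs t ht hst)
    fun s _ => hint.integrableOn]
  exact setIntegral_mono_set hint.integrableOn (.of_forall h0)
    (LE.le.eventuallyLE (iUnion₂_subset hsub))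

lemma sum_zpow_le {k₀ : ℤ} (K : Finset ℤ) (hK : ∀ k ∈ K, k ≤ k₀) :
    ∑ k ∈ K, (2 : ℝ) ^ k ≤ 2 * 2 ^ k₀ := by
  have h1 : ∀ k ∈ K, (2 : ℝ) ^ k = 2 ^ k₀ * (1 / 2) ^ (k₀ - k).toNat := by
    intro k hk
    have : (2 : ℝ) ^ k₀ = 2 ^ k * 2 ^ (k₀ - k).toNat := by
      rw [← zpow_natCast, ← zpow_add₀ (by norm_num), Int.toNat_of_nonneg (by have := hK k hk; lia)]
      congr 1; lia
    rw [this, mul_assoc, ← mul_pow]; norm_num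
  rw [Finset.sum_congr rfl h1, ← Finset.mul_sum, mul_comm]
  gcongr
  have h2 : ∑ k ∈ K, ((1 : ℝ) / 2) ^ (k₀ - k).toNat =
      ∑ m ∈ K.image fun k => (k₀ - k).toNat, ((1 : ℝ) / 2) ^ m := by
    rw [Finset.sum_image]
    intro x hx y hy hxy
    have := hK x hx; have := hK y hy
    simp only at hxy; lia
  rw [h2]
  exact (summable_geometric_two.sum_le_tsum _ fun _ _ => by positivity).trans
    tsum_geometric_two.le

/-- Tails of the weights of an interval `I ⊆ J` outside `J`, spread over `I`. -/
lemma setIntegral_compl_weight_le {c L a b : ℝ} (hL : 0 < L)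
    (hsub : Ioo (c - L / 2) (c + L / 2) ⊆ Ioo a b) :
    ∫ x in (Ioo a b)ᶜ, (weight c L x)⁻¹ ^ 2 ≤
      25 * ∫ y in Ioo (c - L / 2) (c + L / 2), ((weight a L y)⁻¹ + (weight b L y)⁻¹) := by
  have key : ∀ y ∈ Ioo (c - L / 2) (c + L / 2), ∫ x in (Ioo a b)ᶜ, (weight c L x)⁻¹ ^ 2 ≤
      25 * L * ((weight a L y)⁻¹ + (weight b L y)⁻¹) := by
    intro y hy
    have hyJ := hsub hy
    have hyc : |y - c| ≤ L / 2 := by rw [abs_le]; constructor <;> linarith [hy.1, hy.2]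
    have hpt : ∀ x ∈ (Ioo a b)ᶜ, (weight c L x)⁻¹ ^ 2 ≤
        25 / 4 * ((weight a L y)⁻¹ * (weight a L x)⁻¹ + (weight b L y)⁻¹ * (weight b L x)⁻¹) := by
      intro x hx
      have h1 := weight_inv_le_of_mem hL hyc x
      have p0 := weight_inv_nonneg c L x
      have p1 := weight_inv_nonneg x L y
      have h2 : (weight c L x)⁻¹ ^ 2 ≤ 25 / 4 * ((weight x L y)⁻¹ * (weight x L y)⁻¹) := by
        nlinarith
      refine h2.trans ?_
      have pa := mul_nonneg (weight_inv_nonneg a L y) (weight_inv_nonneg a L x)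
      have pb := mul_nonneg (weight_inv_nonneg b L y) (weight_inv_nonneg b L x)
      have h3 : ∀ d, |y - d| ≤ |y - x| → |x - d| ≤ |y - x| →
          (weight x L y)⁻¹ * (weight x L y)⁻¹ ≤ (weight d L y)⁻¹ * (weight d L x)⁻¹ := by
        intro d hd1 hd2
        have := weight_inv_nonneg d L y
        have := weight_pos d L y
        have := weight_pos d L x
        gcongr
        · exact weight_mono_of_abs_le hd1
        · exact weight_mono_of_abs_le hd2
      simp only [mem_compl_iff, mem_Ioo, not_and_or, not_lt] at hx
      rcases hx with hx | hx
      · have := h3 a (by rw [abs_of_pos (by linarith [hyJ.1]), abs_of_pos (by linarith [hyJ.1])]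
                         linarith)
          (by rw [abs_of_nonpos (by linarith), abs_of_pos (by linarith [hyJ.1])]
              linarith [hyJ.1])
        linarith
      · have := h3 b (by rw [abs_of_neg (by linarith [hyJ.2]), abs_of_neg (by linarith [hyJ.2])]
                         linarith)
          (by rw [abs_of_nonneg (by linarith), abs_of_neg (by linarith [hyJ.2])]
              linarith [hyJ.2])
        linarith
    have hint : Integrable fun x => 25 / 4 *
        ((weight a L y)⁻¹ * (weight a L x)⁻¹ + (weight b L y)⁻¹ * (weight b L x)⁻¹) :=
      (((integrable_weight_inv a hL).const_mul _).add
        ((integrable_weight_inv b hL).const_mul _)).const_mul _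
    have pa := weight_inv_nonneg a L y
    have pb := weight_inv_nonneg b L y
    calc ∫ x in (Ioo a b)ᶜ, (weight c L x)⁻¹ ^ 2
        ≤ ∫ x in (Ioo a b)ᶜ, 25 / 4 *
          ((weight a L y)⁻¹ * (weight a L x)⁻¹ + (weight b L y)⁻¹ * (weight b L x)⁻¹) :=
          setIntegral_mono_on (integrable_weight_inv_pow c hL 1).integrableOn hint.integrableOn
            measurableSet_Ioo.compl hpt
      _ ≤ ∫ x, 25 / 4 *
          ((weight a L y)⁻¹ * (weight a L x)⁻¹ + (weight b L y)⁻¹ * (weight b L x)⁻¹) := by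
          refine setIntegral_le_integral hint (.of_forall fun x => ?_)
          have := weight_inv_nonneg a L x
          have := weight_inv_nonneg b L x
          simp only [Pi.zero_apply]; positivity
      _ = 25 / 4 * Real.pi * L * ((weight a L y)⁻¹ + (weight b L y)⁻¹) := by
          rw [integral_const_mul, integral_add ((integrable_weight_inv a hL).const_mul _)
            ((integrable_weight_inv b hL).const_mul _), integral_const_mul, integral_const_mul,
            integral_weight_inv a hL, integral_weight_inv b hL]
          ring
      _ ≤ _ := by
          have := Real.pi_le_four
          gcongr
          linarith
  have hvol : volume.real (Ioo (c - L / 2) (c + L / 2)) = L := by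
    rw [Real.volume_real_Ioo_of_le (by linarith)]; ring
  have hI := setIntegral_mono_on (μ := volume) (s := Ioo (c - L / 2) (c + L / 2))
    (f := fun _ => ∫ x in (Ioo a b)ᶜ, (weight c L x)⁻¹ ^ 2)
    (continuous_const.integrableOn_Icc.mono_set Ioo_subset_Icc_self)
    ((((integrable_weight_inv a hL).add (integrable_weight_inv b hL)).const_mul
      (25 * L)).integrableOn) measurableSet_Ioo key
  rw [setIntegral_const, hvol, smul_eq_mul] at hI
  simp only [Pi.add_apply] at hI
  rw [integral_const_mul] at hI
  refine le_of_mul_le_mul_left (hI.trans (le_of_eq ?_)) hL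
  ring

/-! ### Families of tiles -/

/-- The midpoint of the dyadic interval `[2^k n, 2^k (n + 1)]`. -/
noncomputable def timeMid (k n : ℤ) : ℝ := 2 ^ k * (n + 1 / 2)

/-- The interior of the dyadic interval `[2^k n, 2^k (n + 1)]`. -/
def timeIv (k n : ℤ) : Set ℝ := Ioo (timeMid k n - 2 ^ k / 2) (timeMid k n + 2 ^ k / 2)

/-- The midpoint of the frequency interval `[(l/5) 2⁻ᵏ, (l/5 + 1) 2⁻ᵏ]`. -/
noncomputable def freqMid (k l : ℤ) : ℝ := (l / 5 + 1 / 2) * 2 ^ (-k)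

/-- The interior of the frequency interval `[(l/5) 2⁻ᵏ, (l/5 + 1) 2⁻ᵏ]`. -/
def freqIv (k l : ℤ) : Set ℝ :=
  Ioo (freqMid k l - 2 ^ (-k) / 2) (freqMid k l + 2 ^ (-k) / 2)

/-- The frequency interval `[(l/5) 2⁻ᵏ, (l/5 + 1) 2⁻ᵏ]`. -/
def freqBand (k l : ℤ) : Set ℝ :=
  Icc (freqMid k l - 2 ^ (-k) / 2) (freqMid k l + 2 ^ (-k) / 2)

/-- A family of tiles, indexed by scale `k`, position `n` and frequency `l`: the time intervals
and the frequency intervals form grids, and distinct scales are far apart. -/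
structure IsTileFamily {ι : Type*} (k n l : ι → ℤ) : Prop where
  inj : ∀ s t, k s = k t → n s = n t → l s = l t → s = t
  time_nested : ∀ s t, k t ≤ k s →
    timeIv (k t) (n t) ⊆ timeIv (k s) (n s) ∨ Disjoint (timeIv (k t) (n t)) (timeIv (k s) (n s))
  freq_nested : ∀ s t, k s ≤ k t →
    freqIv (k t) (l t) ⊆ freqIv (k s) (l s) ∨ Disjoint (freqIv (k t) (l t)) (freqIv (k s) (l s))
  sparse : ∀ s t, k s < k t → k s + 1000 ≤ k t

/-- Wave packets adapted to the tiles of a family, with a common constant. -/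
def IsPacketFamily {ι : Type*} (k n l : ι → ℤ) (B : ℝ) (φ : ι → ℝ → ℂ) : Prop :=
  ∀ s, IsPacket (timeMid (k s) (n s)) (2 ^ k s) (freqBand (k s) (l s)) B (φ s)

lemma zpow_two_pos (k : ℤ) : (0 : ℝ) < 2 ^ k := by positivity

lemma freqIv_nonempty (k l : ℤ) : (freqIv k l).Nonempty :=
  nonempty_Ioo.2 (by have := zpow_two_pos (-k); linarith)

lemma timeIv_inj {k n n' : ℤ} (h : timeIv k n ⊆ timeIv k n') : n = n' := by
  have p := zpow_two_pos k
  have h1 := (Ioo_subset_Ioo_iff (by linarith)).1 h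
  have h2 : timeMid k n = timeMid k n' := by linarith [h1.1, h1.2]
  have h3 := mul_left_cancel₀ p.ne' h2
  have : (n : ℝ) = n' := by linarith
  exact_mod_cast this

lemma freqIv_inj {k l l' : ℤ} (h : freqIv k l ⊆ freqIv k l') : l = l' := by
  have p := zpow_two_pos (-k)
  have h1 := (Ioo_subset_Ioo_iff (by linarith)).1 h
  have h2 : freqMid k l = freqMid k l' := by linarith [h1.1, h1.2]
  have h3 := mul_right_cancel₀ p.ne' h2
  have : (l : ℝ) = l' := by linarith
  exact_mod_cast this

lemma abs_freqMid_sub_le {k k' l l' : ℤ} (h : ¬ Disjoint (freqIv k l) (freqIv k' l')) :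
    |freqMid k l - freqMid k' l'| ≤ 2 ^ (-k) / 2 + 2 ^ (-k') / 2 := by
  obtain ⟨x, hx, hx'⟩ := Set.not_disjoint_iff.1 h
  rw [abs_le]
  constructor <;> linarith [hx.1, hx.2, hx'.1, hx'.2]

lemma zpow_le_of_timeIv_subset {k k' n n' : ℤ} (h : timeIv k n ⊆ timeIv k' n') : k ≤ k' := by
  have h1 := (Ioo_subset_Ioo_iff (by have := zpow_two_pos k; linarith)).1 h
  have : (2 : ℝ) ^ k ≤ 2 ^ k' := by linarith [h1.1, h1.2]
  exact (zpow_le_zpow_iff_right₀ (by norm_num)).1 this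

/-- The modulus of the Gram matrix of a family of functions. -/
noncomputable def gram {ι : Type*} (φ : ι → ℝ → ℂ) (s t : ι) : ℝ :=
  ‖∫ x, inner ℂ (φ s x) (φ t x)‖

lemma gram_nonneg {ι : Type*} (φ : ι → ℝ → ℂ) (s t : ι) : 0 ≤ gram φ s t := norm_nonneg _

lemma gram_symm {ι : Type*} (φ : ι → ℝ → ℂ) (s t : ι) : gram φ s t = gram φ t s := by
  unfold gram
  rw [← RCLike.norm_conj, ← integral_conj]
  simp only [inner_conj_symm]

namespace IsTileFamily

variable {ι : Type*} {k n l : ι → ℤ} {B : ℝ} {φ : ι → ℝ → ℂ}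

lemma zpow_le_of_lt (h : IsTileFamily k n l) {s t : ι} (hst : k s < k t) :
    (2 : ℝ) ^ (-k t) * 10 ^ 7 ≤ 2 ^ (-k s) := by
  have h1 := h.sparse s t hst
  calc (2 : ℝ) ^ (-k t) * 10 ^ 7 ≤ 2 ^ (-k t) * 2 ^ (1000 : ℤ) := by
        gcongr
        calc (10 : ℝ) ^ 7 ≤ 2 ^ (24 : ℤ) := by norm_num
          _ ≤ 2 ^ (1000 : ℤ) := zpow_le_zpow_right₀ (by norm_num) (by norm_num)
    _ = 2 ^ (-k t + 1000) := by rw [zpow_add₀ (by norm_num)]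
    _ ≤ 2 ^ (-k s) := zpow_le_zpow_right₀ (by norm_num) (by lia)

lemma freq_eq (h : IsTileFamily k n l) {s t : ι} (hk : k s = k t)
    (hst : ¬ Disjoint (freqIv (k s) (l s)) (freqIv (k t) (l t))) : l s = l t := by
  rcases h.freq_nested t s hk.ge with h1 | h1
  · rw [hk] at h1; exact freqIv_inj h1
  · exact absurd h1 hst

lemma time_disjoint (h : IsTileFamily k n l) {s t : ι} (hk : k s = k t) (hl : l s = l t)
    (hne : s ≠ t) : Disjoint (timeIv (k s) (n s)) (timeIv (k t) (n t)) := by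
  rcases h.time_nested t s hk.le with h1 | h1
  · rw [hk] at h1; exact absurd (h.inj s t hk (timeIv_inj h1) hl) hne
  · exact h1

end IsTileFamily

namespace IsPacketFamily

variable {ι : Type*} {k n l : ι → ℤ} {B : ℝ} {φ : ι → ℝ → ℂ}

lemma gram_eq_zero (hφ : IsPacketFamily k n l B φ) {s t : ι}
    (h : Disjoint (freqIv (k s) (l s)) (freqIv (k t) (l t))) : gram φ s t = 0 := by
  unfold gram
  rw [integral_inner_eq_zero (hφ t).continuous ((hφ s).integrable (zpow_two_pos _))
    ((hφ t).integrable (zpow_two_pos _)) (hφ s).support (hφ t).support h, norm_zero]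

lemma sqrt_mul_gram_le (hφ : IsPacketFamily k n l B φ) {s t : ι} (h : k t ≤ k s) :
    √(2 ^ k t) * gram φ s t ≤ 100 * B ^ 2 * (√(2 ^ k s))⁻¹ *
      ∫ x in timeIv (k t) (n t), (weight (timeMid (k s) (n s)) (2 ^ k s) x)⁻¹ ^ 2 :=
  sqrt_mul_norm_integral_inner_le (hφ s) (hφ t) (zpow_two_pos _)
    (zpow_le_zpow_right₀ (by norm_num) h)

/-- Schur's condition within one scale. -/
lemma sum_gram_le (hT : IsTileFamily k n l) (hφ : IsPacketFamily k n l B φ) (P : Finset ι)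
    (s : ι) : ∑ t ∈ P with k t = k s, gram φ s t ≤ 400 * B ^ 2 := by
  classical
  set w : ℝ → ℝ := fun x => (weight (timeMid (k s) (n s)) (2 ^ k s) x)⁻¹ ^ 2
  set L : ℝ := 2 ^ k s
  have hL : 0 < L := zpow_two_pos _
  set Q := P.filter fun t => k t = k s ∧ l t = l s
  have h1 : ∑ t ∈ P with k t = k s, gram φ s t = ∑ t ∈ Q, gram φ s t := by
    symm
    refine Finset.sum_subset (fun t ht => ?_) fun t ht ht' => ?_
    · simp only [Q, Finset.mem_filter] at ht ⊢; exact ⟨ht.1, ht.2.1⟩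
    · simp only [Q, Finset.mem_filter] at ht ht'
      refine hφ.gram_eq_zero ?_
      by_contra hd
      exact ht' ⟨ht.1, ht.2, (hT.freq_eq ht.2.symm hd).symm⟩
  have h2 : ∀ t ∈ Q, gram φ s t ≤ 100 * B ^ 2 * L⁻¹ * ∫ x in timeIv (k t) (n t), w x := by
    intro t ht
    have hk : k t = k s := (Finset.mem_filter.1 ht).2.1
    have h := hφ.sqrt_mul_gram_le (s := s) (t := t) hk.le
    have e : (2 : ℝ) ^ k t = L := by rw [hk]
    rw [e] at h
    have hs := Real.sqrt_pos.2 hL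
    have hss : √L * √L = L := Real.mul_self_sqrt hL.le
    have h' : gram φ s t ≤ (√L)⁻¹ * (100 * B ^ 2 * (√L)⁻¹ * ∫ x in timeIv (k t) (n t), w x) := by
      rw [inv_mul_eq_div, le_div_iff₀ hs, mul_comm]; exact h
    have hi : (√L)⁻¹ * (√L)⁻¹ = L⁻¹ := by rw [← mul_inv, hss]
    refine h'.trans (le_of_eq ?_)
    rw [← hi]; ring
  have h3 : ∑ t ∈ Q, ∫ x in timeIv (k t) (n t), w x ≤ Real.pi * L := by
    refine (sum_setIntegral_le Q (fun t => timeIv (k t) (n t)) univ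
      (fun t _ => measurableSet_Ioo) (fun t _ => subset_univ _) (fun t ht t' ht' hne => ?_)
      (integrable_weight_inv_pow _ hL 1) (fun x => sq_nonneg _)).trans ?_
    · have a := (Finset.mem_filter.1 ht).2
      have a' := (Finset.mem_filter.1 ht').2
      exact hT.time_disjoint (a.1.trans a'.1.symm) (a.2.trans a'.2.symm) hne
    · rw [Measure.restrict_univ]
      exact integral_weight_inv_sq_le _ hL
  calc _ = ∑ t ∈ Q, gram φ s t := h1
    _ ≤ ∑ t ∈ Q, 100 * B ^ 2 * L⁻¹ * ∫ x in timeIv (k t) (n t), w x := Finset.sum_le_sum h2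
    _ = 100 * B ^ 2 * L⁻¹ * ∑ t ∈ Q, ∫ x in timeIv (k t) (n t), w x := by rw [Finset.mul_sum]
    _ ≤ 100 * B ^ 2 * L⁻¹ * (Real.pi * L) := by gcongr
    _ = 100 * Real.pi * B ^ 2 := by field_simp
    _ ≤ 400 * B ^ 2 := by
      have := Real.pi_le_four
      gcongr
      linarith

lemma sum_sum_gram_same_scale_le (hT : IsTileFamily k n l) (hφ : IsPacketFamily k n l B φ)
    (P : Finset ι) (a : ι → ℝ) :
    ∑ s ∈ P, ∑ t ∈ P, a s * a t * (if k t = k s then gram φ s t else 0) ≤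
      400 * B ^ 2 * ∑ s ∈ P, a s ^ 2 := by
  refine sum_sum_mul_le_of_row_sum_le P a _ (fun s t => ?_) (fun s t => ?_) fun s _ => ?_
  · split_ifs
    · exact gram_nonneg _ _ _
    · rfl
  · simp only [gram_symm φ t s, eq_comm (a := k s)]
  · rw [← Finset.sum_filter]
    exact hφ.sum_gram_le hT P s

/-- The packet as an element of `L²`. -/
noncomputable def toLp (hφ : IsPacketFamily k n l B φ) (s : ι) : Lp ℂ 2 (volume : Measure ℝ) :=
  ((hφ s).memLp (zpow_two_pos _)).toLp (φ s)

lemma inner_toLp (hφ : IsPacketFamily k n l B φ) {f : ℝ → ℂ} (hf : MemLp f 2) (s : ι) :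
    inner ℂ (hφ.toLp s) (hf.toLp f) = pairing f (φ s) := by
  rw [L2.inner_def, pairing]
  refine integral_congr_ae ?_
  filter_upwards [((hφ s).memLp (zpow_two_pos (k s))).coeFn_toLp, hf.coeFn_toLp] with x h1 h2
  rw [toLp, h1, h2]
  simp

lemma norm_inner_toLp_toLp (hφ : IsPacketFamily k n l B φ) (s t : ι) :
    ‖inner ℂ (hφ.toLp s) (hφ.toLp t)‖ = gram φ s t := by
  rw [L2.inner_def, gram]
  congr 1
  refine integral_congr_ae ?_
  filter_upwards [((hφ s).memLp (zpow_two_pos (k s))).coeFn_toLp,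
    ((hφ t).memLp (zpow_two_pos (k t))).coeFn_toLp] with x h1 h2
  rw [toLp, toLp, h1, h2]

lemma norm_toLp_sq {f : ℝ → ℂ} (hf : MemLp f 2) :
    ‖hf.toLp f‖ ^ 2 = ∫ x, ‖f x‖ ^ 2 := by
  have h := inner_self_eq_norm_sq_to_K (𝕜 := ℂ) (hf.toLp f)
  rw [L2.inner_def] at h
  have h2 : ∫ x, inner ℂ (hf.toLp f x) (hf.toLp f x) = ∫ x, ((‖f x‖ ^ 2 : ℝ) : ℂ) := by
    refine integral_congr_ae ?_
    filter_upwards [hf.coeFn_toLp] with x hx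
    rw [hx, inner_self_eq_norm_sq_to_K]; push_cast; rfl
  have h3 : ∫ x, ((‖f x‖ ^ 2 : ℝ) : ℂ) = ((∫ x, ‖f x‖ ^ 2 : ℝ) : ℂ) := integral_ofReal
  rw [h2, h3] at h
  have h4 : ((∫ x, ‖f x‖ ^ 2 : ℝ) : ℂ) = ((‖hf.toLp f‖ ^ 2 : ℝ) : ℂ) := by
    rw [Complex.ofReal_pow]; exact h
  exact (Complex.ofReal_injective h4).symm

/-- Bessel's inequality for packets, in terms of the Gram matrix. -/
lemma sum_pairing_sq_le_of_gram (hφ : IsPacketFamily k n l B φ) {f : ℝ → ℂ} (hf : MemLp f 2)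
    (P : Finset ι) {K : ℝ} (hK : 0 ≤ K)
    (h : ∑ s ∈ P, ∑ t ∈ P, ‖pairing f (φ s)‖ * ‖pairing f (φ t)‖ * gram φ s t ≤
      K * ∑ s ∈ P, ‖pairing f (φ s)‖ ^ 2) :
    ∑ s ∈ P, ‖pairing f (φ s)‖ ^ 2 ≤ K * ∫ x, ‖f x‖ ^ 2 := by
  have := sum_norm_inner_sq_le P hφ.toLp (hf.toLp f) hK
    (by simpa only [inner_toLp hφ hf, norm_inner_toLp_toLp] using h)
  simpa only [inner_toLp hφ hf, norm_toLp_sq] using this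

lemma gram_eq_ite (hφ : IsPacketFamily k n l B φ) {P : Finset ι}
    (hP : ∀ s ∈ P, ∀ t ∈ P, k s ≠ k t → Disjoint (freqIv (k s) (l s)) (freqIv (k t) (l t)))
    {s t : ι} (hs : s ∈ P) (ht : t ∈ P) :
    gram φ s t = if k t = k s then gram φ s t else 0 := by
  split_ifs with hk
  · rfl
  · exact hφ.gram_eq_zero (hP s hs t ht (Ne.symm hk))

/-- Bessel's inequality for a collection of tiles in which different scales have disjoint
frequencies. -/
lemma sum_pairing_sq_le (hT : IsTileFamily k n l) (hφ : IsPacketFamily k n l B φ)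
    {f : ℝ → ℂ} (hf : MemLp f 2) (P : Finset ι)
    (hP : ∀ s ∈ P, ∀ t ∈ P, k s ≠ k t → Disjoint (freqIv (k s) (l s)) (freqIv (k t) (l t))) :
    ∑ s ∈ P, ‖pairing f (φ s)‖ ^ 2 ≤ 400 * B ^ 2 * ∫ x, ‖f x‖ ^ 2 := by
  refine hφ.sum_pairing_sq_le_of_gram hf P (by positivity) ?_
  rw [Finset.sum_congr rfl fun s hs => Finset.sum_congr rfl fun t ht =>
    congrArg _ (hφ.gram_eq_ite hP hs ht)]
  exact hφ.sum_sum_gram_same_scale_le hT P fun s => ‖pairing f (φ s)‖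

/-- The dual form of Bessel's inequality. -/
lemma integral_norm_sum_sq_le (hT : IsTileFamily k n l) (hφ : IsPacketFamily k n l B φ)
    (P : Finset ι) (β : ι → ℂ)
    (hP : ∀ s ∈ P, ∀ t ∈ P, k s ≠ k t → Disjoint (freqIv (k s) (l s)) (freqIv (k t) (l t))) :
    ∫ x, ‖∑ s ∈ P, β s * φ s x‖ ^ 2 ≤ 400 * B ^ 2 * ∑ s ∈ P, ‖β s‖ ^ 2 := by
  have hG : MemLp (fun x => ∑ s ∈ P, β s * φ s x) 2 :=
    memLp_finsetSum P fun s _ => ((hφ s).memLp (zpow_two_pos _)).const_mul (β s)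
  have e : hG.toLp _ = ∑ s ∈ P, β s • hφ.toLp s := by
    rw [Lp.ext_iff]
    have h2 : ∀ᵐ x, ∀ s ∈ P, (β s • hφ.toLp s : Lp ℂ 2 (volume : Measure ℝ)) x = β s * φ s x := by
      rw [Finset.eventually_all]
      intro s _
      filter_upwards [((hφ s).memLp (zpow_two_pos (k s))).coeFn_toLp,
        Lp.coeFn_smul (β s) (hφ.toLp s)] with x h1 h2
      rw [h2, Pi.smul_apply, toLp, h1, smul_eq_mul]
    filter_upwards [hG.coeFn_toLp, Lp.coeFn_finsetSum P fun s => β s • hφ.toLp s, h2]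
      with x h1 h3 h4
    rw [h1, h3, Finset.sum_apply]
    exact (Finset.sum_congr rfl fun s hs => (h4 s hs)).symm
  rw [← norm_toLp_sq hG, e]
  refine (norm_sum_smul_sq_le P _ β).trans ?_
  simp only [norm_inner_toLp_toLp]
  rw [Finset.sum_congr rfl fun s hs => Finset.sum_congr rfl fun t ht =>
    congrArg _ (hφ.gram_eq_ite hP hs ht)]
  exact hφ.sum_sum_gram_same_scale_le hT P fun s => ‖β s‖

end IsPacketFamily

/-! ### Bessel's inequality for forests -/

section Forest

variable {ι : Type*} {k n l : ι → ℤ} {B : ℝ} {φ : ι → ℝ → ℂ}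

/-- The tails, outside `J`, of the time intervals of a tree below `J`: each scale contributes a
multiple of its length. -/
lemma sum_setIntegral_compl_le (hT : IsTileFamily k n l) (T : Finset ι) (t : ι) (ξ : ℝ)
    (hsub : ∀ s ∈ T, timeIv (k s) (n s) ⊆ timeIv (k t) (n t))
    (hξ : ∀ s ∈ T, |freqMid (k s) (l s) - ξ| ≤ 200000 * 2 ^ (-k s)) :
    ∑ s ∈ T, ∫ x in (timeIv (k t) (n t))ᶜ, (weight (timeMid (k s) (n s)) (2 ^ k s) x)⁻¹ ^ 2 ≤
      2 * 10 ^ 9 * 2 ^ k t := by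
  classical
  set J := timeIv (k t) (n t)
  set F : ι → ℝ := fun s => ∫ x in Jᶜ, (weight (timeMid (k s) (n s)) (2 ^ k s) x)⁻¹ ^ 2
  -- Within a scale, the tiles of the tree are sorted by their frequency relative to `ξ`.
  set g : ι → ℤ × ℤ := fun s => (k s, l s - ⌊5 * ξ * 2 ^ k s⌋)
  set M : Finset ℤ := Finset.Icc (-2000000) 2000000
  have hg : ∀ s ∈ T, g s ∈ T.image k ×ˢ M := by
    intro s hs
    refine Finset.mem_product.2 ⟨Finset.mem_image_of_mem _ hs, ?_⟩
    have p := zpow_two_pos (k s)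
    have h1 : |(l s / 5 + 1 / 2 : ℝ) - ξ * 2 ^ k s| ≤ 200000 := by
      have h2 := mul_le_mul_of_nonneg_right (hξ s hs) p.le
      rw [mul_assoc, ← zpow_add₀ (by norm_num), neg_add_cancel, zpow_zero, mul_one,
        ← abs_of_pos p, ← abs_mul, sub_mul, freqMid, mul_assoc,
        ← zpow_add₀ (by norm_num), neg_add_cancel, zpow_zero, mul_one] at h2
      exact h2
    have h3 := abs_le.1 h1
    have h4 := Int.floor_le (5 * ξ * 2 ^ k s)
    have h5 := Int.lt_floor_add_one (5 * ξ * 2 ^ k s)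
    refine Finset.mem_Icc.2 ⟨?_, ?_⟩
    · have : ((-2000000 : ℤ) : ℝ) ≤ ((l s - ⌊5 * ξ * 2 ^ k s⌋ : ℤ) : ℝ) := by
        push_cast; linarith [h3.1]
      exact_mod_cast this
    · have : ((l s - ⌊5 * ξ * 2 ^ k s⌋ : ℤ) : ℝ) ≤ ((2000000 : ℤ) : ℝ) := by
        push_cast; linarith [h3.2]
      exact_mod_cast this
  have hfib : ∀ p ∈ T.image k ×ˢ M, ∑ s ∈ T with g s = p, F s ≤ 200 * 2 ^ p.1 := by
    intro p _
    set a := timeMid (k t) (n t) - 2 ^ k t / 2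
    set b := timeMid (k t) (n t) + 2 ^ k t / 2
    have hL := zpow_two_pos p.1
    have h1 : ∀ s ∈ T.filter (g · = p), F s ≤ 25 * ∫ y in timeIv (k s) (n s),
        ((weight a (2 ^ p.1) y)⁻¹ + (weight b (2 ^ p.1) y)⁻¹) := by
      intro s hs
      rw [Finset.mem_filter] at hs
      have hk : k s = p.1 := congrArg Prod.fst hs.2
      have := setIntegral_compl_weight_le (zpow_two_pos (k s)) (hsub s hs.1)
      rw [← hk]
      exact this
    refine (Finset.sum_le_sum h1).trans ?_
    rw [← Finset.mul_sum]
    have hint := (integrable_weight_inv a hL).add (integrable_weight_inv b hL)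
    have h2 := sum_setIntegral_le (T.filter (g · = p)) (fun s => timeIv (k s) (n s)) univ
      (h := fun y => (weight a (2 ^ p.1) y)⁻¹ + (weight b (2 ^ p.1) y)⁻¹)
      (fun s _ => measurableSet_Ioo) (fun s _ => subset_univ _) (fun s hs s' hs' hne => by
        rw [Finset.mem_filter] at hs hs'
        have e := hs.2.trans hs'.2.symm
        have ek : k s = k s' := congrArg Prod.fst e
        have el : l s - ⌊5 * ξ * 2 ^ k s⌋ = l s' - ⌊5 * ξ * 2 ^ k s'⌋ := congrArg Prod.snd e
        rw [ek] at el
        exact hT.time_disjoint ek (sub_left_injective el) hne)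
      hint (fun y => add_nonneg (weight_inv_nonneg _ _ _) (weight_inv_nonneg _ _ _))
    rw [Measure.restrict_univ, integral_add (integrable_weight_inv a hL)
      (integrable_weight_inv b hL), integral_weight_inv a hL, integral_weight_inv b hL] at h2
    have := Real.pi_le_four
    nlinarith
  have hM : M.card = 4000001 := by simp [M]
  have hK : ∀ m ∈ T.image k, m ≤ k t := by
    intro m hm
    obtain ⟨s, hs, rfl⟩ := Finset.mem_image.1 hm
    exact zpow_le_of_timeIv_subset (hsub s hs)
  calc ∑ s ∈ T, F s = ∑ p ∈ T.image k ×ˢ M, ∑ s ∈ T with g s = p, F s :=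
        (Finset.sum_fiberwise_of_maps_to hg F).symm
    _ ≤ ∑ p ∈ T.image k ×ˢ M, 200 * (2 : ℝ) ^ p.1 := Finset.sum_le_sum hfib
    _ = 4000001 * 200 * ∑ m ∈ T.image k, (2 : ℝ) ^ m := by
        rw [Finset.sum_product]
        simp only [Finset.sum_const, hM, nsmul_eq_mul]
        rw [← Finset.mul_sum, ← Finset.mul_sum]; push_cast; ring
    _ ≤ 4000001 * 200 * (2 * 2 ^ k t) := by gcongr; exact sum_zpow_le _ hK
    _ ≤ _ := by have := zpow_two_pos (k t); nlinarith

/-- Bessel's inequality for a forest of strongly disjoint trees: if each tree `T θ` carries at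
least `λ²` times the length of its top and single coefficients are at most `2λ` times the
square root of the length, then the tops have total length at most `C λ⁻² ‖f‖²`. -/
lemma forest_bessel (hT : IsTileFamily k n l) (hφ : IsPacketFamily k n l B φ) {f : ℝ → ℂ}
    (hf : MemLp f 2) {Θ : Type*} (𝓣 : Finset Θ) (T : Θ → Finset ι) (top : Θ → ι) (ξ : Θ → ℝ)
    {lam : ℝ} (hlam : 0 ≤ lam)
    (hsub : ∀ θ ∈ 𝓣, ∀ s ∈ T θ, timeIv (k s) (n s) ⊆ timeIv (k (top θ)) (n (top θ)))
    (hξ : ∀ θ ∈ 𝓣, ∀ s ∈ T θ, |freqMid (k s) (l s) - ξ θ| ≤ 200000 * 2 ^ (-k s))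
    (hdis : ∀ θ ∈ 𝓣, ∀ θ' ∈ 𝓣, θ ≠ θ' → Disjoint (T θ) (T θ'))
    (hstrong : ∀ θ ∈ 𝓣, ∀ θ' ∈ 𝓣, ∀ s ∈ T θ, ∀ s' ∈ T θ', k s' < k s →
      ¬ Disjoint (freqIv (k s) (l s)) (freqIv (k s') (l s')) →
      Disjoint (timeIv (k s') (n s')) (timeIv (k (top θ)) (n (top θ))))
    (hsmall : ∀ θ ∈ 𝓣, ∀ s ∈ T θ, ‖pairing f (φ s)‖ ^ 2 ≤ 4 * lam ^ 2 * 2 ^ k s)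
    (hbig : ∀ θ ∈ 𝓣, lam ^ 2 * 2 ^ k (top θ) ≤ ∑ s ∈ T θ, ‖pairing f (φ s)‖ ^ 2) :
    lam ^ 2 * ∑ θ ∈ 𝓣, (2 : ℝ) ^ k (top θ) ≤ 2 * 10 ^ 12 * B ^ 2 * ∫ x, ‖f x‖ ^ 2 := by
  classical
  set α : ι → ℝ := fun s => ‖pairing f (φ s)‖ with hα
  have hα0 : ∀ s, 0 ≤ α s := fun s => norm_nonneg _
  set U := 𝓣.biUnion T
  have hpd : (𝓣 : Set Θ).PairwiseDisjoint T := fun θ hθ θ' hθ' hne => hdis θ hθ θ' hθ' hne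
  have hU : ∀ h : ι → ℝ, ∑ s ∈ U, h s = ∑ θ ∈ 𝓣, ∑ s ∈ T θ, h s :=
    fun h => Finset.sum_biUnion hpd
  have hαle : ∀ θ ∈ 𝓣, ∀ s ∈ T θ, α s ≤ 2 * lam * √(2 ^ k s) := by
    intro θ hθ s hs
    refine (pow_le_pow_iff_left₀ (hα0 s) (by positivity) two_ne_zero).1 ?_
    rw [mul_pow, Real.sq_sqrt (zpow_two_pos _).le]
    have := hsmall θ hθ s hs
    linarith
  have hcross : ∑ s ∈ U, ∑ t ∈ U, α s * α t * (if k t < k s then gram φ s t else 0) ≤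
      8 * 10 ^ 11 * B ^ 2 * ∑ s ∈ U, α s ^ 2 := by
    rw [hU, hU, Finset.mul_sum]
    refine Finset.sum_le_sum fun θ hθ => ?_
    set J := timeIv (k (top θ)) (n (top θ))
    have hs1 : ∀ s ∈ T θ, ∑ t ∈ U, α s * α t * (if k t < k s then gram φ s t else 0) ≤
        400 * lam ^ 2 * B ^ 2 *
          ∫ x in Jᶜ, (weight (timeMid (k s) (n s)) (2 ^ k s) x)⁻¹ ^ 2 := by
      intro s hs
      set w : ℝ → ℝ := fun x => (weight (timeMid (k s) (n s)) (2 ^ k s) x)⁻¹ ^ 2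
      have hw : Integrable w := integrable_weight_inv_pow _ (zpow_two_pos _) 1
      set D := U.filter fun t => k t < k s ∧ ¬ Disjoint (freqIv (k s) (l s)) (freqIv (k t) (l t))
      have hD : ∀ t ∈ D, ∃ θ' ∈ 𝓣, t ∈ T θ' ∧ k t < k s ∧
          ¬ Disjoint (freqIv (k s) (l s)) (freqIv (k t) (l t)) := by
        intro t ht
        obtain ⟨h1, h2, h3⟩ := Finset.mem_filter.1 ht
        obtain ⟨θ', h4, h5⟩ := Finset.mem_biUnion.1 h1
        exact ⟨θ', h4, h5, h2, h3⟩
      have h1 : ∑ t ∈ U, α s * α t * (if k t < k s then gram φ s t else 0) =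
          ∑ t ∈ D, α s * α t * gram φ s t := by
        rw [Finset.sum_filter]
        refine Finset.sum_congr rfl fun t _ => ?_
        by_cases h2 : k t < k s
        · by_cases h3 : Disjoint (freqIv (k s) (l s)) (freqIv (k t) (l t))
          · simp [h3, hφ.gram_eq_zero h3]
          · simp [h2, h3]
        · simp [h2]
      have h2 : ∀ t ∈ D, α s * α t * gram φ s t ≤
          400 * lam ^ 2 * B ^ 2 * ∫ x in timeIv (k t) (n t), w x := by
        intro t ht
        obtain ⟨θ', hθ', htT, hk, -⟩ := hD t ht
        have hg := hφ.sqrt_mul_gram_le (s := s) (t := t) hk.le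
        have hsq := Real.sqrt_pos.2 (zpow_two_pos (k s))
        have g0 := gram_nonneg φ s t
        calc α s * α t * gram φ s t
            ≤ (2 * lam * √(2 ^ k s)) * (2 * lam * √(2 ^ k t)) * gram φ s t := by
              gcongr
              · exact hαle θ hθ s hs
              · exact hαle θ' hθ' t htT
          _ = (4 * lam ^ 2 * √(2 ^ k s)) * (√(2 ^ k t) * gram φ s t) := by ring
          _ ≤ (4 * lam ^ 2 * √(2 ^ k s)) * (100 * B ^ 2 * (√(2 ^ k s))⁻¹ *
                ∫ x in timeIv (k t) (n t), w x) := by gcongr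
          _ = 400 * lam ^ 2 * B ^ 2 * (√(2 ^ k s) * (√(2 ^ k s))⁻¹) *
                ∫ x in timeIv (k t) (n t), w x := by ring
          _ = _ := by rw [mul_inv_cancel₀ hsq.ne', mul_one]
      -- The time intervals met by `s` are disjoint from the top of its tree and from each other:
      -- of two of them, the longer one lies in the top of its own tree.
      have h3 : ∑ t ∈ D, ∫ x in timeIv (k t) (n t), w x ≤ ∫ x in Jᶜ, w x := by
        have hlt : ∀ t ∈ D, ∀ t' ∈ D, k t' < k t →
            Disjoint (timeIv (k t') (n t')) (timeIv (k t) (n t)) := by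
          intro t ht t' ht' hk
          obtain ⟨θ₁, hθ₁, htT, hk1, hf1⟩ := hD t ht
          obtain ⟨θ₂, hθ₂, htT', hk2, hf2⟩ := hD t' ht'
          have e1 := (hT.freq_nested t s hk1.le).resolve_right hf1
          have e2 := (hT.freq_nested t' s hk2.le).resolve_right hf2
          refine (hstrong θ₁ hθ₁ θ₂ hθ₂ t htT t' htT' hk fun hd => ?_).mono_right
            (hsub θ₁ hθ₁ t htT)
          obtain ⟨x, hx⟩ := freqIv_nonempty (k s) (l s)
          exact Set.disjoint_left.1 hd (e1 hx) (e2 hx)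
        refine sum_setIntegral_le D (fun t => timeIv (k t) (n t)) _ (fun t _ => measurableSet_Ioo)
          (fun t ht => ?_) (fun t ht t' ht' hne => ?_) hw (fun x => sq_nonneg _)
        · obtain ⟨θ', hθ', htT, hk, hfr⟩ := hD t ht
          exact Set.subset_compl_iff_disjoint_right.2 (hstrong θ hθ θ' hθ' s hs t htT hk hfr)
        · rcases lt_trichotomy (k t) (k t') with hk | hk | hk
          · exact hlt t' ht' t ht hk
          · obtain ⟨θ₁, hθ₁, htT, hk1, hf1⟩ := hD t ht
            obtain ⟨θ₂, hθ₂, htT', hk2, hf2⟩ := hD t' ht'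
            have e1 := (hT.freq_nested t s hk1.le).resolve_right hf1
            have e2 := (hT.freq_nested t' s hk2.le).resolve_right hf2
            refine hT.time_disjoint hk (hT.freq_eq hk fun hd => ?_) hne
            obtain ⟨x, hx⟩ := freqIv_nonempty (k s) (l s)
            exact Set.disjoint_left.1 hd (e1 hx) (e2 hx)
          · exact (hlt t ht t' ht' hk).symm
      calc _ = ∑ t ∈ D, α s * α t * gram φ s t := h1
        _ ≤ ∑ t ∈ D, 400 * lam ^ 2 * B ^ 2 * ∫ x in timeIv (k t) (n t), w x :=
            Finset.sum_le_sum h2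
        _ = 400 * lam ^ 2 * B ^ 2 * ∑ t ∈ D, ∫ x in timeIv (k t) (n t), w x := by
            rw [Finset.mul_sum]
        _ ≤ _ := by gcongr
    calc _ ≤ ∑ s ∈ T θ, 400 * lam ^ 2 * B ^ 2 *
          ∫ x in Jᶜ, (weight (timeMid (k s) (n s)) (2 ^ k s) x)⁻¹ ^ 2 := Finset.sum_le_sum hs1
      _ = 400 * lam ^ 2 * B ^ 2 *
          ∑ s ∈ T θ, ∫ x in Jᶜ, (weight (timeMid (k s) (n s)) (2 ^ k s) x)⁻¹ ^ 2 := by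
          rw [Finset.mul_sum]
      _ ≤ 400 * lam ^ 2 * B ^ 2 * (2 * 10 ^ 9 * 2 ^ k (top θ)) := by
          gcongr
          exact sum_setIntegral_compl_le hT (T θ) (top θ) (ξ θ) (hsub θ hθ) (hξ θ hθ)
      _ = 8 * 10 ^ 11 * B ^ 2 * (lam ^ 2 * 2 ^ k (top θ)) := by ring
      _ ≤ _ := by gcongr; exact hbig θ hθ
  have hgram : ∑ s ∈ U, ∑ t ∈ U, α s * α t * gram φ s t ≤
      2 * 10 ^ 12 * B ^ 2 * ∑ s ∈ U, α s ^ 2 := by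
    have hsame := hφ.sum_sum_gram_same_scale_le hT U α
    have hcross' : ∑ s ∈ U, ∑ t ∈ U, α s * α t * (if k s < k t then gram φ s t else 0) =
        ∑ s ∈ U, ∑ t ∈ U, α s * α t * (if k t < k s then gram φ s t else 0) := by
      rw [Finset.sum_comm]
      refine Finset.sum_congr rfl fun s _ => Finset.sum_congr rfl fun t _ => ?_
      rw [gram_symm φ t s, mul_comm (α t)]
    have hsplit : ∑ s ∈ U, ∑ t ∈ U, α s * α t * gram φ s t =
        ∑ s ∈ U, ∑ t ∈ U, α s * α t * (if k t = k s then gram φ s t else 0) +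
        (∑ s ∈ U, ∑ t ∈ U, α s * α t * (if k t < k s then gram φ s t else 0) +
        ∑ s ∈ U, ∑ t ∈ U, α s * α t * (if k s < k t then gram φ s t else 0)) := by
      simp only [← Finset.sum_add_distrib]
      refine Finset.sum_congr rfl fun s _ => Finset.sum_congr rfl fun t _ => ?_
      rw [← mul_add, ← mul_add]
      congr 1
      rcases lt_trichotomy (k t) (k s) with h | h | h
      · simp [h, h.ne, h.le]
      · simp [h]
      · simp [h, h.ne', h.le]
    rw [hsplit, hcross']
    have : 0 ≤ B ^ 2 * ∑ s ∈ U, α s ^ 2 :=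
      mul_nonneg (sq_nonneg _) (Finset.sum_nonneg fun _ _ => sq_nonneg _)
    linarith
  have hb := hφ.sum_pairing_sq_le_of_gram hf U (by positivity) hgram
  refine le_trans ?_ hb
  rw [hU, Finset.mul_sum]
  exact Finset.sum_le_sum hbig

end Forest

/-! ### Selection of trees -/

section Selection

variable {ι : Type*} {k n l₀ l : ι → ℤ} {B : ℝ} {φ : ι → ℝ → ℂ}

/-- The tree with top `I_t × {ξ}`: tiles below `I_t` whose first frequency interval lies, at its
own scale, in a large neighbourhood of `ξ`. -/
def InTree (k n l₀ : ι → ℤ) (t : ι) (ξ : ℝ) (s : ι) : Prop :=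
  timeIv (k s) (n s) ⊆ timeIv (k t) (n t) ∧ |freqMid (k s) (l₀ s) - ξ| ≤ 100000 * 2 ^ (-k s)

/-- The part of a tree that is lacunary in the frequency `l`, on the side of `ξ` given by the sign
`σ`: the frequency interval of `l` keeps a distance from `ξ` comparable to its length. -/
def InLac (k n l₀ l : ι → ℤ) (σ : ℝ) (t : ι) (ξ : ℝ) (s : ι) : Prop :=
  InTree k n l₀ t ξ s ∧ 3 / 2 * 2 ^ (-k s) ≤ σ * (freqMid (k s) (l s) - ξ)

lemma abs_freqMid_sub_freqMid_le {k l₀ l : ℤ} (h : |l - l₀| ≤ 10 ^ 5) :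
    |freqMid k l - freqMid k l₀| ≤ 20000 * 2 ^ (-k) := by
  have p := zpow_two_pos (-k)
  have h' : |(l : ℝ) - l₀| ≤ 10 ^ 5 := by exact_mod_cast h
  have e : freqMid k l - freqMid k l₀ = (l - l₀) / 5 * 2 ^ (-k) := by unfold freqMid; ring
  rw [e, abs_mul, abs_of_pos p, abs_div, abs_of_pos (by norm_num : (0 : ℝ) < 5)]
  gcongr
  linarith

lemma InLac.abs_le (h : ∀ s, |l s - l₀ s| ≤ 10 ^ 5) {σ ξ : ℝ} {s t : ι}
    (hs : InLac k n l₀ l σ t ξ s) : |freqMid (k s) (l s) - ξ| ≤ 120000 * 2 ^ (-k s) := by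
  have h1 := abs_freqMid_sub_freqMid_le (k := k s) (h s)
  have h2 := abs_sub_le (freqMid (k s) (l s)) (freqMid (k s) (l₀ s)) ξ
  linarith [hs.1.2]

/-- If a tile of one lacunary tree lies under the frequency interval of a much shorter tile of
another one, then the top frequencies of the trees are ordered. -/
lemma InLac.lt_of_overlap (hT : IsTileFamily k n l) (h : ∀ s, |l s - l₀ s| ≤ 10 ^ 5)
    {σ ξ ξ' : ℝ} (hσ : |σ| = 1) {s s' t t' : ι} (hs : InLac k n l₀ l σ t ξ s)
    (hs' : InLac k n l₀ l σ t' ξ' s') (hk : k s' < k s)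
    (hov : ¬ Disjoint (freqIv (k s) (l s)) (freqIv (k s') (l s'))) : σ * ξ' < σ * ξ := by
  have h1 := hT.zpow_le_of_lt hk
  have h2 := abs_freqMid_sub_le hov
  have h3 := hs.abs_le h
  have h4 := hs'.2
  have p := zpow_two_pos (-k s)
  have h5 : |σ * (freqMid (k s') (l s') - ξ)| ≤
      2 ^ (-k s) / 2 + 2 ^ (-k s') / 2 + 120000 * 2 ^ (-k s) := by
    rw [abs_mul, hσ, one_mul]
    have := abs_sub_le (freqMid (k s') (l s')) (freqMid (k s) (l s)) ξ
    rw [abs_sub_comm (freqMid (k s') (l s')) (freqMid (k s) (l s))] at this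
    linarith
  have h6 := (_root_.abs_le.1 h5).2
  nlinarith

lemma InLac.inTree_of_overlap (hT : IsTileFamily k n l) (h : ∀ s, |l s - l₀ s| ≤ 10 ^ 5)
    {σ ξ : ℝ} {s s' t : ι} (hs : InLac k n l₀ l σ t ξ s) (hk : k s' < k s)
    (hov : ¬ Disjoint (freqIv (k s) (l s)) (freqIv (k s') (l s')))
    (hsub : timeIv (k s') (n s') ⊆ timeIv (k t) (n t)) : InTree k n l₀ t ξ s' := by
  refine ⟨hsub, ?_⟩
  have h1 := hT.zpow_le_of_lt hk
  have h2 := abs_freqMid_sub_le hov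
  have h3 := hs.abs_le h
  have h4 := abs_freqMid_sub_freqMid_le (k := k s') (h s')
  have p := zpow_two_pos (-k s)
  have h5 := abs_sub_le (freqMid (k s') (l₀ s')) (freqMid (k s') (l s')) ξ
  have h6 := abs_sub_le (freqMid (k s') (l s')) (freqMid (k s) (l s)) ξ
  rw [abs_sub_comm] at h2 h4
  linarith

open Classical in
/-- The greedy selection. Trees that are too heavy are removed one after another, those with the
extreme top frequency (in the direction `σ`) first, and each time the whole tree is removed. The
order of selection makes the selected lacunary trees strongly disjoint. -/
lemma exists_selection (hT : IsTileFamily k n l) (h : ∀ s, |l s - l₀ s| ≤ 10 ^ 5)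
    {σ : ℝ} (hσ : |σ| = 1) (α : ι → ℝ) (lam : ℝ) (Θ : Finset (ι × ℝ)) (P : Finset ι) :
    ∃ P' ⊆ P, ∃ 𝓣 ⊆ Θ, ∃ T : ι × ℝ → Finset ι,
      (∀ s ∈ P, s ∉ P' → ∃ θ ∈ 𝓣, InTree k n l₀ θ.1 θ.2 s) ∧
      (∀ θ ∈ 𝓣, T θ ⊆ P ∧ ∀ s ∈ T θ, InLac k n l₀ l σ θ.1 θ.2 s) ∧
      (∀ θ ∈ 𝓣, ∀ θ' ∈ 𝓣, θ ≠ θ' → Disjoint (T θ) (T θ')) ∧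
      (∀ θ ∈ 𝓣, lam ^ 2 * 2 ^ k θ.1 < ∑ s ∈ T θ, α s ^ 2) ∧
      (∀ θ ∈ 𝓣, ∀ θ' ∈ 𝓣, ∀ s ∈ T θ, ∀ s' ∈ T θ', k s' < k s →
        ¬ Disjoint (freqIv (k s) (l s)) (freqIv (k s') (l s')) →
        Disjoint (timeIv (k s') (n s')) (timeIv (k θ.1) (n θ.1))) ∧
      (∀ θ ∈ Θ, ∑ s ∈ P' with InLac k n l₀ l σ θ.1 θ.2 s, α s ^ 2 ≤ lam ^ 2 * 2 ^ k θ.1) := by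
  induction P using Finset.strongInduction with
  | H P ih =>
  set W : ι × ℝ → Finset ι := fun θ => P.filter fun s => InLac k n l₀ l σ θ.1 θ.2 s with hW
  set bad := Θ.filter fun θ => lam ^ 2 * 2 ^ k θ.1 < ∑ s ∈ W θ, α s ^ 2 with hbad
  rcases bad.eq_empty_or_nonempty with hb | hb
  · refine ⟨P, subset_rfl, ∅, Finset.empty_subset _, fun _ => ∅, by simp +contextual, by simp,
      by simp, by simp, by simp, fun θ hθ => not_lt.1 fun hlt => ?_⟩
    have : θ ∈ bad := Finset.mem_filter.2 ⟨hθ, hlt⟩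
    simp [hb] at this
  obtain ⟨θ₀, hθ₀, hmax⟩ := bad.exists_max_image (fun θ => σ * θ.2) hb
  obtain ⟨hθ₀Θ, hθ₀b⟩ := Finset.mem_filter.1 hθ₀
  set P₁ := P.filter fun s => ¬ InTree k n l₀ θ₀.1 θ₀.2 s with hP₁
  have hne : (W θ₀).Nonempty := by
    by_contra hemp
    rw [Finset.not_nonempty_iff_eq_empty] at hemp
    rw [hemp, Finset.sum_empty] at hθ₀b
    have := zpow_two_pos (k θ₀.1)
    nlinarith [mul_nonneg (sq_nonneg lam) this.le]
  have hlt : P₁ ⊂ P := by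
    obtain ⟨s, hs⟩ := hne
    obtain ⟨hsP, hsL⟩ := Finset.mem_filter.1 hs
    refine (Finset.filter_subset _ _).ssubset_of_ne fun heq => ?_
    have : s ∈ P₁ := by rw [hP₁, heq]; exact hsP
    exact (Finset.mem_filter.1 this).2 hsL.1
  obtain ⟨P', hP', 𝓣, h𝓣, T, c1, c2, c3, c4, c5, c6⟩ := ih P₁ hlt
  have hnot : θ₀ ∉ 𝓣 := by
    intro hmem
    have hz : T θ₀ = ∅ := by
      refine Finset.eq_empty_of_forall_notMem fun s hs => ?_
      exact (Finset.mem_filter.1 ((c2 θ₀ hmem).1 hs)).2 ((c2 θ₀ hmem).2 s hs).1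
    have h4 := c4 θ₀ hmem
    rw [hz, Finset.sum_empty] at h4
    have := zpow_two_pos (k θ₀.1)
    nlinarith [mul_nonneg (sq_nonneg lam) this.le]
  have hT0 : Function.update T θ₀ (W θ₀) θ₀ = W θ₀ := Function.update_self ..
  have hT1 : ∀ θ ∈ 𝓣, Function.update T θ₀ (W θ₀) θ = T θ := fun θ hθ =>
    Function.update_of_ne (fun e => hnot (by rwa [← e])) ..
  have hle : ∀ θ ∈ 𝓣, σ * θ.2 ≤ σ * θ₀.2 := by
    intro θ hθ
    refine hmax θ (Finset.mem_filter.2 ⟨h𝓣 hθ, (c4 θ hθ).trans_le ?_⟩)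
    refine Finset.sum_le_sum_of_subset_of_nonneg (fun s hs => ?_) fun _ _ _ => sq_nonneg _
    exact Finset.mem_filter.2 ⟨hlt.1 ((c2 θ hθ).1 hs), (c2 θ hθ).2 s hs⟩
  have hd0 : ∀ θ ∈ 𝓣, Disjoint (W θ₀) (T θ) := by
    intro θ hθ
    refine Finset.disjoint_left.2 fun s hs hs' => ?_
    exact (Finset.mem_filter.1 ((c2 θ hθ).1 hs')).2 (Finset.mem_filter.1 hs).2.1
  refine ⟨P', hP'.trans hlt.1, insert θ₀ 𝓣, Finset.insert_subset hθ₀Θ h𝓣,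
    Function.update T θ₀ (W θ₀), ?_, ?_, ?_, ?_, ?_, c6⟩
  · intro s hs hs'
    by_cases ht : InTree k n l₀ θ₀.1 θ₀.2 s
    · exact ⟨θ₀, Finset.mem_insert_self _ _, ht⟩
    · obtain ⟨θ, hθ, h1⟩ := c1 s (Finset.mem_filter.2 ⟨hs, ht⟩) hs'
      exact ⟨θ, Finset.mem_insert_of_mem hθ, h1⟩
  · intro θ hθ
    rcases Finset.mem_insert.1 hθ with rfl | hθ
    · rw [hT0]
      exact ⟨Finset.filter_subset _ _, fun s hs => (Finset.mem_filter.1 hs).2⟩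
    · rw [hT1 θ hθ]
      exact ⟨(c2 θ hθ).1.trans hlt.1, (c2 θ hθ).2⟩
  · intro θ hθ θ' hθ' hne'
    rcases Finset.mem_insert.1 hθ with rfl | h1 <;> rcases Finset.mem_insert.1 hθ' with rfl | h2
    · exact absurd rfl hne'
    · rw [hT0, hT1 _ h2]; exact hd0 _ h2
    · rw [hT0, hT1 _ h1]; exact (hd0 _ h1).symm
    · rw [hT1 _ h1, hT1 _ h2]; exact c3 _ h1 _ h2 hne'
  · intro θ hθ
    rcases Finset.mem_insert.1 hθ with rfl | hθ
    · rw [hT0]; exact hθ₀b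
    · rw [hT1 _ hθ]; exact c4 _ hθ
  · intro θ hθ θ' hθ' s hs s' hs' hk hov
    rcases Finset.mem_insert.1 hθ with rfl | h1 <;> rcases Finset.mem_insert.1 hθ' with rfl | h2
    · rw [hT0] at hs hs'
      exact absurd (InLac.lt_of_overlap hT h hσ (Finset.mem_filter.1 hs).2
        (Finset.mem_filter.1 hs').2 hk hov) (lt_irrefl _)
    · -- `s'` survived the removal of the tree of `θ`, so it cannot lie below its top.
      rw [hT0] at hs
      rw [hT1 _ h2] at hs'
      have hsL := (Finset.mem_filter.1 hs).2
      have hks : k s' ≤ k θ.1 := hk.le.trans (zpow_le_of_timeIv_subset hsL.1.1)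
      refine (hT.time_nested θ.1 s' hks).resolve_left fun hsub => ?_
      exact (Finset.mem_filter.1 ((c2 _ h2).1 hs')).2
        (InLac.inTree_of_overlap hT h hsL hk hov hsub)
    · rw [hT0] at hs'
      rw [hT1 _ h1] at hs
      exact absurd (InLac.lt_of_overlap hT h hσ ((c2 _ h1).2 s hs)
        (Finset.mem_filter.1 hs').2 hk hov) (not_lt.2 (hle θ h1))
    · rw [hT1 _ h1] at hs
      rw [hT1 _ h2] at hs'
      exact c5 θ h1 θ' h2 s hs s' hs' hk hov

open Classical in
/-- One pass of the selection, with the total length of the removed tops controlled by the `L²`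
norm of the function. -/
lemma exists_size_reduction (hT : IsTileFamily k n l) (h : ∀ s, |l s - l₀ s| ≤ 10 ^ 5)
    (hφ : IsPacketFamily k n l B φ) {f : ℝ → ℂ} (hf : MemLp f 2) {σ : ℝ} (hσ : |σ| = 1)
    {lam : ℝ} (hlam : 0 ≤ lam) (Θ : Finset (ι × ℝ)) (P : Finset ι)
    (hP : ∀ s ∈ P, ‖pairing f (φ s)‖ ^ 2 ≤ 4 * lam ^ 2 * 2 ^ k s) :
    ∃ P' ⊆ P, ∃ 𝓣 ⊆ Θ,
      (∀ s ∈ P, s ∉ P' → ∃ θ ∈ 𝓣, InTree k n l₀ θ.1 θ.2 s) ∧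
      lam ^ 2 * ∑ θ ∈ 𝓣, (2 : ℝ) ^ k θ.1 ≤ 2 * 10 ^ 12 * B ^ 2 * ∫ x, ‖f x‖ ^ 2 ∧
      ∀ θ ∈ Θ, ∑ s ∈ P' with InLac k n l₀ l σ θ.1 θ.2 s, ‖pairing f (φ s)‖ ^ 2 ≤
        lam ^ 2 * 2 ^ k θ.1 := by
  obtain ⟨P', hP', 𝓣, h𝓣, T, c1, c2, c3, c4, c5, c6⟩ :=
    exists_selection hT h hσ (fun s => ‖pairing f (φ s)‖) lam Θ P
  refine ⟨P', hP', 𝓣, h𝓣, c1, ?_, c6⟩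
  refine forest_bessel hT hφ hf 𝓣 T Prod.fst Prod.snd hlam (fun θ hθ s hs => ?_)
    (fun θ hθ s hs => ?_) c3 c5 (fun θ hθ s hs => hP s ((c2 θ hθ).1 hs)) fun θ hθ => (c4 θ hθ).le
  · exact ((c2 θ hθ).2 s hs).1.1
  · refine (((c2 θ hθ).2 s hs).abs_le h).trans ?_
    have := zpow_two_pos (-k s)
    linarith

end Selection

/-! ### The estimate for the model sum in terms of sizes -/

section Size

variable {ι : Type*} {k n l₀ l l₁ : ι → ℤ} {B : ℝ}

open Classical in
/-- The size of the coefficients `α` on `P` is at most `lam`: on each lacunary tree with top in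
`Θ`, the square sum of the coefficients is at most `lam²` times the length of the top. -/
def SizeLE (k n l₀ l : ι → ℤ) (α : ι → ℝ) (lam : ℝ) (Θ : Finset (ι × ℝ)) (P : Finset ι) : Prop :=
  ∀ σ : ℝ, |σ| = 1 → ∀ θ ∈ Θ,
    ∑ s ∈ P with InLac k n l₀ l σ θ.1 θ.2 s, α s ^ 2 ≤ lam ^ 2 * 2 ^ k θ.1

lemma SizeLE.mono {α : ι → ℝ} {lam : ℝ} {Θ : Finset (ι × ℝ)} {P P' : Finset ι}
    (h : SizeLE k n l₀ l α lam Θ P) (hP : P' ⊆ P) : SizeLE k n l₀ l α lam Θ P' :=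
  fun σ hσ θ hθ => by
    classical
    exact (Finset.sum_le_sum_of_subset_of_nonneg (Finset.filter_subset_filter _ hP)
      fun _ _ _ => sq_nonneg _).trans (h σ hσ θ hθ)

/-- Every tile of `P` is a lacunary tree with top in `Θ` by itself. -/
def HasSingletons (k n l₀ l : ι → ℤ) (Θ : Finset (ι × ℝ)) (P : Finset ι) : Prop :=
  ∀ s ∈ P, ∃ ξ, (s, ξ) ∈ Θ ∧ ∃ σ : ℝ, |σ| = 1 ∧ InLac k n l₀ l σ s ξ s

lemma SizeLE.sq_le {α : ι → ℝ} {lam : ℝ} {Θ : Finset (ι × ℝ)} {P : Finset ι}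
    (h : SizeLE k n l₀ l α lam Θ P) (hΘ : HasSingletons k n l₀ l Θ P) {s : ι} (hs : s ∈ P) :
    α s ^ 2 ≤ lam ^ 2 * 2 ^ k s := by
  classical
  obtain ⟨ξ, hξ, σ, hσ, hL⟩ := hΘ s hs
  refine le_trans ?_ (h σ hσ _ hξ)
  exact Finset.single_le_sum (f := fun s => α s ^ 2) (fun _ _ => sq_nonneg _)
    (Finset.mem_filter.2 ⟨hs, hL⟩)

lemma sum_union_le {Θ : Type*} [DecidableEq Θ] (𝓣 𝓣' : Finset Θ) (h : Θ → ℝ) (h0 : ∀ θ, 0 ≤ h θ) :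
    ∑ θ ∈ 𝓣 ∪ 𝓣', h θ ≤ ∑ θ ∈ 𝓣, h θ + ∑ θ ∈ 𝓣', h θ := by
  rw [← Finset.sum_union_inter]
  exact le_add_of_nonneg_right (Finset.sum_nonneg fun _ _ => h0 _)

/-- The size of one function is halved by the removal of a collection of trees whose tops have
controlled total length. -/
lemma SizeLE.halve (hT : IsTileFamily k n l) (h : ∀ s, |l s - l₀ s| ≤ 10 ^ 5)
    {φ : ι → ℝ → ℂ} (hφ : IsPacketFamily k n l B φ) {f : ℝ → ℂ} (hf : MemLp f 2)
    {lam : ℝ} (hlam : 0 ≤ lam) {Θ : Finset (ι × ℝ)} {P : Finset ι}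
    (hΘ : HasSingletons k n l₀ l Θ P)
    (hP : SizeLE k n l₀ l (fun s => ‖pairing f (φ s)‖) (2 * lam) Θ P) :
    ∃ P' ⊆ P, ∃ 𝓣 ⊆ Θ,
      (∀ s ∈ P, s ∉ P' → ∃ θ ∈ 𝓣, InTree k n l₀ θ.1 θ.2 s) ∧
      lam ^ 2 * ∑ θ ∈ 𝓣, (2 : ℝ) ^ k θ.1 ≤ 4 * 10 ^ 12 * B ^ 2 * ∫ x, ‖f x‖ ^ 2 ∧
      SizeLE k n l₀ l (fun s => ‖pairing f (φ s)‖) lam Θ P' := by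
  classical
  have h1 : ∀ s ∈ P, ‖pairing f (φ s)‖ ^ 2 ≤ 4 * lam ^ 2 * 2 ^ k s := fun s hs => by
    have := hP.sq_le hΘ hs
    rw [mul_pow] at this
    linarith
  obtain ⟨P₁, hP₁, 𝓣₁, h𝓣₁, a1, a2, a3⟩ :=
    exists_size_reduction hT h hφ hf (σ := 1) (by simp) hlam Θ P h1
  obtain ⟨P₂, hP₂, 𝓣₂, h𝓣₂, b1, b2, b3⟩ :=
    exists_size_reduction hT h hφ hf (σ := -1) (by simp) hlam Θ P₁ fun s hs => h1 s (hP₁ hs)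
  refine ⟨P₂, hP₂.trans hP₁, 𝓣₁ ∪ 𝓣₂, Finset.union_subset h𝓣₁ h𝓣₂, fun s hs hs' => ?_, ?_, ?_⟩
  · by_cases hs1 : s ∈ P₁
    · obtain ⟨θ, hθ, hL⟩ := b1 s hs1 hs'
      exact ⟨θ, Finset.mem_union_right _ hθ, hL⟩
    · obtain ⟨θ, hθ, hL⟩ := a1 s hs hs1
      exact ⟨θ, Finset.mem_union_left _ hθ, hL⟩
  · have := mul_le_mul_of_nonneg_left (sum_union_le 𝓣₁ 𝓣₂ (fun θ => (2 : ℝ) ^ k θ.1)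
      fun θ => (zpow_two_pos _).le) (sq_nonneg lam)
    linarith
  · intro σ hσ θ hθ
    rcases (abs_eq zero_le_one).1 hσ with rfl | rfl
    · exact (Finset.sum_le_sum_of_subset_of_nonneg (Finset.filter_subset_filter _ hP₂)
        fun _ _ _ => sq_nonneg _).trans (a3 θ hθ)
    · exact b3 θ hθ

/-- The two frequencies of a multitile cannot both be close to `ξ`, so that a tree is covered by
its four lacunary parts. -/
lemma InTree.exists_inLac {e : ℤ} (he : 10 ^ 2 < |e|) (hl : ∀ s, l₁ s = l₀ s + e) {t s : ι} {ξ : ℝ}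
    (h : InTree k n l₀ t ξ s) :
    ∃ σ : ℝ, (σ = 1 ∨ σ = -1) ∧ (InLac k n l₀ l₀ σ t ξ s ∨ InLac k n l₀ l₁ σ t ξ s) := by
  have p := zpow_two_pos (-k s)
  have e1 : freqMid (k s) (l₁ s) = freqMid (k s) (l₀ s) + e / 5 * 2 ^ (-k s) := by
    rw [hl]; unfold freqMid; push_cast; ring
  have he' : (10 : ℝ) ^ 2 < |(e : ℝ)| := by exact_mod_cast he
  unfold InLac
  by_cases h1 : 3 / 2 * 2 ^ (-k s) ≤ 1 * (freqMid (k s) (l₀ s) - ξ)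
  · exact ⟨1, .inl rfl, .inl ⟨h, h1⟩⟩
  by_cases h2 : 3 / 2 * 2 ^ (-k s) ≤ -1 * (freqMid (k s) (l₀ s) - ξ)
  · exact ⟨-1, .inr rfl, .inl ⟨h, h2⟩⟩
  rcases lt_abs.1 he' with h3 | h3
  · refine ⟨1, .inl rfl, .inr ⟨h, ?_⟩⟩
    rw [e1]
    nlinarith
  · refine ⟨-1, .inr rfl, .inr ⟨h, ?_⟩⟩
    rw [e1]
    nlinarith

open Classical in
/-- The single tree estimate. On a lacunary part of a tree, the coefficients of one function are
square summable, and those of the other function are bounded one by one. -/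
lemma sum_tree_le {e : ℤ} (he : 10 ^ 2 < |e|) (hl : ∀ s, l₁ s = l₀ s + e) {α β : ι → ℝ} {lam : ℝ}
    {Θ : Finset (ι × ℝ)} {P : Finset ι}
    (hΘ₀ : HasSingletons k n l₀ l₀ Θ P) (hΘ₁ : HasSingletons k n l₀ l₁ Θ P)
    (hα : SizeLE k n l₀ l₀ α lam Θ P) (hβ : SizeLE k n l₀ l₁ β lam Θ P)
    {θ : ι × ℝ} (hθ : θ ∈ Θ) :
    ∑ s ∈ P with InTree k n l₀ θ.1 θ.2 s, 2 ^ (-k s) * α s ^ 2 * β s ^ 2 ≤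
      4 * lam ^ 4 * 2 ^ k θ.1 := by
  set F : ι → ℝ := fun s => 2 ^ (-k s) * α s ^ 2 * β s ^ 2
  have hF : ∀ s, 0 ≤ F s := fun s => by have := zpow_two_pos (-k s); positivity
  have hinv : ∀ s, (2 : ℝ) ^ (-k s) * 2 ^ k s = 1 := fun s => by
    rw [← zpow_add₀ (by norm_num), neg_add_cancel, zpow_zero]
  have hF0 : ∀ s ∈ P, F s ≤ lam ^ 2 * α s ^ 2 := fun s hs => by
    have p := zpow_two_pos (-k s)
    calc F s ≤ 2 ^ (-k s) * α s ^ 2 * (lam ^ 2 * 2 ^ k s) := by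
          simp only [F]; gcongr; exact hβ.sq_le hΘ₁ hs
      _ = lam ^ 2 * α s ^ 2 * (2 ^ (-k s) * 2 ^ k s) := by ring
      _ = _ := by rw [hinv, mul_one]
  have hF1 : ∀ s ∈ P, F s ≤ lam ^ 2 * β s ^ 2 := fun s hs => by
    have p := zpow_two_pos (-k s)
    calc F s ≤ 2 ^ (-k s) * (lam ^ 2 * 2 ^ k s) * β s ^ 2 := by
          simp only [F]; gcongr; exact hα.sq_le hΘ₀ hs
      _ = lam ^ 2 * β s ^ 2 * (2 ^ (-k s) * 2 ^ k s) := by ring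
      _ = _ := by rw [hinv, mul_one]
  have hlac0 : ∀ σ : ℝ, |σ| = 1 → ∑ s ∈ P with InLac k n l₀ l₀ σ θ.1 θ.2 s, F s ≤
      lam ^ 4 * 2 ^ k θ.1 := fun σ hσ => by
    calc _ ≤ ∑ s ∈ P with InLac k n l₀ l₀ σ θ.1 θ.2 s, lam ^ 2 * α s ^ 2 :=
          Finset.sum_le_sum fun s hs => hF0 s (Finset.mem_filter.1 hs).1
      _ ≤ lam ^ 2 * (lam ^ 2 * 2 ^ k θ.1) := by
          rw [← Finset.mul_sum]; gcongr; exact hα σ hσ θ hθ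
      _ = _ := by ring
  have hlac1 : ∀ σ : ℝ, |σ| = 1 → ∑ s ∈ P with InLac k n l₀ l₁ σ θ.1 θ.2 s, F s ≤
      lam ^ 4 * 2 ^ k θ.1 := fun σ hσ => by
    calc _ ≤ ∑ s ∈ P with InLac k n l₀ l₁ σ θ.1 θ.2 s, lam ^ 2 * β s ^ 2 :=
          Finset.sum_le_sum fun s hs => hF1 s (Finset.mem_filter.1 hs).1
      _ ≤ lam ^ 2 * (lam ^ 2 * 2 ^ k θ.1) := by
          rw [← Finset.mul_sum]; gcongr; exact hβ σ hσ θ hθ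
      _ = _ := by ring
  have hsub : (P.filter fun s => InTree k n l₀ θ.1 θ.2 s) ⊆
      ((P.filter fun s => InLac k n l₀ l₀ 1 θ.1 θ.2 s) ∪
        P.filter fun s => InLac k n l₀ l₀ (-1) θ.1 θ.2 s) ∪
      ((P.filter fun s => InLac k n l₀ l₁ 1 θ.1 θ.2 s) ∪
        P.filter fun s => InLac k n l₀ l₁ (-1) θ.1 θ.2 s) := by
    intro s hs
    obtain ⟨hsP, hsT⟩ := Finset.mem_filter.1 hs
    obtain ⟨σ, rfl | rfl, hL | hL⟩ := hsT.exists_inLac he hl <;> simp [hsP, hL]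
  have h1 := Finset.sum_le_sum_of_subset_of_nonneg (f := F) hsub fun s _ _ => hF s
  have h2 := h1.trans (sum_union_le _ _ F hF)
  have h3 := sum_union_le (P.filter fun s => InLac k n l₀ l₀ 1 θ.1 θ.2 s)
    (P.filter fun s => InLac k n l₀ l₀ (-1) θ.1 θ.2 s) F hF
  have h4 := sum_union_le (P.filter fun s => InLac k n l₀ l₁ 1 θ.1 θ.2 s)
    (P.filter fun s => InLac k n l₀ l₁ (-1) θ.1 θ.2 s) F hF
  have h5 := hlac0 1 (by simp)
  have h6 := hlac0 (-1) (by simp)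
  have h7 := hlac1 1 (by simp)
  have h8 := hlac1 (-1) (by simp)
  linarith

lemma sum_filter_exists_le {Θ : Type*} (𝓣 : Finset Θ) (P : Finset ι) (Q : Θ → ι → Prop)
    [∀ θ, DecidablePred (Q θ)] (F : ι → ℝ) (hF : ∀ s, 0 ≤ F s)
    (h : ∀ s ∈ P, ∃ θ ∈ 𝓣, Q θ s) :
    ∑ s ∈ P, F s ≤ ∑ θ ∈ 𝓣, ∑ s ∈ P with Q θ s, F s := by
  simp only [Finset.sum_filter]
  rw [Finset.sum_comm]
  refine Finset.sum_le_sum fun s hs => ?_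
  obtain ⟨θ, hθ, hQ⟩ := h s hs
  refine le_trans ?_ (Finset.single_le_sum (f := fun θ => if Q θ s then F s else 0)
    (fun θ _ => ?_) hθ)
  · simp [hQ]
  · split_ifs
    · exact hF s
    · rfl

/-- If both sizes are at most `Λ`, then `∑ |I_s|⁻¹ |⟨f, φ₀⟩|² |⟨g, φ₁⟩|² ≲ Λ² ‖·‖₂²`: halving the
sizes again and again leads to a geometric series. -/
lemma sum_coeff_sq_mul_le {e : ℤ} (he : 10 ^ 2 < |e|) (he' : |e| ≤ 10 ^ 5)
    (hl : ∀ s, l₁ s = l₀ s + e) (hT₀ : IsTileFamily k n l₀) (hT₁ : IsTileFamily k n l₁)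
    {φ₀ φ₁ : ι → ℝ → ℂ} (hφ₀ : IsPacketFamily k n l₀ B φ₀) (hφ₁ : IsPacketFamily k n l₁ B φ₁)
    {f g : ℝ → ℂ} (hf : MemLp f 2) (hg : MemLp g 2) {N Λ : ℝ} (hΛ : 0 ≤ Λ)
    (hfN : ∫ x, ‖f x‖ ^ 2 ≤ N) (hgN : ∫ x, ‖g x‖ ^ 2 ≤ N) (P : Finset ι)
    (hsf : ∀ Θ, SizeLE k n l₀ l₀ (fun s => ‖pairing f (φ₀ s)‖) Λ (P ×ˢ Θ) P)
    (hsg : ∀ Θ, SizeLE k n l₀ l₁ (fun s => ‖pairing g (φ₁ s)‖) Λ (P ×ˢ Θ) P) :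
    ∑ s ∈ P, 2 ^ (-k s) * ‖pairing f (φ₀ s)‖ ^ 2 * ‖pairing g (φ₁ s)‖ ^ 2 ≤
      10 ^ 15 * B ^ 2 * N * Λ ^ 2 := by
  classical
  set F : ι → ℝ := fun s => 2 ^ (-k s) * ‖pairing f (φ₀ s)‖ ^ 2 * ‖pairing g (φ₁ s)‖ ^ 2
  have hF : ∀ s, 0 ≤ F s := fun s => by have := zpow_two_pos (-k s); positivity
  have hN : 0 ≤ N := le_trans (integral_nonneg fun x => by positivity) hfN
  have hd₀ : ∀ s, |l₀ s - l₀ s| ≤ 10 ^ 5 := fun s => by simp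
  have hd₁ : ∀ s, |l₁ s - l₀ s| ≤ 10 ^ 5 := fun s => by rw [hl]; simpa using he'
  -- Tops are taken at the frequencies of the tiles themselves, to have the singletons as trees.
  set Ξ : Finset ℝ :=
    P.image (fun s => freqMid (k s) (l₀ s)) ∪ P.image fun s => freqMid (k s) (l₁ s)
  have e1 : ∀ s, freqMid (k s) (l₁ s) = freqMid (k s) (l₀ s) + e / 5 * 2 ^ (-k s) := fun s => by
    rw [hl]; unfold freqMid; push_cast; ring
  have heR : (10 : ℝ) ^ 2 < |(e : ℝ)| := by exact_mod_cast he
  have hsign : ∃ σ : ℝ, |σ| = 1 ∧ 100 < σ * e := by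
    rcases lt_abs.1 heR with h3 | h3
    · exact ⟨1, by simp, by linarith⟩
    · exact ⟨-1, by simp, by linarith⟩
  obtain ⟨σ, hσ, hσe⟩ := hsign
  have hΘ₁ : HasSingletons k n l₀ l₁ (P ×ˢ Ξ) P := fun s hs => by
    have p := zpow_two_pos (-k s)
    refine ⟨freqMid (k s) (l₀ s), Finset.mem_product.2 ⟨hs, Finset.mem_union_left _
      (Finset.mem_image_of_mem _ hs)⟩, σ, hσ, ⟨⟨subset_rfl, ?_⟩, ?_⟩⟩
    · rw [sub_self, abs_zero]; positivity
    · rw [e1]; nlinarith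
  have hΘ₀ : HasSingletons k n l₀ l₀ (P ×ˢ Ξ) P := fun s hs => by
    have p := zpow_two_pos (-k s)
    refine ⟨freqMid (k s) (l₁ s), Finset.mem_product.2 ⟨hs, Finset.mem_union_right _
      (Finset.mem_image_of_mem _ hs)⟩, -σ, by simpa using hσ, ⟨⟨subset_rfl, ?_⟩, ?_⟩⟩
    · rw [abs_sub_comm]
      exact (abs_freqMid_sub_freqMid_le (hd₁ s)).trans (by linarith)
    · rw [e1]; nlinarith
  have hmono : ∀ {l : ι → ℤ} {Θ : Finset (ι × ℝ)} {P P' : Finset ι}, P' ⊆ P →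
      HasSingletons k n l₀ l Θ P → HasSingletons k n l₀ l Θ P' := fun hP h s hs => h s (hP hs)
  set A : ℝ := 10 ^ 15 * B ^ 2 * N * Λ ^ 2 with hA
  have iter : ∀ m : ℕ, ∃ P' ⊆ P,
      SizeLE k n l₀ l₀ (fun s => ‖pairing f (φ₀ s)‖) (Λ * (1 / 2) ^ m) (P ×ˢ Ξ) P' ∧
      SizeLE k n l₀ l₁ (fun s => ‖pairing g (φ₁ s)‖) (Λ * (1 / 2) ^ m) (P ×ˢ Ξ) P' ∧
      ∑ s ∈ P, F s ≤ ∑ s ∈ P', F s + A * (1 - (1 / 4) ^ m) := by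
    intro m
    induction m with
    | zero => exact ⟨P, subset_rfl, by simpa using hsf Ξ, by simpa using hsg Ξ, by simp⟩
    | succ m ih =>
      obtain ⟨P₁, hP₁, hs₀, hs₁, hsum⟩ := ih
      set lam := Λ * (1 / 2) ^ (m + 1) with hlam
      have hlam0 : 0 ≤ lam := by positivity
      have h2 : Λ * (1 / 2) ^ m = 2 * lam := by rw [hlam, pow_succ]; ring
      rw [h2] at hs₀ hs₁
      obtain ⟨P₂, hP₂, 𝓣₂, h𝓣₂, a1, a2, a3⟩ := hs₀.halve hT₀ hd₀ hφ₀ hf hlam0 (hmono hP₁ hΘ₀)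
      obtain ⟨P₃, hP₃, 𝓣₃, h𝓣₃, b1, b2, b3⟩ := (hs₁.mono hP₂).halve hT₁ hd₁ hφ₁ hg hlam0
        (hmono (hP₂.trans hP₁) hΘ₁)
      refine ⟨P₃, hP₃.trans (hP₂.trans hP₁), a3.mono hP₃, b3, ?_⟩
      have hsd : ∑ s ∈ P₁ \ P₃, F s ≤ ∑ θ ∈ 𝓣₂ ∪ 𝓣₃,
          ∑ s ∈ P₁ \ P₃ with InTree k n l₀ θ.1 θ.2 s, F s := by
        refine sum_filter_exists_le _ _ _ F hF fun s hs => ?_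
        obtain ⟨hs1, hs3⟩ := Finset.mem_sdiff.1 hs
        by_cases hs2 : s ∈ P₂
        · obtain ⟨θ, hθ, hL⟩ := b1 s hs2 hs3
          exact ⟨θ, Finset.mem_union_right _ hθ, hL⟩
        · obtain ⟨θ, hθ, hL⟩ := a1 s hs1 hs2
          exact ⟨θ, Finset.mem_union_left _ hθ, hL⟩
      have htree : ∀ θ ∈ 𝓣₂ ∪ 𝓣₃, ∑ s ∈ P₁ \ P₃ with InTree k n l₀ θ.1 θ.2 s, F s ≤
          4 * (2 * lam) ^ 4 * 2 ^ k θ.1 := fun θ hθ =>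
        sum_tree_le he hl (hmono (Finset.sdiff_subset.trans hP₁) hΘ₀)
          (hmono (Finset.sdiff_subset.trans hP₁) hΘ₁) (hs₀.mono Finset.sdiff_subset)
          (hs₁.mono Finset.sdiff_subset) (Finset.union_subset h𝓣₂ h𝓣₃ hθ)
      have htops := sum_union_le 𝓣₂ 𝓣₃ (fun θ => (2 : ℝ) ^ k θ.1) fun θ => (zpow_two_pos _).le
      have hlen : lam ^ 2 * ∑ θ ∈ 𝓣₂ ∪ 𝓣₃, (2 : ℝ) ^ k θ.1 ≤ 8 * 10 ^ 12 * B ^ 2 * N := by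
        have i1 := mul_le_mul_of_nonneg_left htops (sq_nonneg lam)
        have i2 : 4 * 10 ^ 12 * B ^ 2 * ∫ x, ‖f x‖ ^ 2 ≤ 4 * 10 ^ 12 * B ^ 2 * N := by gcongr
        have i3 : 4 * 10 ^ 12 * B ^ 2 * ∫ x, ‖g x‖ ^ 2 ≤ 4 * 10 ^ 12 * B ^ 2 * N := by gcongr
        linarith
      have hrem : ∑ s ∈ P₁ \ P₃, F s ≤ A * (1 / 4) ^ (m + 1) := by
        calc _ ≤ ∑ θ ∈ 𝓣₂ ∪ 𝓣₃, 4 * (2 * lam) ^ 4 * (2 : ℝ) ^ k θ.1 :=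
              hsd.trans (Finset.sum_le_sum htree)
          _ = 64 * lam ^ 2 * (lam ^ 2 * ∑ θ ∈ 𝓣₂ ∪ 𝓣₃, (2 : ℝ) ^ k θ.1) := by
              rw [← Finset.mul_sum]; ring
          _ ≤ 64 * lam ^ 2 * (8 * 10 ^ 12 * B ^ 2 * N) := by gcongr
          _ ≤ 10 ^ 15 * B ^ 2 * N * lam ^ 2 := by
              have : 0 ≤ B ^ 2 * N * lam ^ 2 := by positivity
              linarith
          _ = _ := by
              rw [hA, hlam, mul_pow, ← pow_mul, mul_comm (m + 1), pow_mul]; norm_num; ring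
      have hsplit := Finset.sum_sdiff (f := F) (hP₃.trans hP₂)
      have hA0 : 0 ≤ A * (1 / 4) ^ (m + 1) := by positivity
      have h4 : A * (1 / 4) ^ m = 4 * (A * (1 / 4) ^ (m + 1)) := by rw [pow_succ]; ring
      linarith
  have hlim : ∀ m : ℕ, ∑ s ∈ P, F s ≤ A + (∑ s ∈ P, Λ ^ 4 * 2 ^ k s) * (1 / 16) ^ m := by
    intro m
    obtain ⟨P', hP', h0, h1, h2⟩ := iter m
    have h3 : ∑ s ∈ P', F s ≤ (∑ s ∈ P, Λ ^ 4 * 2 ^ k s) * (1 / 16) ^ m := by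
      rw [Finset.sum_mul]
      refine (Finset.sum_le_sum fun s hs => ?_).trans
        (Finset.sum_le_sum_of_subset_of_nonneg hP' fun s _ _ => ?_)
      · have i0 := h0.sq_le (hmono hP' hΘ₀) hs
        have i1 := h1.sq_le (hmono hP' hΘ₁) hs
        have p := zpow_two_pos (-k s)
        have p' := zpow_two_pos (k s)
        have hinv : (2 : ℝ) ^ (-k s) * 2 ^ k s = 1 := by
          rw [← zpow_add₀ (by norm_num), neg_add_cancel, zpow_zero]
        calc F s ≤ 2 ^ (-k s) * ((Λ * (1 / 2) ^ m) ^ 2 * 2 ^ k s) *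
              ((Λ * (1 / 2) ^ m) ^ 2 * 2 ^ k s) := by
              simp only [F]; gcongr
          _ = (2 ^ (-k s) * 2 ^ k s) * (Λ ^ 4 * 2 ^ k s * (((1 / 2) ^ m) ^ 4)) := by ring
          _ = _ := by rw [hinv, one_mul, ← pow_mul, mul_comm m, pow_mul]; norm_num
      · have p' := zpow_two_pos (k s)
        positivity
    have h4 : A * (1 - (1 / 4) ^ m) ≤ A := by
      have : 0 ≤ A := by positivity
      refine mul_le_of_le_one_right this ?_
      have : (0 : ℝ) ≤ (1 / 4) ^ m := by positivity
      linarith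
    linarith
  have ht : Filter.Tendsto (fun m : ℕ => A + (∑ s ∈ P, Λ ^ 4 * 2 ^ k s) * (1 / 16 : ℝ) ^ m)
      Filter.atTop (nhds (A + (∑ s ∈ P, Λ ^ 4 * 2 ^ k s) * 0)) :=
    ((tendsto_pow_atTop_nhds_zero_of_lt_one (by norm_num) (by norm_num)).const_mul _).const_add _
  have := ge_of_tendsto' ht hlim
  simpa using this

end Size

/-! ### The exceptional set -/

/-- The union of the balls on which the average of `h` exceeds `1/2`. -/
def exceptional (h : ℝ → ℝ) : Set ℝ :=
  ⋃ p ∈ {p : ℝ × ℝ | 0 < p.2 ∧ p.2 < ∫ y in Metric.ball p.1 p.2, h y}, Metric.ball p.1 p.2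

lemma isOpen_exceptional (h : ℝ → ℝ) : IsOpen (exceptional h) :=
  isOpen_biUnion fun _ _ => Metric.isOpen_ball

lemma setIntegral_ball_le_of_notMem {h : ℝ → ℝ} {x : ℝ} (hx : x ∉ exceptional h) {r : ℝ}
    (hr : 0 < r) : ∫ y in Metric.ball x r, h y ≤ r := by
  by_contra hlt
  exact hx (mem_biUnion (x := (x, r)) ⟨hr, not_le.1 hlt⟩ (Metric.mem_ball_self hr))

/-- The weak-type maximal inequality, by Vitali's covering lemma. -/
lemma volume_exceptional_le {h : ℝ → ℝ} (hint : Integrable h) (h0 : ∀ x, 0 ≤ h x) :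
    volume (exceptional h) ≤ ENNReal.ofReal (10 * ∫ x, h x) := by
  set t := {p : ℝ × ℝ | 0 < p.2 ∧ p.2 < ∫ y in Metric.ball p.1 p.2, h y}
  have hle : ∀ A : Set ℝ, ∫ y in A, h y ≤ ∫ y, h y := fun A =>
    setIntegral_le_integral hint (.of_forall h0)
  obtain ⟨u, hut, hdis, hcov⟩ := Vitali.exists_disjoint_subfamily_covering_enlargement_closedBall
    t Prod.fst Prod.snd (∫ y, h y) (fun p hp => hp.2.le.trans (hle _)) 5 (by norm_num)
  have hcount : u.Countable := by
    refine hdis.countable_of_nonempty_interior fun p hp => ?_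
    refine (Metric.nonempty_ball (x := p.1).2 (hut hp).1).mono ?_
    exact interior_maximal Metric.ball_subset_closedBall Metric.isOpen_ball
  have hsub : exceptional h ⊆ ⋃ p ∈ u, Metric.closedBall p.1 (5 * p.2) := by
    refine iUnion₂_subset fun p hp => ?_
    obtain ⟨q, hq, hpq⟩ := hcov p hp
    exact (Metric.ball_subset_closedBall.trans hpq).trans
      (subset_biUnion_of_mem (u := fun q : ℝ × ℝ => Metric.closedBall q.1 (5 * q.2)) hq)
  have hsum : ∑' p : u, ENNReal.ofReal (p : ℝ × ℝ).2 ≤ ENNReal.ofReal (∫ x, h x) := by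
    rw [ENNReal.tsum_eq_iSup_sum]
    refine iSup_le fun F => ?_
    rw [← ENNReal.ofReal_sum_of_nonneg fun p _ => (hut p.2).1.le]
    refine ENNReal.ofReal_le_ofReal ?_
    calc ∑ p ∈ F, (p : ℝ × ℝ).2
        ≤ ∑ p ∈ F, ∫ y in Metric.ball (p : ℝ × ℝ).1 (p : ℝ × ℝ).2, h y :=
          Finset.sum_le_sum fun p _ => (hut p.2).2.le
      _ ≤ ∫ y in univ, h y := by
          refine sum_setIntegral_le F (fun p : u => Metric.ball (p : ℝ × ℝ).1 (p : ℝ × ℝ).2) univ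
            (fun p _ => measurableSet_ball) (fun p _ => subset_univ _)
            (fun p _ q _ hpq => ?_) hint h0
          exact (hdis p.2 q.2 fun e => hpq (Subtype.ext e)).mono Metric.ball_subset_closedBall
            Metric.ball_subset_closedBall
      _ = ∫ y, h y := by rw [Measure.restrict_univ]
  calc volume (exceptional h) ≤ volume (⋃ p ∈ u, Metric.closedBall p.1 (5 * p.2)) :=
        measure_mono hsub
    _ ≤ ∑' p : u, volume (Metric.closedBall (p : ℝ × ℝ).1 (5 * (p : ℝ × ℝ).2)) :=
        measure_biUnion_le _ hcount _
    _ = ∑' p : u, ENNReal.ofReal 10 * ENNReal.ofReal (p : ℝ × ℝ).2 := by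
        congr 1; ext p
        rw [Real.volume_closedBall, ← ENNReal.ofReal_mul (by norm_num)]
        congr 1; ring
    _ ≤ _ := by
        rw [ENNReal.tsum_mul_left, ENNReal.ofReal_mul (by norm_num)]
        gcongr

/-- Off the exceptional set, the weighted integrals of `h` are controlled, at all scales. -/
lemma integral_mul_weight_le {h : ℝ → ℝ} (hint : Integrable h) (h0 : ∀ x, 0 ≤ h x) {x : ℝ}
    (hx : x ∉ exceptional h) {L : ℝ} (hL : 0 < L) :
    ∫ y, h y * (weight x L y)⁻¹ ^ 2 ≤ 32 * L := by
  have hpt : ∀ y, ∃ m : ℕ, y ∈ Metric.ball x (2 ^ m * L) ∧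
      (weight x L y)⁻¹ ^ 2 ≤ 16 * (1 / 4) ^ m := by
    intro y
    have hex : ∃ m : ℕ, |y - x| / L < 2 ^ m := pow_unbounded_of_one_lt _ (by norm_num)
    classical
    refine ⟨Nat.find hex, ?_, ?_⟩
    · rw [Metric.mem_ball, Real.dist_eq]
      exact (div_lt_iff₀ hL).1 (Nat.find_spec hex)
    · rcases hm : Nat.find hex with _ | m
      · have := pow_le_one₀ (n := 2) (weight_inv_nonneg x L y) (weight_inv_le_one x L y)
        rw [pow_zero]
        linarith
      · have h1 : (2 : ℝ) ^ m ≤ |y - x| / L :=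
          not_lt.1 (Nat.find_min hex (m := m) (by lia))
        have h2 : ((2 : ℝ) ^ m) ^ 2 ≤ weight x L y := by
          have : ((2 : ℝ) ^ m) ^ 2 ≤ (|y - x| / L) ^ 2 := by gcongr
          rw [div_pow, sq_abs, ← div_pow] at this
          unfold weight
          linarith
        have h3 : (weight x L y)⁻¹ ≤ (1 / 4) ^ m := by
          have e : ((1 : ℝ) / 4) ^ m = (((2 : ℝ) ^ m) ^ 2)⁻¹ := by
            rw [← pow_mul, mul_comm, pow_mul, ← inv_pow]; norm_num
          rw [e]
          gcongr
        have h4 : (weight x L y)⁻¹ ^ 2 ≤ (weight x L y)⁻¹ :=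
          pow_le_of_le_one (weight_inv_nonneg _ _ _) (weight_inv_le_one _ _ _) (by lia)
        have h5 : (0 : ℝ) ≤ (1 / 4) ^ m := by positivity
        rw [pow_succ (1 / 4 : ℝ)]
        linarith
  have hnn : ∀ y, 0 ≤ h y * (weight x L y)⁻¹ ^ 2 := fun y =>
    mul_nonneg (h0 y) (sq_nonneg _)
  have hmeas : AEStronglyMeasurable (fun y => h y * (weight x L y)⁻¹ ^ 2) volume :=
    hint.aestronglyMeasurable.mul ((continuous_weight_inv x L).pow 2).aestronglyMeasurable
  rw [integral_eq_lintegral_of_nonneg_ae (.of_forall hnn) hmeas]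
  refine ENNReal.toReal_le_of_le_ofReal (by positivity) ?_
  calc ∫⁻ y, ENNReal.ofReal (h y * (weight x L y)⁻¹ ^ 2)
      ≤ ∫⁻ y, ∑' m : ℕ, ENNReal.ofReal (16 * (1 / 4) ^ m) *
          (Metric.ball x (2 ^ m * L)).indicator (fun y => ENNReal.ofReal (h y)) y := by
        refine lintegral_mono fun y => ?_
        obtain ⟨m, hm, hw⟩ := hpt y
        refine le_trans ?_ (ENNReal.le_tsum m)
        rw [indicator_of_mem hm, ← ENNReal.ofReal_mul (by positivity)]
        refine ENNReal.ofReal_le_ofReal ?_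
        rw [mul_comm]
        exact mul_le_mul_of_nonneg_right hw (h0 y)
    _ = ∑' m : ℕ, ENNReal.ofReal (16 * (1 / 4) ^ m) *
          ∫⁻ y in Metric.ball x (2 ^ m * L), ENNReal.ofReal (h y) := by
        have hm : ∀ m : ℕ, AEMeasurable ((Metric.ball x (2 ^ m * L)).indicator
            fun y => ENNReal.ofReal (h y)) volume := fun m =>
          hint.aestronglyMeasurable.aemeasurable.ennreal_ofReal.indicator measurableSet_ball
        rw [lintegral_tsum fun m => (hm m).const_mul _]
        congr 1; ext m
        rw [lintegral_const_mul'' _ (hm m), lintegral_indicator measurableSet_ball]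
    _ ≤ ∑' m : ℕ, ENNReal.ofReal (16 * L * (1 / 2) ^ m) := by
        refine ENNReal.tsum_le_tsum fun m => ?_
        rw [← ofReal_integral_eq_lintegral_ofReal hint.integrableOn (.of_forall h0),
          ← ENNReal.ofReal_mul (by positivity)]
        refine ENNReal.ofReal_le_ofReal ?_
        calc _ ≤ 16 * (1 / 4) ^ m * (2 ^ m * L) := by
              gcongr
              exact setIntegral_ball_le_of_notMem hx (by positivity)
          _ = 16 * L * ((1 / 4) ^ m * 2 ^ m) := by ring
          _ = _ := by rw [← mul_pow]; norm_num
    _ = ENNReal.ofReal (32 * L) := by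
        rw [← ENNReal.ofReal_tsum_of_nonneg (fun m => by positivity)
          (summable_geometric_two.mul_left _), tsum_mul_left, tsum_geometric_two]
        congr 1; ring

/-! ### Size estimates -/

section SizeBound

variable {ι : Type*} {k n l₀ l : ι → ℤ} {B : ℝ}

/-- The weight of a larger interval is dominated by the weight of a smaller one inside it. -/
lemma weight_le_of_timeIv_subset {k k' n n' : ℤ} (h : timeIv k n ⊆ timeIv k' n') (x : ℝ) :
    weight (timeMid k' n') (2 ^ k') x ≤ 2 * weight (timeMid k n) (2 ^ k) x := by
  have p := zpow_two_pos k
  have p' := zpow_two_pos k'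
  have h1 := (Ioo_subset_Ioo_iff (by linarith)).1 h
  set c := timeMid k n
  set c' := timeMid k' n'
  set L : ℝ := 2 ^ k
  set L' : ℝ := 2 ^ k'
  have hLL : L ≤ L' := by linarith [h1.1, h1.2]
  have hc : |c - c'| ≤ L' / 2 := by rw [abs_le]; constructor <;> linarith [h1.1, h1.2]
  have h2 : weight c' L' x ≤ 3 / 2 + 2 * ((x - c) / L') ^ 2 := by
    have e : (x - c') / L' = (x - c) / L' + (c - c') / L' := by ring
    have h3 : ((c - c') / L') ^ 2 ≤ 1 / 4 := by
      have := (abs_div (c - c') L').symm ▸ (div_le_iff₀ (abs_pos.2 p'.ne')).2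
        (by rw [abs_of_pos p']; linarith : |c - c'| ≤ 1 / 2 * |L'|)
      have h4 := abs_le.1 this
      nlinarith [h4.1, h4.2]
    unfold weight
    rw [e]
    nlinarith [sq_nonneg ((x - c) / L' - (c - c') / L')]
  have h3 := weight_mono (c := c) (x := x) p hLL
  have h4 : weight c L' x = 1 + ((x - c) / L') ^ 2 := rfl
  linarith

/-- The square sum over a lacunary tree is localised to the top of the tree: the packets remain
packets, with the same Fourier support, when multiplied by the polynomial weight of the top. -/
lemma sum_inLac_le (hT : IsTileFamily k n l) (h : ∀ s, |l s - l₀ s| ≤ 10 ^ 5) (hB : 0 ≤ B)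
    {ψ : ι → ℝ → ℂ} (hψ : IsPacketFamily k n l B ψ)
    (hdec : ∀ s x, ‖ψ s x‖ ≤ B * (√(2 ^ k s))⁻¹ * (weight (timeMid (k s) (n s)) (2 ^ k s) x)⁻¹ ^ 4)
    {f : ℝ → ℂ} (hf : MemLp f 2) {σ : ℝ} (hσ : |σ| = 1) (t : ι) (ξ : ℝ) (P : Finset ι)
    (hP : ∀ s ∈ P, InLac k n l₀ l σ t ξ s) :
    ∑ s ∈ P, ‖pairing f (ψ s)‖ ^ 2 ≤
      1600 * B ^ 2 * ∫ x, ‖f x‖ ^ 2 * (weight (timeMid (k t) (n t)) (2 ^ k t) x)⁻¹ ^ 2 := by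
  classical
  set w : ℝ → ℝ := weight (timeMid (k t) (n t)) (2 ^ k t)
  have hw0 : ∀ x, 0 < w x := weight_pos _ _
  set φ : ι → ℝ → ℂ := fun s =>
    if timeIv (k s) (n s) ⊆ timeIv (k t) (n t) then fun x => (w x : ℂ) * ψ s x else ψ s with hφdef
  have hφ : IsPacketFamily k n l (2 * B) φ := by
    intro s
    by_cases hs : timeIv (k s) (n s) ⊆ timeIv (k t) (n t)
    · simp only [hφdef, if_pos hs]
      exact (isPacket_weight_mul isClosed_Icc (zpow_two_pos _) hB zero_le_two le_rfl
        (hψ s).continuous (hdec s) (hψ s).support (weight_le_of_timeIv_subset hs)).1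
    · simp only [hφdef, if_neg hs]
      exact (hψ s).mono_const (by linarith)
  have hg : MemLp (fun x => f x * ((w x)⁻¹ : ℝ)) 2 := by
    refine hf.of_le (hf.aestronglyMeasurable.mul ?_) (.of_forall fun x => ?_)
    · exact (Complex.continuous_ofReal.comp (continuous_weight_inv _ _)).aestronglyMeasurable
    · rw [norm_mul, Complex.norm_real, Real.norm_of_nonneg (weight_inv_nonneg _ _ _)]
      exact mul_le_of_le_one_right (norm_nonneg _) (weight_inv_le_one _ _ _)
  have hpair : ∀ s ∈ P, pairing f (ψ s) = pairing (fun x => f x * ((w x)⁻¹ : ℝ)) (φ s) := by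
    intro s hs
    simp only [hφdef, if_pos (hP s hs).1.1, pairing]
    congr 1; ext x
    have : (w x : ℂ) ≠ 0 := by exact_mod_cast (hw0 x).ne'
    simp only [map_mul, Complex.conj_ofReal]
    push_cast
    field_simp
  have hdisj : ∀ s ∈ P, ∀ s' ∈ P, k s ≠ k s' →
      Disjoint (freqIv (k s) (l s)) (freqIv (k s') (l s')) := by
    intro s hs s' hs' hk
    by_contra hov
    rcases lt_or_gt_of_ne hk with hk | hk
    · exact lt_irrefl _ (InLac.lt_of_overlap hT h hσ (hP s' hs') (hP s hs) hk
        fun hd => hov hd.symm)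
    · exact lt_irrefl _ (InLac.lt_of_overlap hT h hσ (hP s hs) (hP s' hs') hk hov)
  have key := hφ.sum_pairing_sq_le hT hg P hdisj
  rw [Finset.sum_congr rfl fun s hs => by rw [hpair s hs]]
  refine key.trans (le_of_eq ?_)
  have e : ∀ x, ‖f x * ((w x)⁻¹ : ℝ)‖ ^ 2 = ‖f x‖ ^ 2 * (w x)⁻¹ ^ 2 := fun x => by
    rw [norm_mul, Complex.norm_real, Real.norm_eq_abs, mul_pow, sq_abs]
  simp only [e]
  ring

/-- If every packet is damped by the weight of its interval at the nearest point of a set `E`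
outside the exceptional set, then all sizes are bounded. -/
lemma sizeLE_of_damped (hT : IsTileFamily k n l) (h : ∀ s, |l s - l₀ s| ≤ 10 ^ 5) (hB : 0 ≤ B)
    {ψ : ι → ℝ → ℂ} (hψ : IsPacketFamily k n l B ψ)
    (hdec : ∀ s x, ‖ψ s x‖ ≤ B * (√(2 ^ k s))⁻¹ * (weight (timeMid (k s) (n s)) (2 ^ k s) x)⁻¹ ^ 4)
    {f : ℝ → ℂ} (hf : MemLp f 2) {E : Set ℝ} (hE : ∀ x ∈ E, x ∉ exceptional fun x => ‖f x‖ ^ 2)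
    {near : ℝ → ℝ} (hnear : ∀ c, near c ∈ E ∧ ∀ x ∈ E, |near c - c| ≤ |x - c|)
    {q : ι → ℝ}
    (hq : ∀ s, q s = weight (timeMid (k s) (n s)) (2 ^ k s) (near (timeMid (k s) (n s))))
    (Θ : Finset (ι × ℝ)) (P : Finset ι) :
    SizeLE k n l₀ l (fun s => ‖pairing f (fun x => ((q s)⁻¹ : ℝ) * ψ s x)‖) (1000 * B) Θ P := by
  classical
  rintro σ hσ ⟨t, ξ⟩ -
  have hqpos : ∀ s, 0 < q s := fun s => by rw [hq]; exact weight_pos _ _ _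
  have hfint : Integrable fun x => ‖f x‖ ^ 2 :=
    (memLp_two_iff_integrable_sq_norm hf.aestronglyMeasurable).1 hf
  set P' := P.filter fun s => InLac k n l₀ l σ t ξ s
  have h1 : ∀ s ∈ P', ‖pairing f (fun x => ((q s)⁻¹ : ℝ) * ψ s x)‖ ^ 2 ≤
      4 * (q t)⁻¹ ^ 2 * ‖pairing f (ψ s)‖ ^ 2 := by
    intro s hs
    have e : pairing f (fun x => ((q s)⁻¹ : ℝ) * ψ s x) = ((q s)⁻¹ : ℝ) * pairing f (ψ s) := by
      simp only [pairing, ← integral_const_mul]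
      congr 1; ext x
      simp only [map_mul, Complex.conj_ofReal]; ring
    have hq2 : q t ≤ 2 * q s := by
      have i1 : q t ≤ weight (timeMid (k t) (n t)) (2 ^ k t) (near (timeMid (k s) (n s))) := by
        rw [hq]
        exact weight_mono_of_abs_le ((hnear _).2 _ (hnear _).1)
      have i2 := weight_le_of_timeIv_subset (Finset.mem_filter.1 hs).2.1.1
        (near (timeMid (k s) (n s)))
      rw [← hq s] at i2
      exact i1.trans i2
    have h2 : (q s)⁻¹ ≤ 2 * (q t)⁻¹ := by
      rw [inv_eq_one_div, inv_eq_one_div, mul_one_div, div_le_div_iff₀ (hqpos s) (hqpos t)]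
      linarith
    rw [e, norm_mul, Complex.norm_real, Real.norm_of_nonneg (inv_pos.2 (hqpos s)).le, mul_pow]
    have h3 : (q s)⁻¹ ^ 2 ≤ (2 * (q t)⁻¹) ^ 2 := by
      have := inv_pos.2 (hqpos s)
      gcongr
    calc (q s)⁻¹ ^ 2 * ‖pairing f (ψ s)‖ ^ 2 ≤ (2 * (q t)⁻¹) ^ 2 * ‖pairing f (ψ s)‖ ^ 2 := by
          gcongr
      _ = _ := by ring
  have h2 := sum_inLac_le hT h hB hψ hdec hf hσ t ξ P' fun s hs => (Finset.mem_filter.1 hs).2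
  have h3 : ∫ x, ‖f x‖ ^ 2 * (weight (timeMid (k t) (n t)) (2 ^ k t) x)⁻¹ ^ 2 ≤
      4 * q t ^ 2 * (32 * 2 ^ k t) := by
    set c := timeMid (k t) (n t)
    set L : ℝ := 2 ^ k t
    have hL : 0 < L := zpow_two_pos _
    refine le_trans ?_ (mul_le_mul_of_nonneg_left (integral_mul_weight_le hfint
      (fun x => by positivity) (hE _ (hnear c).1) hL) (by positivity))
    rw [← integral_const_mul]
    have hpt : ∀ x, ‖f x‖ ^ 2 * (weight c L x)⁻¹ ^ 2 ≤
        4 * q t ^ 2 * (‖f x‖ ^ 2 * (weight (near c) L x)⁻¹ ^ 2) := by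
      intro x
      have i1 := weight_le_mul (near c) L x c
      rw [weight_comm (near c) L c, ← hq t] at i1
      have i2 : (weight c L x)⁻¹ ≤ 2 * q t * (weight (near c) L x)⁻¹ := by
        rw [inv_eq_one_div, inv_eq_one_div, mul_one_div,
          div_le_div_iff₀ (weight_pos _ _ _) (weight_pos _ _ _)]
        linarith
      have i3 := weight_inv_nonneg c L x
      calc ‖f x‖ ^ 2 * (weight c L x)⁻¹ ^ 2
          ≤ ‖f x‖ ^ 2 * (2 * q t * (weight (near c) L x)⁻¹) ^ 2 := by gcongr
        _ = _ := by ring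
    have hi : ∀ c', Integrable fun x => ‖f x‖ ^ 2 * (weight c' L x)⁻¹ ^ 2 := fun c' => by
      refine hfint.mono' (hfint.aestronglyMeasurable.mul
        ((continuous_weight_inv c' L).pow 2).aestronglyMeasurable) (.of_forall fun x => ?_)
      rw [Real.norm_of_nonneg (by positivity)]
      exact mul_le_of_le_one_right (by positivity)
        (pow_le_one₀ (weight_inv_nonneg _ _ _) (weight_inv_le_one _ _ _))
    exact integral_mono (hi c) ((hi (near c)).const_mul _) hpt
  have hqt := hqpos t
  calc _ ≤ ∑ s ∈ P', 4 * (q t)⁻¹ ^ 2 * ‖pairing f (ψ s)‖ ^ 2 := Finset.sum_le_sum h1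
    _ = 4 * (q t)⁻¹ ^ 2 * ∑ s ∈ P', ‖pairing f (ψ s)‖ ^ 2 := by rw [Finset.mul_sum]
    _ ≤ 4 * (q t)⁻¹ ^ 2 * (1600 * B ^ 2 * (4 * q t ^ 2 * (32 * 2 ^ k t))) := by
        gcongr
        exact h2.trans (by gcongr)
    _ = 819200 * B ^ 2 * 2 ^ k t * ((q t)⁻¹ * q t) ^ 2 := by ring
    _ ≤ _ := by
        rw [inv_mul_cancel₀ hqt.ne']
        have : 0 ≤ B ^ 2 * 2 ^ k t := by have := zpow_two_pos (k t); positivity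
        linarith

end SizeBound

/-! ### A single scale off the exceptional set -/

section SingleScale

variable {ι : Type*} {k n l : ι → ℤ} {B : ℝ}

lemma timeIv_disjoint {κ ν ν' : ℤ} (h : ν ≠ ν') : Disjoint (timeIv κ ν) (timeIv κ ν') := by
  wlog hlt : ν < ν' generalizing ν ν'
  · exact (this h.symm (lt_of_le_of_ne (not_lt.1 hlt) h.symm)).symm
  have p := zpow_two_pos κ
  have h1 : (ν : ℝ) + 1 ≤ ν' := by exact_mod_cast hlt
  refine Set.disjoint_left.2 fun x hx hx' => ?_
  have h2 := hx.2
  have h3 := hx'.1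
  unfold timeMid at h2 h3
  nlinarith

lemma sum_weight_inv_le (κ : ℤ) (V : Finset ℤ) (x : ℝ) :
    ∑ ν ∈ V, (weight (timeMid κ ν) (2 ^ κ) x)⁻¹ ≤ 10 := by
  set L : ℝ := 2 ^ κ
  have hL : 0 < L := zpow_two_pos κ
  have h1 : ∀ ν ∈ V, L * (weight (timeMid κ ν) L x)⁻¹ ≤
      5 / 2 * ∫ y in timeIv κ ν, (weight x L y)⁻¹ := by
    intro ν _
    have hvol : volume.real (timeIv κ ν) = L := by
      rw [timeIv, Real.volume_real_Ioo_of_le (by linarith)]; ring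
    have hI := setIntegral_mono_on (μ := volume) (s := timeIv κ ν)
      (f := fun _ => (weight (timeMid κ ν) L x)⁻¹) (g := fun y => 5 / 2 * (weight x L y)⁻¹)
      (continuous_const.integrableOn_Icc.mono_set Ioo_subset_Icc_self)
      ((integrable_weight_inv x hL).const_mul _).integrableOn measurableSet_Ioo fun y hy =>
        weight_inv_le_of_mem hL
          (by rw [abs_le]; constructor <;> linarith [hy.1, hy.2]) x
    rwa [setIntegral_const, hvol, smul_eq_mul, integral_const_mul] at hI
  have h2 := sum_setIntegral_le V (fun ν => timeIv κ ν) univ (h := fun y => (weight x L y)⁻¹)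
    (fun ν _ => measurableSet_Ioo) (fun ν _ => subset_univ _)
    (fun ν _ ν' _ hne => timeIv_disjoint hne) (integrable_weight_inv x hL)
    fun y => weight_inv_nonneg _ _ _
  rw [Measure.restrict_univ, integral_weight_inv x hL] at h2
  have h3 := Finset.sum_le_sum h1
  rw [← Finset.mul_sum, ← Finset.mul_sum] at h3
  refine le_of_mul_le_mul_left ?_ hL
  have := Real.pi_le_four
  nlinarith

/-- Off the exceptional set, a sum of packets of a single scale is controlled by the square sum
of the coefficients damped by the distance to `E`. Packets over the same interval are multiplied
by a power of its weight, which keeps them orthogonal and gains decay on `E`. -/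
lemma setIntegral_norm_sum_sq_le (hT : IsTileFamily k n l) (hB : 0 ≤ B)
    {ψ : ι → ℝ → ℂ} (hψ : IsPacketFamily k n l B ψ)
    (hdec : ∀ s x, ‖ψ s x‖ ≤ B * (√(2 ^ k s))⁻¹ * (weight (timeMid (k s) (n s)) (2 ^ k s) x)⁻¹ ^ 6)
    {E : Set ℝ} (hEm : MeasurableSet E)
    {near : ℝ → ℝ} (hnear : ∀ c, near c ∈ E ∧ ∀ x ∈ E, |near c - c| ≤ |x - c|)
    {q : ι → ℝ}
    (hq : ∀ s, q s = weight (timeMid (k s) (n s)) (2 ^ k s) (near (timeMid (k s) (n s))))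
    (κ : ℤ) (P : Finset ι) (hP : ∀ s ∈ P, k s = κ) (β : ι → ℂ) :
    ∫ x in E, ‖∑ s ∈ P, β s * ψ s x‖ ^ 2 ≤ 4000 * B ^ 2 * ∑ s ∈ P, (q s)⁻¹ ^ 4 * ‖β s‖ ^ 2 := by
  classical
  set w : ι → ℝ → ℝ := fun s => weight (timeMid (k s) (n s)) (2 ^ k s)
  set φ : ι → ℝ → ℂ := fun s x => w s x * (w s x * (w s x * ψ s x)) with hφdef
  have hφ : IsPacketFamily k n l B φ := by
    intro s
    have hL := zpow_two_pos (k s)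
    have h1 := isPacket_weight_mul isClosed_Icc hL hB zero_le_one (m := 5) (by lia)
      (hψ s).continuous (hdec s) (hψ s).support (fun x => (one_mul (w s x)).ge)
    rw [one_mul] at h1
    have h2 := isPacket_weight_mul isClosed_Icc hL hB zero_le_one (m := 4) (by lia)
      h1.1.continuous h1.2 h1.1.support (fun x => (one_mul (w s x)).ge)
    rw [one_mul] at h2
    have h3 := isPacket_weight_mul isClosed_Icc hL hB zero_le_one (m := 3) (by lia)
      h2.1.continuous h2.2 h2.1.support (fun x => (one_mul (w s x)).ge)
    rw [one_mul] at h3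
    exact h3.1
  set V := P.image n
  set W : ℤ → ℝ → ℝ := fun ν => weight (timeMid κ ν) (2 ^ κ)
  have hW0 : ∀ ν x, 0 < W ν x := fun ν x => weight_pos _ _ _
  set Q : ℤ → ℝ := fun ν => W ν (near (timeMid κ ν))
  have hQ0 : ∀ ν, 0 < Q ν := fun ν => hW0 _ _
  set H : ℤ → ℝ → ℂ := fun ν x => ∑ s ∈ P with n s = ν, β s * φ s x
  have hH : ∀ x, ∑ s ∈ P, β s * ψ s x = ∑ ν ∈ V, ((W ν x)⁻¹ ^ 3 : ℝ) * H ν x := by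
    intro x
    rw [← Finset.sum_fiberwise_of_maps_to (g := n) (t := V)
      fun s hs => Finset.mem_image_of_mem _ hs]
    refine Finset.sum_congr rfl fun ν _ => ?_
    rw [Finset.mul_sum]
    refine Finset.sum_congr rfl fun s hs => ?_
    obtain ⟨hsP, rfl⟩ := Finset.mem_filter.1 hs
    have e : W (n s) x = w s x := by simp only [W, w, hP s hsP]
    have hne : (w s x : ℂ) ≠ 0 := by exact_mod_cast (weight_pos _ _ _).ne'
    rw [e]
    simp only [hφdef]
    push_cast
    field_simp
  have hpt : ∀ x ∈ E, ‖∑ s ∈ P, β s * ψ s x‖ ^ 2 ≤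
      10 * ∑ ν ∈ V, (Q ν)⁻¹ ^ 4 * ‖H ν x‖ ^ 2 := by
    intro x hx
    have h1 : ‖∑ s ∈ P, β s * ψ s x‖ ≤ ∑ ν ∈ V, (W ν x)⁻¹ ^ 3 * ‖H ν x‖ := by
      rw [hH]
      refine (norm_sum_le _ _).trans (Finset.sum_le_sum fun ν _ => ?_)
      rw [norm_mul, Complex.norm_real, Real.norm_of_nonneg]
      have := hW0 ν x
      positivity
    have h2 : (∑ ν ∈ V, (W ν x)⁻¹ ^ 3 * ‖H ν x‖) ^ 2 ≤
        (∑ ν ∈ V, (W ν x)⁻¹) * ∑ ν ∈ V, (W ν x)⁻¹ ^ 5 * ‖H ν x‖ ^ 2 := by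
      refine Finset.sum_sq_le_sum_mul_sum_of_sq_le_mul V (fun ν _ => ?_) (fun ν _ => ?_)
        fun ν _ => le_of_eq (by ring)
      · exact (inv_pos.2 (hW0 ν x)).le
      · have := hW0 ν x
        positivity
    have h3 : ∑ ν ∈ V, (W ν x)⁻¹ ^ 5 * ‖H ν x‖ ^ 2 ≤ ∑ ν ∈ V, (Q ν)⁻¹ ^ 4 * ‖H ν x‖ ^ 2 := by
      refine Finset.sum_le_sum fun ν _ => ?_
      gcongr
      have i1 : (W ν x)⁻¹ ^ 5 ≤ (W ν x)⁻¹ ^ 4 :=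
        pow_le_pow_of_le_one (weight_inv_nonneg _ _ _) (weight_inv_le_one _ _ _) (by lia)
      have i2 : (W ν x)⁻¹ ≤ (Q ν)⁻¹ := by
        have := hQ0 ν
        gcongr
        exact weight_mono_of_abs_le ((hnear _).2 x hx)
      refine i1.trans ?_
      have := inv_pos.2 (hW0 ν x)
      gcongr
    have h4 : 0 ≤ ∑ ν ∈ V, (Q ν)⁻¹ ^ 4 * ‖H ν x‖ ^ 2 := Finset.sum_nonneg fun ν _ => by
      have := hQ0 ν
      positivity
    calc _ ≤ (∑ ν ∈ V, (W ν x)⁻¹ ^ 3 * ‖H ν x‖) ^ 2 := by gcongr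
      _ ≤ _ := h2
      _ ≤ (∑ ν ∈ V, (W ν x)⁻¹) * ∑ ν ∈ V, (Q ν)⁻¹ ^ 4 * ‖H ν x‖ ^ 2 := by
          gcongr
          exact Finset.sum_nonneg fun ν _ => (inv_pos.2 (hW0 ν x)).le
      _ ≤ _ := by
          gcongr
          exact sum_weight_inv_le κ V x
  have hsq : ∀ (P' : Finset ι) (φ' : ι → ℝ → ℂ), (∀ s, MemLp (φ' s) 2) →
      Integrable fun x => ‖∑ s ∈ P', β s * φ' s x‖ ^ 2 := fun P' φ' h =>
    (memLp_two_iff_integrable_sq_norm (Finset.aestronglyMeasurable_fun_sum _ fun s _ =>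
      ((h s).const_mul (β s)).aestronglyMeasurable)).1
      (memLp_finsetSum P' fun s _ => (h s).const_mul (β s))
  have hHint : ∀ ν, Integrable fun x => ‖H ν x‖ ^ 2 := fun ν =>
    hsq _ φ fun s => (hφ s).memLp (zpow_two_pos _)
  have hRint : Integrable fun x => 10 * ∑ ν ∈ V, (Q ν)⁻¹ ^ 4 * ‖H ν x‖ ^ 2 :=
    (integrable_finsetSum V fun ν _ => (hHint ν).const_mul _).const_mul _
  have hHle : ∀ ν ∈ V, (Q ν)⁻¹ ^ 4 * ∫ x, ‖H ν x‖ ^ 2 ≤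
      400 * B ^ 2 * ∑ s ∈ P with n s = ν, (q s)⁻¹ ^ 4 * ‖β s‖ ^ 2 := by
    intro ν _
    have h1 := hφ.integral_norm_sum_sq_le hT (P.filter (n · = ν)) β fun s hs t ht hk =>
      absurd ((hP s (Finset.mem_filter.1 hs).1).trans (hP t (Finset.mem_filter.1 ht).1).symm) hk
    have h2 : ∑ s ∈ P with n s = ν, (q s)⁻¹ ^ 4 * ‖β s‖ ^ 2 =
        (Q ν)⁻¹ ^ 4 * ∑ s ∈ P with n s = ν, ‖β s‖ ^ 2 := by
      rw [Finset.mul_sum]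
      refine Finset.sum_congr rfl fun s hs => ?_
      obtain ⟨hsP, rfl⟩ := Finset.mem_filter.1 hs
      rw [hq, hP s hsP]
    rw [h2]
    have := hQ0 ν
    calc _ ≤ (Q ν)⁻¹ ^ 4 * (400 * B ^ 2 * ∑ s ∈ P with n s = ν, ‖β s‖ ^ 2) := by gcongr
      _ = _ := by ring
  calc ∫ x in E, ‖∑ s ∈ P, β s * ψ s x‖ ^ 2
      ≤ ∫ x in E, 10 * ∑ ν ∈ V, (Q ν)⁻¹ ^ 4 * ‖H ν x‖ ^ 2 :=
        setIntegral_mono_on (hsq P ψ fun s => (hψ s).memLp (zpow_two_pos _)).integrableOn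
          hRint.integrableOn hEm hpt
    _ ≤ ∫ x, 10 * ∑ ν ∈ V, (Q ν)⁻¹ ^ 4 * ‖H ν x‖ ^ 2 := by
        refine setIntegral_le_integral hRint (.of_forall fun x => ?_)
        refine mul_nonneg (by norm_num) (Finset.sum_nonneg fun ν _ => ?_)
        have := hQ0 ν
        positivity
    _ = 10 * ∑ ν ∈ V, (Q ν)⁻¹ ^ 4 * ∫ x, ‖H ν x‖ ^ 2 := by
        rw [integral_const_mul, integral_finsetSum V fun ν _ => (hHint ν).const_mul _]
        simp only [integral_const_mul]
    _ ≤ 10 * ∑ ν ∈ V, 400 * B ^ 2 * ∑ s ∈ P with n s = ν, (q s)⁻¹ ^ 4 * ‖β s‖ ^ 2 := by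
        exact mul_le_mul_of_nonneg_left (Finset.sum_le_sum hHle) (by norm_num)
    _ = 4000 * B ^ 2 * ∑ s ∈ P, (q s)⁻¹ ^ 4 * ‖β s‖ ^ 2 := by
        rw [← Finset.mul_sum, Finset.sum_fiberwise_of_maps_to fun s hs =>
          Finset.mem_image_of_mem _ hs]
        ring

end SingleScale

/-! ### The square function -/

section SquareFunction

variable {α : ℤ → Type*} {n l₀ l₁ l₂ : (Σ κ, α κ) → ℤ} {B : ℝ}

/-- Packets that decay like the sixth power of the inverse weight. -/
def HasDecay {ι : Type*} (k n : ι → ℤ) (B : ℝ) (ψ : ι → ℝ → ℂ) : Prop :=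
  ∀ s x, ‖ψ s x‖ ≤ B * (√(2 ^ k s))⁻¹ * (weight (timeMid (k s) (n s)) (2 ^ k s) x)⁻¹ ^ 6

lemma HasDecay.four {ι : Type*} {k n : ι → ℤ} {ψ : ι → ℝ → ℂ} (hB : 0 ≤ B)
    (h : HasDecay k n B ψ) (s : ι) (x : ℝ) :
    ‖ψ s x‖ ≤ B * (√(2 ^ k s))⁻¹ * (weight (timeMid (k s) (n s)) (2 ^ k s) x)⁻¹ ^ 4 := by
  refine (h s x).trans ?_
  have := pow_le_pow_of_le_one (weight_inv_nonneg (timeMid (k s) (n s)) (2 ^ k s) x)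
    (weight_inv_le_one _ _ _) (show 4 ≤ 6 by lia)
  gcongr

/-- The coefficient `|I_s|^{-1/2} ⟨f, ψ₀⟩ ⟨g, ψ₁⟩` of the model sum. -/
noncomputable def coeff {ι : Type*} (k : ι → ℤ) (ψ₀ ψ₁ : ι → ℝ → ℂ) (f g : ℝ → ℂ) (s : ι) : ℂ :=
  ((√(2 ^ k s))⁻¹ : ℝ) * pairing f (ψ₀ s) * pairing g (ψ₁ s)

lemma norm_coeff_sq {ι : Type*} (k : ι → ℤ) (ψ₀ ψ₁ : ι → ℝ → ℂ) (f g : ℝ → ℂ) (s : ι) :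
    ‖coeff k ψ₀ ψ₁ f g s‖ ^ 2 =
      2 ^ (-k s) * ‖pairing f (ψ₀ s)‖ ^ 2 * ‖pairing g (ψ₁ s)‖ ^ 2 := by
  rw [coeff, norm_mul, norm_mul, Complex.norm_real, Real.norm_eq_abs, mul_pow, mul_pow, sq_abs,
    inv_pow, Real.sq_sqrt (zpow_two_pos _).le, zpow_neg]

/-- At each scale the coefficients are summable, by Bessel's inequality. -/
lemma summable_norm_coeff (hT₀ : IsTileFamily Sigma.fst n l₀) (hT₁ : IsTileFamily Sigma.fst n l₁)
    {ψ₀ ψ₁ : (Σ κ, α κ) → ℝ → ℂ} (hψ₀ : IsPacketFamily Sigma.fst n l₀ B ψ₀)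
    (hψ₁ : IsPacketFamily Sigma.fst n l₁ B ψ₁) {f g : ℝ → ℂ} (hf : MemLp f 2) (hg : MemLp g 2)
    (κ : ℤ) : Summable fun s : α κ => ‖coeff Sigma.fst ψ₀ ψ₁ f g ⟨κ, s⟩‖ := by
  refine summable_of_sum_le (c := (√(2 ^ κ))⁻¹ * (400 * B ^ 2 * (∫ x, ‖f x‖ ^ 2) +
    400 * B ^ 2 * ∫ x, ‖g x‖ ^ 2)) (fun _ => norm_nonneg _) fun P => ?_
  set P' := P.map (Function.Embedding.sigmaMk κ)
  have hk : ∀ s ∈ P', s.1 = κ := fun s hs => by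
    obtain ⟨a, -, rfl⟩ := Finset.mem_map.1 hs; rfl
  have hsame : ∀ {l : (Σ κ, α κ) → ℤ}, ∀ s ∈ P', ∀ t ∈ P', s.1 ≠ t.1 →
      Disjoint (freqIv s.1 (l s)) (freqIv t.1 (l t)) := fun s hs t ht hst =>
    absurd ((hk s hs).trans (hk t ht).symm) hst
  have h0 := hψ₀.sum_pairing_sq_le hT₀ hf P' hsame
  have h1 := hψ₁.sum_pairing_sq_le hT₁ hg P' hsame
  rw [Finset.sum_map] at h0 h1
  calc _ ≤ ∑ s ∈ P, (√(2 ^ κ))⁻¹ * (‖pairing f (ψ₀ ⟨κ, s⟩)‖ ^ 2 + ‖pairing g (ψ₁ ⟨κ, s⟩)‖ ^ 2) := by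
        refine Finset.sum_le_sum fun s _ => ?_
        rw [coeff, norm_mul, norm_mul, Complex.norm_real, Real.norm_of_nonneg (by positivity),
          mul_assoc]
        gcongr
        nlinarith [sq_nonneg (‖pairing f (ψ₀ ⟨κ, s⟩)‖ - ‖pairing g (ψ₁ ⟨κ, s⟩)‖),
          norm_nonneg (pairing f (ψ₀ ⟨κ, s⟩)), norm_nonneg (pairing g (ψ₁ ⟨κ, s⟩)),
          mul_nonneg (norm_nonneg (pairing f (ψ₀ ⟨κ, s⟩))) (norm_nonneg (pairing g (ψ₁ ⟨κ, s⟩)))]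
    _ ≤ _ := by
        rw [← Finset.mul_sum, Finset.sum_add_distrib]
        gcongr
        · exact h0
        · exact h1

lemma HasDecay.norm_le {ι : Type*} {k n : ι → ℤ} {ψ : ι → ℝ → ℂ} (hB : 0 ≤ B)
    (h : HasDecay k n B ψ) (s : ι) (x : ℝ) : ‖ψ s x‖ ≤ B * (√(2 ^ k s))⁻¹ :=
  (h s x).trans (mul_le_of_le_one_right (by positivity)
    (pow_le_one₀ (weight_inv_nonneg _ _ _) (weight_inv_le_one _ _ _)))

lemma norm_coeff_mul_le {ψ₀ ψ₁ ψ₂ : (Σ κ, α κ) → ℝ → ℂ} (hB : 0 ≤ B)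
    (hd₂ : HasDecay Sigma.fst n B ψ₂) (f g : ℝ → ℂ) (κ : ℤ) (s : α κ) (x : ℝ) :
    ‖coeff Sigma.fst ψ₀ ψ₁ f g ⟨κ, s⟩ * ψ₂ ⟨κ, s⟩ x‖ ≤
      ‖coeff Sigma.fst ψ₀ ψ₁ f g ⟨κ, s⟩‖ * (B * (√(2 ^ κ))⁻¹) := by
  rw [norm_mul]
  gcongr
  exact hd₂.norm_le hB ⟨κ, s⟩ x

/-- The square function of the model sum, normalised to level `1`: outside the exceptional sets
of `|f|²` and `|g|²`, its square has integral at most `C N`. -/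
lemma volume_lt_squareFunction_le {e : ℤ} (he : 10 ^ 2 < |e|) (he' : |e| ≤ 10 ^ 5)
    (hl : ∀ s, l₁ s = l₀ s + e) (hT₀ : IsTileFamily Sigma.fst n l₀)
    (hT₁ : IsTileFamily Sigma.fst n l₁) (hT₂ : IsTileFamily Sigma.fst n l₂) (hB : 0 ≤ B)
    {ψ₀ ψ₁ ψ₂ : (Σ κ, α κ) → ℝ → ℂ} (hψ₀ : IsPacketFamily Sigma.fst n l₀ B ψ₀)
    (hψ₁ : IsPacketFamily Sigma.fst n l₁ B ψ₁) (hψ₂ : IsPacketFamily Sigma.fst n l₂ B ψ₂)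
    (hd₀ : HasDecay Sigma.fst n B ψ₀) (hd₁ : HasDecay Sigma.fst n B ψ₁)
    (hd₂ : HasDecay Sigma.fst n B ψ₂)
    {f g : ℝ → ℂ} (hf : MemLp f 2) (hg : MemLp g 2) {N : ℝ}
    (hfN : ∫ x, ‖f x‖ ^ 2 ≤ N) (hgN : ∫ x, ‖g x‖ ^ 2 ≤ N) :
    volume {x | 1 < ∑' κ : ℤ, ‖∑' s : α κ, coeff Sigma.fst ψ₀ ψ₁ f g ⟨κ, s⟩ * ψ₂ ⟨κ, s⟩ x‖ₑ ^ 2} ≤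
      ENNReal.ofReal ((20 + 4 * 10 ^ 24 * B ^ 6) * N) := by
  classical
  have hN : 0 ≤ N := le_trans (integral_nonneg fun x => by positivity) hfN
  set β : (Σ κ, α κ) → ℂ := coeff Sigma.fst ψ₀ ψ₁ f g
  set G : ℤ → ℝ → ℂ := fun κ x => ∑' s : α κ, β ⟨κ, s⟩ * ψ₂ ⟨κ, s⟩ x
  set Ω : Set ℝ := exceptional (fun x => ‖f x‖ ^ 2) ∪ exceptional fun x => ‖g x‖ ^ 2
  have hΩo : IsOpen Ω := (isOpen_exceptional _).union (isOpen_exceptional _)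
  have hfint := (memLp_two_iff_integrable_sq_norm hf.aestronglyMeasurable).1 hf
  have hgint := (memLp_two_iff_integrable_sq_norm hg.aestronglyMeasurable).1 hg
  have hΩ : volume Ω ≤ ENNReal.ofReal (20 * N) := by
    calc volume Ω ≤ ENNReal.ofReal (10 * N) + ENNReal.ofReal (10 * N) := by
          refine (measure_union_le _ _).trans (add_le_add ?_ ?_)
          · exact (volume_exceptional_le hfint fun x => by positivity).trans
              (ENNReal.ofReal_le_ofReal (by gcongr))
          · exact (volume_exceptional_le hgint fun x => by positivity).trans
              (ENNReal.ofReal_le_ofReal (by gcongr))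
      _ = _ := by rw [← ENNReal.ofReal_add (by positivity) (by positivity)]; congr 1; ring
  -- Nearest points exist only if the complement of `Ω` is nonempty. If it is empty, the bound on
  -- the volume of `Ω` suffices.
  rcases (Ωᶜ).eq_empty_or_nonempty with hemp | hne
  · rw [compl_empty_iff] at hemp
    refine (measure_mono (subset_univ _)).trans ?_
    rw [← hemp]
    refine hΩ.trans (ENNReal.ofReal_le_ofReal ?_)
    have : 0 ≤ B ^ 6 * N := by positivity
    linarith
  have hEm : MeasurableSet Ωᶜ := hΩo.measurableSet.compl
  have hnear : ∀ c : ℝ, ∃ y, y ∈ Ωᶜ ∧ ∀ x ∈ Ωᶜ, |y - c| ≤ |x - c| := by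
    intro c
    obtain ⟨y, hy, hyd⟩ := hΩo.isClosed_compl.exists_infDist_eq_dist hne c
    refine ⟨y, hy, fun x hx => ?_⟩
    have := Metric.infDist_le_dist_of_mem (x := c) hx
    rw [hyd, dist_comm c y, dist_comm c x, Real.dist_eq, Real.dist_eq] at this
    exact this
  choose near hnear using hnear
  set q : (Σ κ, α κ) → ℝ := fun s =>
    weight (timeMid s.1 (n s)) (2 ^ s.1) (near (timeMid s.1 (n s))) with hqdef
  have hq1 : ∀ s, (q s)⁻¹ ≤ 1 := fun s => weight_inv_le_one _ _ _
  have hq0 : ∀ s, 0 < q s := fun s => weight_pos _ _ _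
  -- Distribute the damping factor `q⁻⁴` over the two coefficients.
  have hsum : ∀ P : Finset (Σ κ, α κ), ∑ s ∈ P, (q s)⁻¹ ^ 4 * ‖β s‖ ^ 2 ≤
      10 ^ 21 * B ^ 4 * N := by
    intro P
    set φ₀ : (Σ κ, α κ) → ℝ → ℂ := fun s x => ((q s)⁻¹ : ℝ) * ψ₀ s x
    set φ₁ : (Σ κ, α κ) → ℝ → ℂ := fun s x => ((q s)⁻¹ : ℝ) * ψ₁ s x
    have hqn : ∀ s, ‖(((q s)⁻¹ : ℝ) : ℂ)‖ ≤ 1 := fun s => by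
      rw [Complex.norm_real, Real.norm_of_nonneg (inv_pos.2 (hq0 s)).le]
      exact hq1 s
    have hpair : ∀ (h : ℝ → ℂ) (ψ : (Σ κ, α κ) → ℝ → ℂ) s,
        ‖pairing h (fun x => ((q s)⁻¹ : ℝ) * ψ s x)‖ ^ 2 = (q s)⁻¹ ^ 2 * ‖pairing h (ψ s)‖ ^ 2 := by
      intro h ψ s
      have e : pairing h (fun x => ((q s)⁻¹ : ℝ) * ψ s x) = ((q s)⁻¹ : ℝ) * pairing h (ψ s) := by
        simp only [pairing, ← integral_const_mul]
        congr 1; ext x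
        simp only [map_mul, Complex.conj_ofReal]; ring
      rw [e, norm_mul, Complex.norm_real, Real.norm_eq_abs, mul_pow, sq_abs]
    have hl0 : ∀ s, |l₀ s - l₀ s| ≤ 10 ^ 5 := fun s => by simp
    have hl1 : ∀ s, |l₁ s - l₀ s| ≤ 10 ^ 5 := fun s => by rw [hl]; simpa using he'
    have key := sum_coeff_sq_mul_le he he' hl hT₀ hT₁ (φ₀ := φ₀) (φ₁ := φ₁)
      (fun s => (hψ₀ s).const_mul (hqn s)) (fun s => (hψ₁ s).const_mul (hqn s)) hf hg
      (Λ := 1000 * B) (by positivity) hfN hgN P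
      (fun Θ => sizeLE_of_damped hT₀ hl0 hB hψ₀ (hd₀.four hB) hf (E := Ωᶜ)
        (fun x hx hx' => hx (.inl hx')) hnear (fun s => rfl) _ P)
      (fun Θ => sizeLE_of_damped hT₁ hl1 hB hψ₁ (hd₁.four hB) hg (E := Ωᶜ)
        (fun x hx hx' => hx (.inr hx')) hnear (fun s => rfl) _ P)
    calc ∑ s ∈ P, (q s)⁻¹ ^ 4 * ‖β s‖ ^ 2
        = ∑ s ∈ P, 2 ^ (-s.1) * ‖pairing f (φ₀ s)‖ ^ 2 * ‖pairing g (φ₁ s)‖ ^ 2 := by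
          refine Finset.sum_congr rfl fun s _ => ?_
          rw [hpair, hpair, norm_coeff_sq]; ring
      _ ≤ _ := key
      _ = _ := by ring
  have hcount : ∀ κ, Countable (α κ) := fun κ => by
    refine Function.Injective.countable (f := fun s : α κ => ((n ⟨κ, s⟩, l₀ ⟨κ, s⟩) : ℤ × ℤ))
      fun s t hst => ?_
    have := hT₀.inj ⟨κ, s⟩ ⟨κ, t⟩ rfl (congrArg Prod.fst hst) (congrArg Prod.snd hst)
    simpa using this
  have hsm : ∀ κ, Summable fun s : α κ => ‖β ⟨κ, s⟩‖ := fun κ =>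
    summable_norm_coeff hT₀ hT₁ hψ₀ hψ₁ hf hg κ
  have hGcont : ∀ κ, Continuous (G κ) := fun κ =>
    continuous_tsum (fun s => continuous_const.mul (hψ₂ _).continuous)
      ((hsm κ).mul_right _) fun s x => norm_coeff_mul_le hB hd₂ f g κ s x
  have hGsum : ∀ κ x, HasSum (fun s : α κ => β ⟨κ, s⟩ * ψ₂ ⟨κ, s⟩ x) (G κ x) := fun κ x =>
    (Summable.of_norm_bounded ((hsm κ).mul_right _)
      fun s => norm_coeff_mul_le hB hd₂ f g κ s x).hasSum
  have hG : ∀ κ, ∫⁻ x in Ωᶜ, ‖G κ x‖ₑ ^ 2 ≤ ENNReal.ofReal (4000 * B ^ 2) *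
      ∑' s : α κ, ENNReal.ofReal ((q ⟨κ, s⟩)⁻¹ ^ 4 * ‖β ⟨κ, s⟩‖ ^ 2) := by
    intro κ
    have := hcount κ
    set g' : Finset (α κ) → ℝ → ℂ := fun P x => ∑ s ∈ P, β ⟨κ, s⟩ * ψ₂ ⟨κ, s⟩ x
    have hgc : ∀ P, Continuous (g' P) := fun P =>
      continuous_finsetSum _ fun s _ => continuous_const.mul (hψ₂ _).continuous
    have hfin : ∀ P, ∫⁻ x in Ωᶜ, ‖g' P x‖ₑ ^ 2 ≤ ENNReal.ofReal (4000 * B ^ 2) *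
        ∑' s : α κ, ENNReal.ofReal ((q ⟨κ, s⟩)⁻¹ ^ 4 * ‖β ⟨κ, s⟩‖ ^ 2) := by
      intro P
      set P' := P.map (Function.Embedding.sigmaMk κ)
      have h1 := setIntegral_norm_sum_sq_le hT₂ hB hψ₂ hd₂ hEm hnear (q := q) (fun s => rfl) κ P'
        (fun s hs => by obtain ⟨a, -, rfl⟩ := Finset.mem_map.1 hs; rfl) β
      simp only [P', Finset.sum_map, Function.Embedding.sigmaMk_apply] at h1
      have hmem : MemLp (g' P) 2 := memLp_finsetSum P fun s _ =>
        ((hψ₂ ⟨κ, s⟩).memLp (zpow_two_pos _)).const_mul (β ⟨κ, s⟩)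
      have hint := (memLp_two_iff_integrable_sq_norm hmem.aestronglyMeasurable).1 hmem
      have e : ∀ x, ‖g' P x‖ₑ ^ 2 = ENNReal.ofReal (‖g' P x‖ ^ 2) := fun x => by
        rw [ENNReal.ofReal_pow (norm_nonneg _), ofReal_norm]
      simp only [e]
      rw [← ofReal_integral_eq_lintegral_ofReal hint.integrableOn
        (.of_forall fun x => by positivity)]
      refine (ENNReal.ofReal_le_ofReal h1).trans ?_
      rw [ENNReal.ofReal_mul (by positivity), ENNReal.ofReal_sum_of_nonneg fun s _ => by
        have := hq0 ⟨κ, s⟩; positivity]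
      gcongr
      exact ENNReal.sum_le_tsum P
    calc ∫⁻ x in Ωᶜ, ‖G κ x‖ₑ ^ 2
        = ∫⁻ x in Ωᶜ, Filter.liminf (fun P => ‖g' P x‖ₑ ^ 2) Filter.atTop := by
          refine lintegral_congr fun x => ?_
          exact (ENNReal.Tendsto.pow (n := 2) (Filter.Tendsto.enorm (hGsum κ x))).liminf_eq.symm
      _ ≤ Filter.liminf (fun P => ∫⁻ x in Ωᶜ, ‖g' P x‖ₑ ^ 2) Filter.atTop :=
          lintegral_liminf_le fun P => (hgc P).enorm.measurable.pow_const 2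
      _ ≤ _ := by
          refine Filter.liminf_le_of_frequently_le' (Filter.Frequently.of_forall fun P => hfin P)
  have htot : ∫⁻ x in Ωᶜ, ∑' κ, ‖G κ x‖ₑ ^ 2 ≤ ENNReal.ofReal (4 * 10 ^ 24 * B ^ 6 * N) := by
    rw [lintegral_tsum fun κ => ((hGcont κ).enorm.measurable.pow_const 2).aemeasurable]
    refine (ENNReal.tsum_le_tsum hG).trans ?_
    rw [ENNReal.tsum_mul_left, ← ENNReal.tsum_sigma' fun s : (Σ κ, α κ) =>
      ENNReal.ofReal ((q s)⁻¹ ^ 4 * ‖β s‖ ^ 2)]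
    have h1 : ∑' s : (Σ κ, α κ), ENNReal.ofReal ((q s)⁻¹ ^ 4 * ‖β s‖ ^ 2) ≤
        ENNReal.ofReal (10 ^ 21 * B ^ 4 * N) := by
      rw [ENNReal.tsum_eq_iSup_sum]
      refine iSup_le fun P => ?_
      rw [← ENNReal.ofReal_sum_of_nonneg fun s _ => by have := hq0 s; positivity]
      exact ENNReal.ofReal_le_ofReal (hsum P)
    calc _ ≤ ENNReal.ofReal (4000 * B ^ 2) * ENNReal.ofReal (10 ^ 21 * B ^ 4 * N) := by gcongr
      _ = _ := by rw [← ENNReal.ofReal_mul (by positivity)]; congr 1; ring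
  calc volume {x | 1 < ∑' κ : ℤ, ‖G κ x‖ₑ ^ 2}
      ≤ volume (Ω ∪ {x | 1 ≤ ∑' κ : ℤ, ‖G κ x‖ₑ ^ 2} ∩ Ωᶜ) := by
        refine measure_mono fun x hx => ?_
        have hx' : 1 < ∑' κ : ℤ, ‖G κ x‖ₑ ^ 2 := hx
        by_cases hxΩ : x ∈ Ω
        · exact .inl hxΩ
        · exact .inr ⟨hx'.le, hxΩ⟩
    _ ≤ volume Ω + volume.restrict Ωᶜ {x | 1 ≤ ∑' κ : ℤ, ‖G κ x‖ₑ ^ 2} := by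
        rw [Measure.restrict_apply' hEm]
        exact measure_union_le _ _
    _ ≤ ENNReal.ofReal (20 * N) + ∫⁻ x in Ωᶜ, ∑' κ, ‖G κ x‖ₑ ^ 2 := by
        refine add_le_add hΩ ?_
        have hm : Measurable fun x => ∑' κ : ℤ, ‖G κ x‖ₑ ^ 2 :=
          Measurable.tsum fun κ => (hGcont κ).enorm.measurable.pow_const 2
        have := mul_meas_ge_le_lintegral (μ := volume.restrict Ωᶜ) hm 1
        simpa using this
    _ ≤ ENNReal.ofReal (20 * N) + ENNReal.ofReal (4 * 10 ^ 24 * B ^ 6 * N) := by gcongr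
    _ = _ := by rw [← ENNReal.ofReal_add (by positivity) (by positivity)]; congr 1; ring

end SquareFunction

/-! ### Multitiles as tile families -/

lemma len_Icc_of_le {a b : ℝ} (h : a ≤ b) : len (Icc a b) = b - a :=
  Real.volume_real_Icc_of_le h

lemma center_Icc {a b : ℝ} (h : a ≤ b) : center (Icc a b) = (a + b) / 2 := by
  rw [center, csInf_Icc h, csSup_Icc h]

/-- The dyadic interval `[2^k n, 2^k (n + 1)]`, given by its midpoint. -/
lemma Icc_time_eq (k n : ℤ) : Icc ((2 : ℝ) ^ k * n) (2 ^ k * (n + 1)) =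
    Icc (timeMid k n - 2 ^ k / 2) (timeMid k n + 2 ^ k / 2) := by
  unfold timeMid; congr 1 <;> ring

lemma Icc_freq_eq (k l : ℤ) : Icc ((l / 5 : ℝ) * 2 ^ (-k)) ((l / 5 + 1 : ℝ) * 2 ^ (-k)) =
    freqBand k l := by
  unfold freqBand freqMid; congr 1 <;> ring

lemma interior_freqBand (k l : ℤ) : interior (freqBand k l) = freqIv k l := interior_Icc

lemma len_freqBand (k l : ℤ) : len (freqBand k l) = 2 ^ (-k) := by
  have := zpow_two_pos (-k)
  rw [freqBand, len_Icc_of_le (by linarith)]; ring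

/-- The closed dyadic interval with midpoint `timeMid k n` and length `2^k`. -/
def timeBand (k n : ℤ) : Set ℝ := Icc (timeMid k n - 2 ^ k / 2) (timeMid k n + 2 ^ k / 2)

lemma interior_timeBand (k n : ℤ) : interior (timeBand k n) = timeIv k n := interior_Icc

lemma len_timeBand (k n : ℤ) : len (timeBand k n) = 2 ^ k := by
  have := zpow_two_pos k
  rw [timeBand, len_Icc_of_le (by linarith)]; ring

lemma center_timeBand (k n : ℤ) : center (timeBand k n) = timeMid k n := by
  have := zpow_two_pos k
  rw [timeBand, center_Icc (by linarith)]; ring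

/-- A multitile of scale `κ` is given by the position of its time interval and the three
frequencies. -/
lemma exists_coordinates {𝒢 : Set (Set ℝ)} {𝒢f : Fin 3 → Set (Set ℝ)} {e : ℤ}
    (h𝒢 : 𝒢 ⊆ standardGrid) {κ : ℤ} {s : Multitile} (hs : s ∈ atScale (multitiles 𝒢 𝒢f e) κ) :
    ∃ (n : ℤ) (l : Fin 3 → ℤ), s.I = timeBand κ n ∧ (∀ j, s.freq j = freqBand κ (l j)) ∧
      l 1 = l 0 + e ∧ l 2 = l 0 + l 1 := by
  obtain ⟨⟨hI, ⟨i', l, hl, -, h1, h2⟩, hlen⟩, hκ⟩ := hs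
  obtain ⟨i, n, hn⟩ := h𝒢 hI
  have hi : i = κ := by
    rw [Icc_time_eq] at hn
    have : len s.I = 2 ^ i := by rw [hn]; exact len_timeBand i n
    rw [hκ] at this
    exact ((zpow_right_inj₀ (by norm_num) (by norm_num)).1 this).symm
  have hi' : i' = -κ := by
    have h3 := hlen 0
    have e1 := Icc_freq_eq (-i') (l 0)
    rw [neg_neg] at e1
    have : len (s.freq 0) = 2 ^ i' := by rw [hl 0, e1, len_freqBand, neg_neg]
    rw [this, hκ, one_div, ← zpow_neg] at h3
    exact (zpow_right_inj₀ (by norm_num) (by norm_num)).1 h3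
  subst hi hi'
  refine ⟨n, l, ?_, fun j => ?_, h1, h2⟩
  · rw [hn, Icc_time_eq]; rfl
  · rw [hl j, Icc_freq_eq]

/-- The multitiles of `S`, seen through the `j`-th frequency, form a family of tiles. -/
lemma isTileFamily_multitiles {𝒢 : Set (Set ℝ)} {𝒢f : Fin 3 → Set (Set ℝ)} {e : ℤ}
    (hgrid : IsGrid 𝒢) (hgridf : ∀ j, IsGrid (𝒢f j)) (hsparse : IsSparse 1000 𝒢)
    {n : (Σ κ, atScale (multitiles 𝒢 𝒢f e) κ) → ℤ}
    {l : (Σ κ, atScale (multitiles 𝒢 𝒢f e) κ) → Fin 3 → ℤ}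
    (hI : ∀ s, s.2.1.I = timeBand s.1 (n s)) (hω : ∀ s j, s.2.1.freq j = freqBand s.1 (l s j))
    (h1 : ∀ s, l s 1 = l s 0 + e) (h2 : ∀ s, l s 2 = l s 0 + l s 1) (j : Fin 3) :
    IsTileFamily Sigma.fst n fun s => l s j where
  inj := by
    rintro ⟨κ, s⟩ ⟨κ', t⟩ hk hn hl
    obtain rfl : κ = κ' := hk
    have h0 : l ⟨κ, s⟩ 0 = l ⟨κ, t⟩ 0 := by
      have a1 := h1 ⟨κ, s⟩
      have a2 := h2 ⟨κ, s⟩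
      have b1 := h1 ⟨κ, t⟩
      have b2 := h2 ⟨κ, t⟩
      fin_cases j <;> simp only [Fin.zero_eta, Fin.mk_one, Fin.reduceFinMk] at hl <;> lia
    have hl' : ∀ j, l ⟨κ, s⟩ j = l ⟨κ, t⟩ j := by
      have a1 := h1 ⟨κ, s⟩
      have a2 := h2 ⟨κ, s⟩
      have b1 := h1 ⟨κ, t⟩
      have b2 := h2 ⟨κ, t⟩
      intro j
      fin_cases j <;> simp only [Fin.zero_eta, Fin.mk_one, Fin.reduceFinMk] <;> lia
    have hst : s = t := by
      refine Subtype.ext (Multitile.ext ?_ ?_)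
      · rw [hI ⟨κ, s⟩, hI ⟨κ, t⟩, hn]
      · funext j
        rw [hω ⟨κ, s⟩, hω ⟨κ, t⟩, hl']
    rw [hst]
  time_nested s t hk := by
    have h := hgrid.nested _ s.2.2.1.1 _ t.2.2.1.1
      (by rw [hI, hI, len_timeBand, len_timeBand]; exact zpow_le_zpow_right₀ (by norm_num) hk)
    rw [hI, hI] at h
    simp only [interior_timeBand] at h
    refine h.imp (fun h => ?_) fun h => h.symm
    rw [← interior_timeBand, ← interior_timeBand]
    exact interior_mono h
  freq_nested s t hk := by
    have hmem : ∀ s : (Σ κ, atScale (multitiles 𝒢 𝒢f e) κ), s.2.1.freq j ∈ 𝒢f j := fun s => by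
      obtain ⟨_, _, -, h, -⟩ := s.2.2.1.2.1
      exact h j
    have h := (hgridf j).nested _ (hmem s) _ (hmem t)
      (by rw [hω, hω, len_freqBand, len_freqBand]
          exact zpow_le_zpow_right₀ (by norm_num) (neg_le_neg hk))
    rw [hω, hω] at h
    simp only [interior_freqBand] at h
    refine h.imp (fun h => ?_) fun h => h.symm
    rw [← interior_freqBand, ← interior_freqBand]
    exact interior_mono h
  sparse s t hk := by
    have hlt : (2 : ℝ) ^ s.1 < 2 ^ t.1 := zpow_lt_zpow_right₀ (by norm_num) hk
    have h := hsparse _ s.2.2.1.1 _ t.2.2.1.1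
      (by rw [hI, hI, len_timeBand, len_timeBand]; exact hlt.ne)
    rw [hI, hI, len_timeBand, len_timeBand] at h
    have p := zpow_two_pos s.1
    rcases le_max_iff.1 h with h | h
    · have h3 : (2 : ℝ) ^ s.1 / 2 ^ t.1 ≤ 1 := (div_le_one (zpow_two_pos _)).2 hlt.le
      have h4 : (1 : ℝ) < 2 ^ 1000 := one_lt_pow₀ (by norm_num) (by norm_num)
      exact absurd (h.trans h3) (not_le.2 h4)
    · rw [← zpow_sub₀ (by norm_num), ← zpow_natCast] at h
      have := (zpow_le_zpow_iff_right₀ (by norm_num)).1 h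
      push_cast at this
      lia

lemma chi_timeBand_pow (k n : ℤ) (x : ℝ) :
    chi (timeBand k n) x ^ 12 = (weight (timeMid k n) (2 ^ k) x)⁻¹ ^ 6 := by
  have e : 1 + (x - center (timeBand k n)) ^ 2 / len (timeBand k n) ^ 2 =
      weight (timeMid k n) (2 ^ k) x := by
    rw [center_timeBand, len_timeBand, weight, div_pow]
  have p := weight_pos (timeMid k n) (2 ^ k) x
  rw [chi, e, ← Real.rpow_mul_natCast p.le, inv_pow, ← Real.rpow_natCast, ← Real.rpow_neg p.le]
  norm_num

lemma rpow_neg_half_eq {x : ℝ} (hx : 0 ≤ x) : x ^ (-(1 / 2) : ℝ) = (√x)⁻¹ := by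
  rw [Real.rpow_neg hx, Real.sqrt_eq_rpow]

lemma IsWavePackets.hasDecay {A : ℕ → ℕ → ℝ} {S : Set Multitile}
    {ψ : Multitile → Fin 3 → ℝ → ℂ} (h : IsWavePackets A S ψ)
    {n : (Σ κ, atScale S κ) → ℤ} (hI : ∀ s, s.2.1.I = timeBand s.1 (n s)) (j : Fin 3) :
    HasDecay Sigma.fst n |A 0 12| fun s : (Σ κ, atScale S κ) => ψ s.2.1 j := by
  intro s x
  have h1 := h.decay _ s.2.2.1 j 0 12 x
  have h2 : ‖iteratedDeriv 0 (modulate (-center (s.2.1.freq j)) (ψ s.2.1 j)) x‖ =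
      ‖ψ s.2.1 j x‖ := by
    rw [iteratedDeriv_zero, modulate, norm_mul]
    have : (2 * Real.pi * Complex.I * ((-center (s.2.1.freq j) : ℝ) : ℂ) * x : ℂ) =
        ((2 * Real.pi * (-center (s.2.1.freq j)) * x : ℝ) : ℂ) * Complex.I := by
      push_cast; ring
    rw [this, Complex.norm_exp_ofReal_mul_I, one_mul]
  rw [h2, hI, len_timeBand, chi_timeBand_pow, Nat.cast_zero, sub_zero,
    rpow_neg_half_eq (zpow_two_pos _).le] at h1
  refine h1.trans ?_
  have := weight_inv_nonneg (timeMid s.1 (n s)) (2 ^ s.1) x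
  gcongr
  exact le_abs_self _

lemma IsWavePackets.isPacketFamily {A : ℕ → ℕ → ℝ} {S : Set Multitile}
    {ψ : Multitile → Fin 3 → ℝ → ℂ} (h : IsWavePackets A S ψ)
    {n : (Σ κ, atScale S κ) → ℤ} {l : (Σ κ, atScale S κ) → Fin 3 → ℤ}
    (hI : ∀ s, s.2.1.I = timeBand s.1 (n s)) (hω : ∀ s j, s.2.1.freq j = freqBand s.1 (l s j))
    (j : Fin 3) :
    IsPacketFamily Sigma.fst n (fun s => l s j) |A 0 12|
      fun s : (Σ κ, atScale S κ) => ψ s.2.1 j := fun s => by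
  refine ⟨(h.smooth _ s.2.2.1 j).continuous, fun x => (h.hasDecay hI j s x).trans ?_, ?_⟩
  · have := pow_le_pow_of_le_one (weight_inv_nonneg (timeMid s.1 (n s)) (2 ^ s.1) x)
      (weight_inv_le_one _ _ _) (show 3 ≤ 6 by lia)
    gcongr
  · have := h.fourier_support _ s.2.2.1 j
    rwa [hω] at this

/-! ### Normalisation -/

lemma pairing_const_mul (a : ℂ) (f h : ℝ → ℂ) :
    pairing (fun x => a * f x) h = a * pairing f h := by
  simp only [pairing, ← integral_const_mul, mul_assoc]

lemma pairing_eq_zero_of_ae {f : ℝ → ℂ} (hf : f =ᵐ[volume] 0) (h : ℝ → ℂ) : pairing f h = 0 := by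
  refine integral_eq_zero_of_ae ?_
  filter_upwards [hf] with x hx
  simp [hx]

lemma modelTerm_const_mul (ψ : Multitile → Fin 3 → ℝ → ℂ) (a b : ℂ) (f g : ℝ → ℂ) (x : ℝ)
    (s : Multitile) : modelTerm ψ (fun x => a * f x) (fun x => b * g x) x s =
      a * b * modelTerm ψ f g x s := by
  simp only [modelTerm, pairing_const_mul]; ring

lemma toReal_eLpNorm_sq {f : ℝ → ℂ} (hf : MemLp f 2) :
    (eLpNorm f 2 volume).toReal ^ 2 = ∫ x, ‖f x‖ ^ 2 := by
  rw [← IsPacketFamily.norm_toLp_sq hf, Lp.norm_toLp]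

/-- By bilinearity, a bound at level `1` that depends on the larger of the two norms implies the
weak-type bound by the product of the norms. -/
lemma weakL1Norm_squareFunction_le {S : Set Multitile} {ψ : Multitile → Fin 3 → ℝ → ℂ} {C : ℝ≥0}
    (h : ∀ f g : ℝ → ℂ, MemLp f 2 volume → MemLp g 2 volume → ∀ N : ℝ, ∫ x, ‖f x‖ ^ 2 ≤ N →
      ∫ x, ‖g x‖ ^ 2 ≤ N →
      volume {x | 1 < ∑' κ : ℤ, ‖∑' s : atScale S κ, modelTerm ψ f g x s‖ₑ ^ 2} ≤
        ENNReal.ofReal (C * N))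
    {f g : ℝ → ℂ} (hf : MemLp f 2 volume) (hg : MemLp g 2 volume) :
    weakL1Norm (squareFunction S ψ f g) ≤ C * eLpNorm f 2 volume * eLpNorm g 2 volume := by
  have hzero : (∀ x s, modelTerm ψ f g x s = 0) →
      weakL1Norm (squareFunction S ψ f g) ≤ C * eLpNorm f 2 volume * eLpNorm g 2 volume := by
    intro hz
    have : squareFunction S ψ f g = fun _ => 0 := by
      funext x
      simp [squareFunction, hz]
    simp [weakL1Norm, this]
  by_cases hf0 : eLpNorm f 2 volume = 0
  · have := (eLpNorm_eq_zero_iff hf.aestronglyMeasurable two_ne_zero).1 hf0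
    exact hzero fun x s => by simp [modelTerm, pairing_eq_zero_of_ae this]
  by_cases hg0 : eLpNorm g 2 volume = 0
  · have := (eLpNorm_eq_zero_iff hg.aestronglyMeasurable two_ne_zero).1 hg0
    exact hzero fun x s => by simp [modelTerm, pairing_eq_zero_of_ae this]
  refine iSup_le fun t => ?_
  rcases eq_or_ne t 0 with rfl | ht0
  · simp
  have ht : (0 : ℝ) < t := by exact_mod_cast pos_iff_ne_zero.2 ht0
  set a := (eLpNorm f 2 volume).toReal
  set b := (eLpNorm g 2 volume).toReal
  have ha : 0 < a := ENNReal.toReal_pos hf0 hf.eLpNorm_ne_top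
  have hb : 0 < b := ENNReal.toReal_pos hg0 hg.eLpNorm_ne_top
  set u := √(b / (a * t))
  set v := √(a / (b * t))
  have hu : u ^ 2 = b / (a * t) := Real.sq_sqrt (by positivity)
  have hv : v ^ 2 = a / (b * t) := Real.sq_sqrt (by positivity)
  have huv : u * v = (t : ℝ)⁻¹ := by
    rw [← Real.sqrt_mul (by positivity)]
    have : b / (a * t) * (a / (b * t)) = ((t : ℝ)⁻¹) ^ 2 := by field_simp
    rw [this, Real.sqrt_sq (by positivity)]
  have hnorm : ∀ (c : ℝ) (f : ℝ → ℂ),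
      ∫ x, ‖(c : ℂ) * f x‖ ^ 2 = c ^ 2 * ∫ x, ‖f x‖ ^ 2 := fun c f => by
    rw [← integral_const_mul]
    congr 1; ext x
    rw [norm_mul, Complex.norm_real, Real.norm_eq_abs, mul_pow, sq_abs]
  have key := h (fun x => (u : ℂ) * f x) (fun x => (v : ℂ) * g x) (hf.const_mul _)
    (hg.const_mul _) (a * b / t)
    (by rw [hnorm, ← toReal_eLpNorm_sq hf, hu]; apply le_of_eq; field_simp; rfl)
    (by rw [hnorm, ← toReal_eLpNorm_sq hg, hv]; apply le_of_eq; field_simp; rfl)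
  have htE : (t : ℝ≥0∞) ≠ 0 := by exact_mod_cast ht0
  have hsub : {x | (t : ℝ≥0∞) < squareFunction S ψ f g x} ⊆
      {x | 1 < ∑' κ : ℤ, ‖∑' s : atScale S κ,
        modelTerm ψ (fun x => (u : ℂ) * f x) (fun x => (v : ℂ) * g x) x s‖ₑ ^ 2} := by
    intro x hx
    have hx1 : (t : ℝ≥0∞) < squareFunction S ψ f g x := hx
    have hx2 : (t : ℝ≥0∞) ^ 2 < ∑' κ : ℤ, ‖∑' s : atScale S κ, modelTerm ψ f g x s‖ₑ ^ 2 := by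
      have h1 := ENNReal.rpow_lt_rpow hx1 (show (0 : ℝ) < 2 by norm_num)
      rw [squareFunction, ← ENNReal.rpow_mul] at h1
      norm_num at h1
      exact h1
    have e : ∀ κ : ℤ, ‖∑' s : atScale S κ,
        modelTerm ψ (fun x => (u : ℂ) * f x) (fun x => (v : ℂ) * g x) x s‖ₑ ^ 2 =
        ((t : ℝ≥0∞)⁻¹) ^ 2 * ‖∑' s : atScale S κ, modelTerm ψ f g x s‖ₑ ^ 2 := by
      intro κ
      simp only [modelTerm_const_mul]
      rw [tsum_mul_left, enorm_mul, mul_pow]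
      congr 2
      rw [← Complex.ofReal_mul, huv, ← ofReal_norm, Complex.norm_real,
        Real.norm_of_nonneg (by positivity), ENNReal.ofReal_inv_of_pos ht,
        ENNReal.ofReal_coe_nnreal]
    rw [mem_ofPred_eq]
    simp only [e]
    rw [ENNReal.tsum_mul_left]
    have h3 : ((t : ℝ≥0∞)⁻¹) ^ 2 * (t : ℝ≥0∞) ^ 2 = 1 := by
      rw [← mul_pow, ENNReal.inv_mul_cancel htE ENNReal.coe_ne_top, one_pow]
    rw [← h3]
    exact ENNReal.mul_lt_mul_right (by simp) (by simp [htE]) hx2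
  calc (t : ℝ≥0∞) * volume {x | (t : ℝ≥0∞) < squareFunction S ψ f g x}
      ≤ t * ENNReal.ofReal (C * (a * b / t)) := by
        gcongr
        exact (measure_mono hsub).trans key
    _ = ENNReal.ofReal (C * a * b) := by
        rw [← ENNReal.ofReal_coe_nnreal (p := t), ← ENNReal.ofReal_mul ht.le]
        congr 1; field_simp
    _ = C * eLpNorm f 2 volume * eLpNorm g 2 volume := by
        rw [ENNReal.ofReal_mul (by positivity), ENNReal.ofReal_mul (by positivity),
          ENNReal.ofReal_coe_nnreal, ENNReal.ofReal_toReal hf.eLpNorm_ne_top,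
          ENNReal.ofReal_toReal hg.eLpNorm_ne_top]

end BilinearModel

theorem theorem8p1 (A : ℕ → ℕ → ℝ) :
    ∃ C : ℝ≥0, ∀ (𝒢 : Set (Set ℝ)) (𝒢f : Fin 3 → Set (Set ℝ)) (e : ℤ)
      (ψ : Multitile → Fin 3 → ℝ → ℂ),
      IsGrid 𝒢 → (∀ j, IsGrid (𝒢f j)) → 𝒢 ⊆ standardGrid → IsSparse 1000 𝒢 →
      10 ^ 2 < |e| → |e| ≤ 10 ^ 5 →
      IsWavePackets A (multitiles 𝒢 𝒢f e) ψ →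
      ∀ f g : ℝ → ℂ, MemLp f 2 volume → MemLp g 2 volume →
        (∀ (k : ℤ) (x : ℝ),
          Summable fun s : atScale (multitiles 𝒢 𝒢f e) k => modelTerm ψ f g x s) ∧
        weakL1Norm (squareFunction (multitiles 𝒢 𝒢f e) ψ f g) ≤
          C * eLpNorm f 2 volume * eLpNorm g 2 volume := by
  refine ⟨(20 + 4 * 10 ^ 24 * |A 0 12| ^ 6).toNNReal,
    fun 𝒢 𝒢f e ψ hgrid hgridf h𝒢 hsparse he he' hψ => ?_⟩
  choose n l hI hω h1 h2 using fun s : (Σ κ, atScale (multitiles 𝒢 𝒢f e) κ) =>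
    exists_coordinates h𝒢 s.2.2
  have hT := isTileFamily_multitiles hgrid hgridf hsparse hI hω h1 h2
  have hpk := hψ.isPacketFamily hI hω
  have hdec := hψ.hasDecay hI
  have hterm : ∀ (f g : ℝ → ℂ) (x : ℝ) (κ : ℤ) (s : atScale (multitiles 𝒢 𝒢f e) κ),
      modelTerm ψ f g x s = coeff Sigma.fst (fun s => ψ s.2.1 0) (fun s => ψ s.2.1 1) f g
        (⟨κ, s⟩ : Σ κ, atScale (multitiles 𝒢 𝒢f e) κ) * ψ s.1 2 x := by
    intro f g x κ s
    rw [modelTerm, coeff, hI ⟨κ, s⟩, len_timeBand, rpow_neg_half_eq (zpow_two_pos _).le]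
  intro f g hf hg
  refine ⟨fun κ x => ?_, weakL1Norm_squareFunction_le (fun f g hf hg N hfN hgN => ?_) hf hg⟩
  · simp only [hterm]
    exact Summable.of_norm_bounded
      ((summable_norm_coeff (hT 0) (hT 1) (hpk 0) (hpk 1) hf hg κ).mul_right _)
      fun s => norm_coeff_mul_le (abs_nonneg _) (hdec 2) f g κ s x
  · rw [Real.coe_toNNReal _ (by positivity)]
    simp only [hterm]
    exact volume_lt_squareFunction_le he he' h1 (hT 0) (hT 1) (hT 2) (abs_nonneg _) (hpk 0)
      (hpk 1) (hpk 2) (hdec 0) (hdec 1) (hdec 2) hf hg hfN hgN
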